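/- Let $e\ge 0$, let $N=\langle\sigma\rangle$ be a cyclic group of order $2^e$, and let $\mathrm{Hol}(N)=N\rtimes\mathrm{Aut}(N)$ be its holomorph, whose elements are written $[\eta,\varphi]$ with $\eta\in N$, $\varphi\in\mathrm{Aut}(N)$, with multiplication $[\eta,\varphi][\mu,\psi]=[\eta\,\varphi(\mu),\varphi\psi]$. It acts on $N$ by $[\eta,\varphi]\cdot x=\eta\,\varphi(x)$, and $N$ and $\mathrm{Aut}(N)$ are regarded as subgroups of $\mathrm{Hol}(N)$ via $\eta\mapsto[\eta,1]$ and $\varphi\mapsto[1,\varphi]$. A subgroup $T$ of $\mathrm{Hol}(N)$ is called transitive if it acts transitively on $N$, and $\mathrm{Stab}_T(1_N)$ is the stabiliser in $T$ of the identity $1_N$ of $N$. For an odd integer $a$, let $\varphi_a\in\mathrm{Aut}(N)$ be the automorphism with $\varphi_a(\sigma)=\sigma^a$. Let $G$ be a transitive subgroup of $\mathrm{Hol}(N)$, let $H$ be a subgroup of $G$ of index $2^e$, and let $C=\mathrm{Core}_G(H)$ be the largest normal subgroup of $G$ contained in $H$. Then the following are equivalent: (1) There is no transitive subgroup $T$ of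 $\mathrm{Hol}(N)$ such that $G/C$ is isomorphic to $T$ under an isomorphism that takes $H/C$ to $\mathrm{Stab}_T(1_N)$. (2) At least one of the following holds: (i) $|H\cap N|\ge 4$; (ii) $|H\cap N|=2$ and $G$ has no element of order $2^e$; (iii) $|H\cap N|=2$ and $H$ is not normal in $G$; (iv) $|H\cap N|=1$, $H=\langle[\sigma^u,\varphi_{-1}]\rangle$ for some odd integer $u$, $|G|=2^{e+1}$, $\mathrm{Stab}_G(1_N)=\langle\varphi_{1+2^{e-1}}\rangle$, and either $|G\cap N|\ge 8$ or $|G\cap N|=|[G,G]|=4$. (For $e\le 1$ none of (i)–(iv) can occur: then $\mathrm{Hol}(N)=N$, so $G=N$ and $H=1$, whence $|G|\ne 2^{e+1}$ and condition (iv) fails regardless of the meaning of $\varphi_{1+2^{e-1}}$.) -/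

import Mathlib

/-- The holomorph `Hol(N) = N ⋊ Aut(N)`: pairs `[η, φ]` with
`[η, φ] * [μ, ψ] = [η * φ μ, φ * ψ]`. -/
abbrev Hol (N : Type*) [Group N] : Type _ :=
  SemidirectProduct N (MulAut N) (MonoidHom.id (MulAut N))

/-- The standard action of the holomorph on `N`: `[η, φ] • x = η * φ x`. -/
instance Hol.instMulAction (N : Type*) [Group N] : MulAction (Hol N) N where
  smul g x := g.left * g.right x
  one_smul x := by
    change (1 : N) * (1 : MulAut N) x = x
    simp
  mul_smul g h x := by
    change (g * h).left * (g * h).right x = g.left * g.right (h.left * h.right x)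
    simp [mul_assoc]

theorem Hol.smul_def {N : Type*} [Group N] (g : Hol N) (x : N) :
    g • x = g.left * g.right x := rfl

/-- The copy of `N` inside `Hol(N)`, i.e. the subgroup of all `[η, 1]`. -/
def Hol.base (N : Type*) [Group N] : Subgroup (Hol N) :=
  (SemidirectProduct.inl : N →* Hol N).range

/-- `Stab_T(1_N)` as a subgroup of `T`, for a subgroup `T` of `Hol(N)`. -/
def Hol.stab {N : Type*} [Group N] (T : Subgroup (Hol N)) : Subgroup T :=
  MulAction.stabilizer T (1 : N)

open Classical in
/-- The automorphism `φ_a : x ↦ x ^ a` of an abelian group `N`. When the `a`-th power map is not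
bijective, in which case there is no such automorphism, the value is the identity. -/
noncomputable def powAut (N : Type*) [CommGroup N] (a : ℤ) : MulAut N :=
  if h : Function.Bijective (zpowGroupHom a : N →* N) then
    MulEquiv.ofBijective (zpowGroupHom a : N →* N) h
  else 1

/-- For `N` of order `2 ^ e` and `a` odd, `powAut N a` really is the map `x ↦ x ^ a`. -/
theorem powAut_apply {N : Type*} [CommGroup N] {e : ℕ} (hN : Nat.card N = 2 ^ e)
    {a : ℤ} (ha : Odd a) (x : N) : powAut N a x = x ^ a := by
  have hfin : Finite N := Nat.finite_of_card_ne_zero (by rw [hN]; positivity)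
  have hinj : Function.Injective (zpowGroupHom a : N →* N) := by
    rw [injective_iff_map_eq_one]
    intro y hy
    have h1 : (orderOf y : ℤ) ∣ a := orderOf_dvd_iff_zpow_eq_one.2 hy
    have h2 : orderOf y ∣ 2 ^ e := hN ▸ orderOf_dvd_natCard y
    have hc : IsCoprime ((2 : ℤ) ^ e) a := (Int.isCoprime_two_left.2 ha).pow_left
    have h3 : IsUnit (orderOf y : ℤ) := hc.isUnit_of_dvd' (by exact_mod_cast h2) h1
    exact orderOf_eq_one_iff.1 (by simpa [Int.isUnit_iff] using h3)
  have hb : Function.Bijective (zpowGroupHom a : N →* N) :=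
    Finite.injective_iff_bijective.1 hinj
  simp [powAut, hb]

/-- The quotient `G/C` by the core `C` of `H` in `G` is isomorphic to a transitive subgroup `T` of
`Hol(N)` under an isomorphism that takes `H/C` to the stabiliser `Stab_T(1_N)`.
Here `H` is a subgroup of `G`. -/
def IsRealizable {N : Type*} [Group N] {G : Subgroup (Hol N)} (H : Subgroup G) : Prop :=
  ∃ T : Subgroup (Hol N), MulAction.IsPretransitive T N ∧
    ∃ f : (G ⧸ H.normalCore) ≃* T,
      (H.map (QuotientGroup.mk' H.normalCore)).map f.toMonoidHom = Hol.stab T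

/-! Identify `N` with ℤ/2^e, so that Hol(N) becomes the group of maps x ↦ ax + b with a a unit. As
`H` has index 2^e, the required isomorphism exists exactly when `H` is the stabiliser of 0 in some
second, possibly unfaithful, affine action B of `G` (`Hol.isRealizable_iff`). Write A for the given
faithful transitive action. The main tool is that 1 + a + ⋯ + a^(m-1) is m times a unit when a ≡ 1
mod 4 (`geom_sum_eq`). Hence x ↦ ax + b with b odd is then a 2^e-cycle, while for e ≥ 3 every unit
satisfies a^(2^(e-2)) = 1.

Necessity. Transitivity of B yields t for which t^(2^(e-2)) moves 0 in B. In A, for e ≥ 3, this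
power is a translation killed by 4. If |H ∩ N| ≥ 4, such translations lie in `H`, a contradiction.
If |H ∩ N| = 2, the power is not killed by 2, so t has order 2^e, and comparing commutators in A and
B shows that `H` is normal (`Faithful.normal_of_card`). In the reflection case (iv), the generator h
of `H` acts in B with linear part 1 + 2^(e-1) or ≡ 3 mod 4. The first makes all commutators with h
involutive, so that G ∩ N or [G, G] is too small. The second contradicts that commutators in A
translate by multiples of 4 (`Faithful.not_isAffineStabilizer`).

Sufficiency. If |H ∩ N| = 2, `H` is normal and `G` has an element of order 2^e, then G/H has order
2^e and a cyclic subgroup of index two; every such group acts regularly by affine maps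
(`isAffineStabilizer_bot`). If H ∩ N = 1, the linear part is injective on `H`, so `H` has at most
two generators, and one of three things happens (`Faithful.isAffineStabilizer_or`): `H` fixes a
point and A itself works after a shift; `H` is a twisted subgroup and an explicit modification of A
works (`IsTwisted.isAffineStabilizer`); or `H` is generated by a reflection x ↦ u - x with u odd. In
the last case B exists if `G` is dihedral, or if |G ∩ N| = 4 and |[G, G]| ≤ 2; what remains is (iv).
-/

namespace ZModTwoPow

/-! ### Arithmetic in ℤ/2^e. -/

variable {e : ℕ}

theorem two_pow_self : (2 : ZMod (2 ^ e)) ^ e = 0 := by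
  have h := ZMod.natCast_self (2 ^ e)
  push_cast at h
  exact h

theorem two_pow_eq_zero {i : ℕ} (hi : e ≤ i) : (2 : ZMod (2 ^ e)) ^ i = 0 := by
  rw [← Nat.sub_add_cancel hi, pow_add, two_pow_self, mul_zero]

theorem exists_int (x : ZMod (2 ^ e)) : ∃ z : ℤ, (z : ZMod (2 ^ e)) = x :=
  ZMod.intCast_surjective x

theorem intCast_eq_zero (z : ℤ) : (z : ZMod (2 ^ e)) = 0 ↔ (2 : ℤ) ^ e ∣ z := by
  rw [ZMod.intCast_zmod_eq_zero_iff_dvd]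
  push_cast
  rfl

theorem two_pow_dvd_intCast {i : ℕ} (hi : i ≤ e) (z : ℤ) :
    (2 : ZMod (2 ^ e)) ^ i ∣ (z : ZMod (2 ^ e)) ↔ (2 : ℤ) ^ i ∣ z := by
  constructor
  · rintro ⟨x, hx⟩
    obtain ⟨y, rfl⟩ := exists_int x
    have h : ((z - 2 ^ i * y : ℤ) : ZMod (2 ^ e)) = 0 := by push_cast; rw [hx]; ring
    rw [intCast_eq_zero] at h
    have h2 := (pow_dvd_pow (2 : ℤ) hi).trans h
    have := dvd_add h2 (Dvd.intro y rfl : (2 : ℤ) ^ i ∣ 2 ^ i * y)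
    simpa using this
  · rintro ⟨y, rfl⟩
    exact ⟨y, by push_cast; rfl⟩

/-- Multiplication by `2 ^ j` kills exactly the multiples of `2 ^ (e - j)`. -/
theorem two_pow_mul_eq_zero {i j : ℕ} (h : i + j = e) (x : ZMod (2 ^ e)) :
    2 ^ j * x = 0 ↔ (2 : ZMod (2 ^ e)) ^ i ∣ x := by
  obtain ⟨z, rfl⟩ := exists_int x
  rw [two_pow_dvd_intCast (by omega)]
  have : (2 : ZMod (2 ^ e)) ^ j * (z : ZMod (2 ^ e)) = ((2 ^ j * z : ℤ) : ZMod (2 ^ e)) := by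
    push_cast; rfl
  rw [this, intCast_eq_zero, ← h, pow_add, mul_comm]
  exact mul_dvd_mul_iff_left (by positivity)

theorem dvd_of_two_pow_mul_dvd {i j : ℕ} (h : j + i ≤ e) {x : ZMod (2 ^ e)}
    (hx : (2 : ZMod (2 ^ e)) ^ (j + i) ∣ 2 ^ j * x) : (2 : ZMod (2 ^ e)) ^ i ∣ x := by
  obtain ⟨z, rfl⟩ := exists_int x
  have : (2 : ZMod (2 ^ e)) ^ j * (z : ZMod (2 ^ e)) = ((2 ^ j * z : ℤ) : ZMod (2 ^ e)) := by
    push_cast; rfl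
  rw [this, two_pow_dvd_intCast h, pow_add] at hx
  rw [two_pow_dvd_intCast (by omega)]
  exact (mul_dvd_mul_iff_left (by positivity)).1 hx

theorem isUnit_intCast_of_odd {z : ℤ} (hz : Odd z) : IsUnit (z : ZMod (2 ^ e)) := by
  have hc : IsCoprime ((2 : ℤ) ^ e) z := (Int.isCoprime_two_left.2 hz).pow_left
  obtain ⟨x, y, hxy⟩ := hc
  have := congrArg (Int.cast : ℤ → ZMod (2 ^ e)) hxy
  push_cast at this
  rw [two_pow_self, mul_zero, zero_add] at this
  exact IsUnit.of_mul_eq_one_right _ this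

theorem isUnit_of_not_two_dvd {x : ZMod (2 ^ e)} (hx : ¬ 2 ∣ x) : IsUnit x := by
  obtain ⟨z, rfl⟩ := exists_int x
  apply isUnit_intCast_of_odd
  by_contra h
  rw [Int.not_odd_iff_even] at h
  obtain ⟨y, rfl⟩ := h.two_dvd
  exact hx ⟨y, by push_cast; rfl⟩

theorem two_dvd_or_isUnit (x : ZMod (2 ^ e)) : 2 ∣ x ∨ IsUnit x :=
  or_iff_not_imp_left.2 isUnit_of_not_two_dvd

theorem not_two_dvd_of_isUnit (he : 1 ≤ e) {x : ZMod (2 ^ e)} (hx : IsUnit x) : ¬ 2 ∣ x := by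
  intro h
  have h2 : IsUnit (2 : ZMod (2 ^ e)) := isUnit_of_dvd_unit h hx
  have := h2.pow e
  rw [two_pow_self, isUnit_zero_iff] at this
  have h3 : ((1 : ℤ) : ZMod (2 ^ e)) = 0 := by push_cast; exact this.symm
  rw [intCast_eq_zero] at h3
  have h4 : (2 : ℤ) ^ 1 ∣ 1 := (pow_dvd_pow 2 he).trans h3
  norm_num at h4

theorem isUnit_add_of_two_dvd {x y : ZMod (2 ^ e)} (hx : IsUnit x) (hy : 2 ∣ y) :
    IsUnit (x + y) := by
  rcases Nat.eq_zero_or_pos e with rfl | he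
  · have : Subsingleton (ZMod (2 ^ 0)) := by rw [pow_zero]; infer_instance
    rwa [Subsingleton.elim (x + y) x]
  · apply isUnit_of_not_two_dvd
    intro h
    exact not_two_dvd_of_isUnit he hx ((dvd_add_left hy).1 h)

theorem two_dvd_add_of_isUnit {x y : ZMod (2 ^ e)} (hx : IsUnit x) (hy : IsUnit y) :
    2 ∣ x + y := by
  rcases two_dvd_or_isUnit (x + y) with h | h
  · exact h
  rcases Nat.eq_zero_or_pos e with rfl | he
  · have : Subsingleton (ZMod (2 ^ 0)) := by rw [pow_zero]; infer_instance
    exact ⟨0, Subsingleton.elim _ _⟩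
  obtain ⟨a, rfl⟩ := exists_int x
  obtain ⟨b, rfl⟩ := exists_int y
  have key : ∀ z : ℤ, IsUnit (z : ZMod (2 ^ e)) → Odd z := by
    intro z hz
    by_contra h
    rw [Int.not_odd_iff_even] at h
    obtain ⟨y, rfl⟩ := h.two_dvd
    exact not_two_dvd_of_isUnit he hz ⟨y, by push_cast; rfl⟩
  obtain ⟨c, hc⟩ := (key a hx).add_odd (key b hy)
  exact ⟨c, by rw [← Int.cast_add, hc]; push_cast; ring⟩

theorem four_dvd_or {a : ZMod (2 ^ e)} (ha : IsUnit a) : 4 ∣ a - 1 ∨ 4 ∣ a + 1 := by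
  rcases Nat.eq_zero_or_pos e with rfl | he
  · have : Subsingleton (ZMod (2 ^ 0)) := by rw [pow_zero]; infer_instance
    exact Or.inl ⟨0, Subsingleton.elim _ _⟩
  obtain ⟨z, rfl⟩ := exists_int a
  have hz : Odd z := by
    by_contra h
    rw [Int.not_odd_iff_even] at h
    obtain ⟨y, rfl⟩ := h.two_dvd
    exact not_two_dvd_of_isUnit he ha ⟨y, by push_cast; rfl⟩
  obtain ⟨k, rfl⟩ := hz
  rcases Int.even_or_odd' k with ⟨m, rfl | rfl⟩
  · exact Or.inl ⟨m, by push_cast; ring⟩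
  · exact Or.inr ⟨m + 1, by push_cast; ring⟩

theorem not_four_dvd_two (he : 2 ≤ e) : ¬ (4 : ZMod (2 ^ e)) ∣ 2 := by
  intro h
  have h1 : (2 : ZMod (2 ^ e)) ^ 2 ∣ ((2 : ℤ) : ZMod (2 ^ e)) := by
    push_cast; norm_num; exact h
  rw [two_pow_dvd_intCast he] at h1
  norm_num at h1

theorem not_four_dvd_both (he : 2 ≤ e) {a : ZMod (2 ^ e)} (h1 : 4 ∣ a - 1) : ¬ 4 ∣ a + 1 := by
  intro h2
  apply not_four_dvd_two he
  have := dvd_sub h2 h1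
  ring_nf at this
  exact this

theorem isUnit_of_four_dvd {a : ZMod (2 ^ e)} (h : 4 ∣ a - 1) : IsUnit a := by
  have := isUnit_add_of_two_dvd (isUnit_one) ((show (2 : ZMod (2 ^ e)) ∣ 4 from ⟨2, by norm_num⟩).trans h)
  simpa using this

/-- Every element is a power of two times a unit. -/
theorem exists_two_pow_mul (x : ZMod (2 ^ e)) :
    ∃ k ≤ e, ∃ u : ZMod (2 ^ e), IsUnit u ∧ x = 2 ^ k * u := by
  by_cases hx : x = 0
  · exact ⟨e, le_rfl, 1, isUnit_one, by rw [hx, two_pow_self, zero_mul]⟩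
  obtain ⟨z, rfl⟩ := ZMod.natCast_zmod_surjective x
  have hz : z ≠ 0 := by rintro rfl; simp at hx
  obtain ⟨k, m, hm, rfl⟩ := Nat.exists_eq_two_pow_mul_odd hz
  have hm2 := isUnit_intCast_of_odd (e := e) ((Int.odd_coe_nat m).2 hm)
  rw [Int.cast_natCast] at hm2
  refine ⟨k, ?_, m, hm2, by push_cast; rfl⟩
  by_contra h
  apply hx
  push_cast
  rw [two_pow_eq_zero (by omega), zero_mul]

theorem two_pow_ne_zero {k : ℕ} (hk : k < e) : (2 : ZMod (2 ^ e)) ^ k ≠ 0 := by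
  intro h
  have h1 : (((2 : ℤ) ^ k : ℤ) : ZMod (2 ^ e)) = 0 := by push_cast; exact h
  rw [intCast_eq_zero] at h1
  have := (Int.natAbs_dvd_natAbs.2 h1)
  rw [Int.natAbs_pow, Int.natAbs_pow] at this
  have := (Nat.pow_dvd_pow_iff_le_right (by norm_num)).1 this
  omega

theorem two_pow_mul_unit_eq_zero {k : ℕ} {u : ZMod (2 ^ e)} (hu : IsUnit u) :
    2 ^ k * u = 0 ↔ e ≤ k := by
  rw [hu.mul_left_eq_zero]
  constructor
  · intro h
    by_contra hk
    exact two_pow_ne_zero (by omega) h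
  · exact two_pow_eq_zero

theorem two_pow_mul_self_eq {x : ZMod (2 ^ e)} (he : 1 ≤ e) (hx : IsUnit x) :
    2 ^ (e - 1) * x = 2 ^ (e - 1) := by
  have h : (2 : ZMod (2 ^ e)) ^ (e - 1) * (x - 1) = 0 := by
    rw [two_pow_mul_eq_zero (i := 1) (by omega), pow_one]
    simpa [sub_eq_add_neg] using two_dvd_add_of_isUnit hx isUnit_one.neg
  linear_combination h

theorem two_pow_pred_mul_even {x : ZMod (2 ^ e)} (he : 1 ≤ e) (hx : 2 ∣ x) :
    2 ^ (e - 1) * x = 0 := by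
  rw [two_pow_mul_eq_zero (i := 1) (by omega), pow_one]
  exact hx

theorem two_mul_two_pow_pred (he : 1 ≤ e) : 2 * (2 : ZMod (2 ^ e)) ^ (e - 1) = 0 := by
  rw [← pow_succ', Nat.sub_add_cancel he, two_pow_self]

/-- The elements killed by two. -/
theorem eq_zero_or_of_two_mul (he : 1 ≤ e) {x : ZMod (2 ^ e)} (hx : 2 * x = 0) :
    x = 0 ∨ x = 2 ^ (e - 1) := by
  have h : (2 : ZMod (2 ^ e)) ^ (e - 1) ∣ x :=
    (two_pow_mul_eq_zero (i := e - 1) (j := 1) (by omega) x).1 (by simpa using hx)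
  obtain ⟨y, rfl⟩ := h
  rcases two_dvd_or_isUnit y with hy | hy
  · exact Or.inl (two_pow_pred_mul_even he hy)
  · exact Or.inr (two_pow_mul_self_eq he hy)

theorem two_pow_pred_dvd (he : 1 ≤ e) {x : ZMod (2 ^ e)} (hx : 2 ^ (e - 1) ∣ x) :
    x = 0 ∨ x = 2 ^ (e - 1) := by
  obtain ⟨y, rfl⟩ := hx
  rcases two_dvd_or_isUnit y with hy | hy
  · exact Or.inl (two_pow_pred_mul_even he hy)
  · exact Or.inr (two_pow_mul_self_eq he hy)

theorem unit_eq_add {a : ZMod (2 ^ e)} (ha : IsUnit a) : ∃ k, a = 1 + 2 * k := by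
  have := two_dvd_add_of_isUnit ha isUnit_one.neg
  obtain ⟨k, hk⟩ := this
  exact ⟨k, by linear_combination hk⟩

theorem four_dvd_pow_sub_one {a : ZMod (2 ^ e)} (h : 4 ∣ a - 1) (m : ℕ) : 4 ∣ a ^ m - 1 :=
  h.trans (sub_one_dvd_pow_sub_one a m)

/-- If `a ≡ 1` modulo `4`, then `1 + a + ⋯ + a ^ (m - 1)` is `m` times a unit. -/
theorem geom_sum_eq {a : ZMod (2 ^ e)} (h : 4 ∣ a - 1) (m : ℕ) :
    ∃ w, IsUnit w ∧ ∑ i ∈ Finset.range m, a ^ i = m * w := by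
  induction m using Nat.strong_induction_on with
  | _ m ih =>
  rcases Nat.eq_zero_or_pos m with rfl | hm
  · exact ⟨1, isUnit_one, by simp⟩
  rcases Nat.even_or_odd' m with ⟨k, rfl | rfl⟩
  · obtain ⟨w, hw, hk⟩ := ih k (by omega)
    obtain ⟨s, hs⟩ := four_dvd_pow_sub_one h k
    -- The sum of length 2k is (1 + a^k) times the sum of length k, and 1 + a^k is twice a unit
    -- because a^k ≡ 1 mod 4.
    refine ⟨(1 + 2 * s) * w, (isUnit_add_of_two_dvd isUnit_one ⟨s, rfl⟩).mul hw, ?_⟩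
    rw [two_mul, Finset.sum_range_add]
    simp_rw [pow_add, ← Finset.mul_sum]
    rw [hk]
    push_cast
    linear_combination (k * w) * hs
  · have h1 : IsUnit (((2 * k + 1 : ℕ) : ℤ) : ZMod (2 ^ e)) :=
      isUnit_intCast_of_odd ⟨k, by push_cast; ring⟩
    rw [Int.cast_natCast] at h1
    have h2 : IsUnit (∑ i ∈ Finset.range (2 * k + 1), a ^ i) := by
      have : ∑ i ∈ Finset.range (2 * k + 1), a ^ i =
          ((2 * k + 1 : ℕ) : ZMod (2 ^ e)) + ∑ i ∈ Finset.range (2 * k + 1), (a ^ i - 1) := by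
        rw [Finset.sum_sub_distrib]; simp
      rw [this]
      refine isUnit_add_of_two_dvd h1 (Finset.dvd_sum fun i _ => ?_)
      exact (show (2 : ZMod (2 ^ e)) ∣ 4 from ⟨2, by norm_num⟩).trans (four_dvd_pow_sub_one h i)
    obtain ⟨u, hu⟩ := h1
    refine ⟨↑u⁻¹ * _, (Units.isUnit _).mul h2, ?_⟩
    rw [← hu, ← mul_assoc, Units.mul_inv, one_mul]

theorem geom_sum_eq_zero {a : ZMod (2 ^ e)} (h : 4 ∣ a - 1) (m : ℕ) :
    ∑ i ∈ Finset.range m, a ^ i = 0 ↔ 2 ^ e ∣ m := by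
  obtain ⟨w, hw, hs⟩ := geom_sum_eq h m
  rw [hs, hw.mul_left_eq_zero, ZMod.natCast_eq_zero_iff]

/-- The partial sums for m < 2^e are pairwise distinct by `geom_sum_eq_zero`, and there are 2^e of
them. -/
theorem geom_sum_surjective {a : ZMod (2 ^ e)} (h : 4 ∣ a - 1) (w : ZMod (2 ^ e)) :
    ∃ m : ℕ, ∑ i ∈ Finset.range m, a ^ i = w := by
  have hinj : Function.Injective
      (fun m : Fin (2 ^ e) => ∑ i ∈ Finset.range (m : ℕ), a ^ i) := by
    have key : ∀ m n : ℕ, m ≤ n → n < 2 ^ e → ∑ i ∈ Finset.range m, a ^ i =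
        ∑ i ∈ Finset.range n, a ^ i → m = n := by
      intro m n hmn hn hs
      obtain ⟨k, rfl⟩ := Nat.exists_eq_add_of_le hmn
      rw [Finset.sum_range_add] at hs
      simp_rw [pow_add, ← Finset.mul_sum] at hs
      have h0 : a ^ m * ∑ i ∈ Finset.range k, a ^ i = 0 := by linear_combination -hs
      rw [((isUnit_of_four_dvd h).pow m).mul_right_eq_zero, geom_sum_eq_zero h] at h0
      have := Nat.eq_zero_of_dvd_of_lt h0 (by omega)
      omega
    intro m n hs
    rcases le_total (m : ℕ) n with hmn | hmn
    · exact Fin.ext (key _ _ hmn n.2 hs)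
    · exact Fin.ext (key _ _ hmn m.2 hs.symm).symm
  have hsurj := (Fintype.bijective_iff_injective_and_card _).2 ⟨hinj, by simp [ZMod.card]⟩ |>.2
  obtain ⟨m, hm⟩ := hsurj w
  exact ⟨m, hm⟩

/-- The powers of `1 + 2 ^ r * u`, with `u` a unit and `2 ≤ r`, are all `x ≡ 1` modulo `2 ^ r`. -/
theorem exists_pow_eq {r : ℕ} (hr : 2 ≤ r) {a u x : ZMod (2 ^ e)} (hu : IsUnit u)
    (ha : a = 1 + 2 ^ r * u) (hx : 2 ^ r ∣ x - 1) : ∃ m : ℕ, a ^ m = x := by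
  have h4 : 4 ∣ a - 1 := by
    obtain ⟨k, rfl⟩ := Nat.exists_eq_add_of_le hr
    exact ⟨2 ^ k * u, by rw [ha]; ring⟩
  obtain ⟨w, hw⟩ := hx
  obtain ⟨v, rfl⟩ := hu
  obtain ⟨m, hm⟩ := geom_sum_surjective h4 (↑v⁻¹ * w)
  refine ⟨m, ?_⟩
  have h1 := geom_sum_mul a m
  rw [hm, ha] at h1
  rw [ha]
  have h2 : (v : ZMod (2 ^ e)) * ↑v⁻¹ = 1 := Units.mul_inv v
  linear_combination -h1 - hw + 2 ^ r * w * h2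

/-- Each squaring gains a factor of two: (1 + q)² = 1 + 2q + q² with q even. -/
theorem pow_two_pow_sub_one {r : ℕ} {a : ZMod (2 ^ e)} (hr : 1 ≤ r) (h : 2 ^ r ∣ a - 1) (k : ℕ) :
    2 ^ (r + k) ∣ a ^ 2 ^ k - 1 := by
  induction k with
  | zero => simpa using h
  | succ k ih =>
    obtain ⟨y, hy⟩ := ih
    obtain ⟨s, hs⟩ := Nat.exists_eq_add_of_le (show 1 ≤ r + k by omega)
    refine ⟨y + 2 ^ s * y ^ 2, ?_⟩
    rw [pow_succ 2 k, pow_mul]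
    have h3 : (2 : ZMod (2 ^ e)) ^ (r + k) = 2 * 2 ^ s := by rw [hs, pow_add, pow_one]
    have h4 : (2 : ZMod (2 ^ e)) ^ (r + (k + 1)) = 2 * (2 * 2 ^ s) := by
      rw [← add_assoc, pow_succ, h3]; ring
    rw [h4]
    rw [h3] at hy
    linear_combination (a ^ 2 ^ k + 1 + 2 * 2 ^ s * y) * hy

/-- The exponent of the unit group divides `2 ^ (e - 2)` for `3 ≤ e`. -/
theorem pow_two_pow_eq_one (he : 3 ≤ e) {a : ZMod (2 ^ e)} (ha : IsUnit a) :
    a ^ 2 ^ (e - 2) = 1 := by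
  have h1 : 2 ^ 2 ∣ a ^ 2 - 1 := by
    obtain ⟨k, rfl⟩ := unit_eq_add ha
    exact ⟨k ^ 2 + k, by ring⟩
  have h2 : 2 ^ 3 ∣ a ^ 2 - 1 := by
    rcases four_dvd_or ha with ⟨k, hk⟩ | ⟨k, hk⟩
    · exact ⟨2 * k ^ 2 + k, by linear_combination (a + 1 + 4 * k) * hk⟩
    · exact ⟨2 * k ^ 2 - k, by linear_combination (a - 1 + 4 * k) * hk⟩
  have h3 := pow_two_pow_sub_one (by norm_num) h2 (e - 3)
  rw [← pow_mul, ← pow_succ', show e - 3 + 1 = e - 2 by omega, show 3 + (e - 3) = e by omega,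
    two_pow_self, zero_dvd_iff] at h3
  linear_combination h3

/-- The square roots of one that are `≡ 1` modulo `4`. -/
theorem sq_eq_one_of_four_dvd_sub (he : 1 ≤ e) {a : ZMod (2 ^ e)} (h : 4 ∣ a - 1)
    (ha : a * a = 1) : a = 1 ∨ a = 1 + 2 ^ (e - 1) := by
  obtain ⟨k, hk⟩ := h
  have hu : IsUnit (1 + 2 * k) := isUnit_add_of_two_dvd isUnit_one ⟨k, rfl⟩
  have h2 : (1 + 2 * k) * (2 * (a - 1)) = 0 := by linear_combination ha - (a - 1) * hk
  rw [hu.mul_right_eq_zero] at h2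
  rcases eq_zero_or_of_two_mul he h2 with h | h
  · exact Or.inl (by linear_combination h)
  · exact Or.inr (by linear_combination h)

theorem sq_eq_one_of_four_dvd_add (he : 1 ≤ e) {a : ZMod (2 ^ e)} (h : 4 ∣ a + 1)
    (ha : a * a = 1) : a = -1 ∨ a = -1 + 2 ^ (e - 1) := by
  have h' : 4 ∣ -a - 1 := by
    have := dvd_neg.2 h
    rwa [neg_add'] at this
  have h0 := two_mul_two_pow_pred he
  rcases sq_eq_one_of_four_dvd_sub he h' (by linear_combination ha) with h | h
  · exact Or.inl (by linear_combination -h)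
  · exact Or.inr (by linear_combination -h - h0)

end ZModTwoPow

/-! ### Affine actions on ℤ/2^e. -/

open ZModTwoPow

/-- An action of `G` on `ZMod (2 ^ e)` by affine maps `x ↦ lin g * x + tr g`. -/
structure AffineAction (e : ℕ) (G : Type*) [Group G] where
  lin : G →* ZMod (2 ^ e)
  tr : G → ZMod (2 ^ e)
  tr_mul : ∀ g h, tr (g * h) = tr g + lin g * tr h

namespace AffineAction

open scoped commutatorElement

variable {e : ℕ} {G : Type*} [Group G] (A : AffineAction e G)

theorem tr_one : A.tr 1 = 0 := by
  have h := A.tr_mul 1 1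
  rw [mul_one, map_one, one_mul] at h
  linear_combination -h

theorem isUnit_lin (g : G) : IsUnit (A.lin g) := (Group.isUnit g).map A.lin

theorem lin_inv_mul (g : G) : A.lin g⁻¹ * A.lin g = 1 := by
  rw [← map_mul, inv_mul_cancel, map_one]

theorem tr_inv (g : G) : A.tr g⁻¹ = -(A.lin g⁻¹ * A.tr g) := by
  have h := A.tr_mul g⁻¹ g
  rw [inv_mul_cancel, tr_one] at h
  linear_combination -h

theorem tr_pow (g : G) (m : ℕ) :
    A.tr (g ^ m) = (∑ i ∈ Finset.range m, A.lin g ^ i) * A.tr g := by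
  induction m with
  | zero => simp [tr_one]
  | succ m ih => rw [pow_succ, tr_mul, ih, map_pow, Finset.sum_range_succ]; ring

/-- The stabilizer of `0`. -/
def stab : Subgroup G where
  carrier := {g | A.tr g = 0}
  one_mem' := A.tr_one
  mul_mem' {g h} hg hh := by
    change A.tr (g * h) = 0
    rw [tr_mul, show A.tr g = 0 from hg, show A.tr h = 0 from hh]; ring
  inv_mem' {g} hg := by
    change A.tr g⁻¹ = 0
    rw [tr_inv, show A.tr g = 0 from hg]; ring

theorem mem_stab {g : G} : g ∈ A.stab ↔ A.tr g = 0 := Iff.rfl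

theorem inv_mul_mem_stab {g h : G} : g⁻¹ * h ∈ A.stab ↔ A.tr g = A.tr h := by
  rw [mem_stab, tr_mul, tr_inv]
  have : -(A.lin g⁻¹ * A.tr g) + A.lin g⁻¹ * A.tr h = A.lin g⁻¹ * (A.tr h - A.tr g) := by ring
  rw [this, (A.isUnit_lin _).mul_right_eq_zero, sub_eq_zero, eq_comm]

/-- The translation part as a map on the cosets of the stabilizer of `0`. -/
def cosetTr : G ⧸ A.stab → ZMod (2 ^ e) :=
  Quotient.lift A.tr fun _ _ h => A.inv_mul_mem_stab.1 (QuotientGroup.leftRel_apply.1 h)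

theorem cosetTr_injective : Function.Injective A.cosetTr := by
  intro x y
  induction x using QuotientGroup.induction_on
  induction y using QuotientGroup.induction_on
  intro h
  exact QuotientGroup.eq.2 (A.inv_mul_mem_stab.2 h)

theorem surjective_of_index (h : A.stab.index = 2 ^ e) : Function.Surjective A.tr := by
  have hb : Function.Bijective A.cosetTr := by
    have hc : Nat.card (G ⧸ A.stab) = 2 ^ e := h
    have : Finite (G ⧸ A.stab) := Nat.finite_of_card_ne_zero (by rw [hc]; positivity)
    have : Fintype (G ⧸ A.stab) := Fintype.ofFinite _
    rw [Fintype.bijective_iff_injective_and_card]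
    refine ⟨A.cosetTr_injective, ?_⟩
    rw [← Nat.card_eq_fintype_card, hc, ZMod.card]
  intro y
  obtain ⟨x, hx⟩ := hb.2 y
  obtain ⟨g, rfl⟩ := QuotientGroup.mk_surjective x
  exact ⟨g, hx⟩

theorem index_of_surjective (h : Function.Surjective A.tr) : A.stab.index = 2 ^ e := by
  have hb : Function.Bijective A.cosetTr :=
    ⟨A.cosetTr_injective, fun y => let ⟨g, hg⟩ := h y; ⟨(g : G ⧸ A.stab), hg⟩⟩
  rw [Subgroup.index, Nat.card_congr (Equiv.ofBijective _ hb), Nat.card_zmod]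

/-- Both subgroups have index 2^e. A candidate action therefore needs only to be transitive and to
have generators of `H` fixing 0. -/
theorem stab_eq_of_le {H : Subgroup G} (hH : H.index = 2 ^ e) (h : Function.Surjective A.tr)
    (hle : H ≤ A.stab) : A.stab = H := by
  refine le_antisymm ?_ hle
  have h1 := Subgroup.relIndex_mul_index hle
  rw [hH, A.index_of_surjective h] at h1
  exact Subgroup.relIndex_eq_one.1 (Nat.eq_of_mul_eq_mul_right
    (show 0 < 2 ^ e by positivity) (by rw [h1, one_mul]))

/-- The conjugate action in which `x` takes the place of `0`. -/
def shift (x : ZMod (2 ^ e)) : AffineAction e G where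
  lin := A.lin
  tr g := A.tr g - (1 - A.lin g) * x
  tr_mul g h := by rw [tr_mul, map_mul]; ring

theorem shift_lin (x : ZMod (2 ^ e)) : (A.shift x).lin = A.lin := rfl

theorem shift_tr (x : ZMod (2 ^ e)) (g : G) :
    (A.shift x).tr g = A.tr g - (1 - A.lin g) * x := rfl

theorem shift_surjective (h : Function.Surjective A.tr) (x : ZMod (2 ^ e)) :
    Function.Surjective (A.shift x).tr := by
  intro y
  obtain ⟨k, hk⟩ := h x
  obtain ⟨g, hg⟩ := h (y + x)
  refine ⟨g * k⁻¹, ?_⟩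
  rw [shift_tr, tr_mul, tr_inv, map_mul, hg, hk]
  ring

/-- The action with translation parts multiplied by `u`. -/
def scale (u : ZMod (2 ^ e)) : AffineAction e G where
  lin := A.lin
  tr g := u * A.tr g
  tr_mul g h := by rw [tr_mul]; ring

/-- The pullback of an action along a homomorphism. -/
def comap {K : Type*} [Group K] (f : K →* G) : AffineAction e K where
  lin := A.lin.comp f
  tr g := A.tr (f g)
  tr_mul g h := by rw [map_mul, tr_mul]; rfl

/-- No nontrivial element acts trivially. -/
def Faithful : Prop := ∀ g, A.tr g = 0 → A.lin g = 1 → g = 1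

variable {A}

theorem Faithful.ext (hA : A.Faithful) {g h : G} (h1 : A.tr g = A.tr h) (h2 : A.lin g = A.lin h) :
    g = h := by
  have : g⁻¹ * h = 1 := by
    apply hA
    · exact A.inv_mul_mem_stab.2 h1
    · rw [map_mul, ← h2, lin_inv_mul]
  exact (inv_mul_eq_one.1 this)

theorem Faithful.shift (hA : A.Faithful) (x : ZMod (2 ^ e)) : (A.shift x).Faithful := by
  intro g h1 h2
  rw [shift_lin] at h2
  rw [shift_tr, h2] at h1
  exact hA g (by linear_combination h1) h2

theorem Faithful.scale (hA : A.Faithful) (u : (ZMod (2 ^ e))ˣ) : (A.scale u).Faithful := by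
  intro g h1 h2
  exact hA g ((Units.mul_right_eq_zero u).1 h1) h2

theorem Faithful.finite (hA : A.Faithful) : Finite G :=
  Finite.of_injective (fun g => (A.tr g, A.lin g)) fun _ _ hgh =>
    hA.ext (congrArg Prod.fst hgh) (congrArg Prod.snd hgh)

variable (A)

theorem lin_commutator (g h : G) : A.lin ⁅g, h⁆ = 1 := by
  have h1 : ⁅g, h⁆ * (h * g) = g * h := by rw [commutatorElement_def]; group
  have h2 := congrArg A.lin h1
  simp only [map_mul] at h2
  rw [mul_comm (A.lin h)] at h2
  exact ((A.isUnit_lin g).mul (A.isUnit_lin h)).mul_eq_right.1 h2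

theorem tr_commutator (g h : G) :
    A.tr ⁅g, h⁆ = A.tr g + A.lin g * A.tr h - A.tr h - A.lin h * A.tr g := by
  have h1 : ⁅g, h⁆ * (h * g) = g * h := by rw [commutatorElement_def]; group
  have h2 := congrArg A.tr h1
  rw [tr_mul, lin_commutator, tr_mul, tr_mul] at h2
  linear_combination h2

theorem four_dvd_lin_mul {g h : G} (h1 : 4 ∣ A.lin g - 1) (h2 : 4 ∣ A.lin h - 1) :
    4 ∣ A.lin (g * h) - 1 := by
  rw [map_mul]
  have := dvd_add (h1.mul_right (A.lin h)) h2
  ring_nf at this ⊢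
  exact this

theorem four_dvd_lin_mul' {g h : G} (h1 : 4 ∣ A.lin g + 1) (h2 : 4 ∣ A.lin h + 1) :
    4 ∣ A.lin (g * h) - 1 := by
  rw [map_mul]
  have := dvd_sub (h1.mul_right (A.lin h)) h2
  ring_nf at this ⊢
  exact this

theorem four_dvd_lin_mul'' {g h : G} (h1 : 4 ∣ A.lin g + 1) (h2 : 4 ∣ A.lin h - 1) :
    4 ∣ A.lin (g * h) + 1 := by
  rw [map_mul]
  have := dvd_sub (h1.mul_right (A.lin h)) h2
  ring_nf at this ⊢
  exact this

theorem isUnit_tr_mul {g h : G} (h1 : IsUnit (A.tr g)) (h2 : 2 ∣ A.tr h) :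
    IsUnit (A.tr (g * h)) := by
  rw [tr_mul]
  exact isUnit_add_of_two_dvd h1 (h2.mul_left _)

theorem isUnit_tr_mul' {g h : G} (h1 : 2 ∣ A.tr g) (h2 : IsUnit (A.tr h)) :
    IsUnit (A.tr (g * h)) := by
  rw [tr_mul, add_comm]
  exact isUnit_add_of_two_dvd ((A.isUnit_lin g).mul h2) h1

theorem two_dvd_tr_mul {g h : G} (h1 : IsUnit (A.tr g)) (h2 : IsUnit (A.tr h)) :
    2 ∣ A.tr (g * h) := by
  rw [tr_mul]
  exact two_dvd_add_of_isUnit h1 ((A.isUnit_lin g).mul h2)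

/-- A transitive action contains an element `x ↦ a * x + b` with `a ≡ 1` modulo `4` and `b`
not divisible by `4`. -/
theorem exists_four_dvd_lin_sub_one (h : Function.Surjective A.tr) :
    ∃ t, 4 ∣ A.lin t - 1 ∧ (IsUnit (A.tr t) ∨ A.tr t = 2) := by
  obtain ⟨g, hg⟩ := h 1
  rcases four_dvd_or (A.isUnit_lin g) with hg1 | hg1
  · exact ⟨g, hg1, Or.inl (hg ▸ isUnit_one)⟩
  obtain ⟨k, hk⟩ := h 2
  rcases four_dvd_or (A.isUnit_lin k) with hk1 | hk1
  · exact ⟨k, hk1, Or.inr hk⟩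
  exact ⟨g * k, A.four_dvd_lin_mul' hg1 hk1,
    Or.inl (A.isUnit_tr_mul (hg ▸ isUnit_one) (hk ▸ dvd_rfl))⟩

theorem tr_pow_eq_zero {t : G} (h : 4 ∣ A.lin t - 1) (ht : IsUnit (A.tr t)) (m : ℕ) :
    A.tr (t ^ m) = 0 ↔ 2 ^ e ∣ m := by
  rw [tr_pow, ht.mul_left_eq_zero, geom_sum_eq_zero h]

/-- The 2^k-th power multiplies the translation part by 2^k times a unit, and that part has 2-adic
valuation at most one. -/
theorem tr_pow_two_pow_ne_zero {t : G} {k : ℕ} (h : 4 ∣ A.lin t - 1)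
    (ht : IsUnit (A.tr t) ∨ A.tr t = 2) (hk : k + 1 < e) : A.tr (t ^ 2 ^ k) ≠ 0 := by
  rcases ht with ht | ht
  · rw [Ne, A.tr_pow_eq_zero h ht, Nat.pow_dvd_pow_iff_le_right (by norm_num)]
    omega
  · obtain ⟨w, hw, hs⟩ := geom_sum_eq h (2 ^ k)
    rw [tr_pow, hs, ht]
    push_cast
    have : (2 : ZMod (2 ^ e)) ^ k * w * 2 = 2 ^ (k + 1) * w := by ring
    rw [this, Ne, two_pow_mul_unit_eq_zero hw]
    omega

theorem exists_pow_tr_eq {t : G} (h : 4 ∣ A.lin t - 1) (ht : IsUnit (A.tr t)) (x : ZMod (2 ^ e)) :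
    ∃ m : ℕ, A.tr (t ^ m) = x := by
  obtain ⟨u, hu⟩ := ht
  obtain ⟨m, hm⟩ := geom_sum_surjective h (x * ↑u⁻¹)
  exact ⟨m, by rw [tr_pow, hm, ← hu, mul_assoc, Units.inv_mul, mul_one]⟩

theorem geom_sum_two_pow_dvd {a : ZMod (2 ^ e)} (ha : IsUnit a) (k : ℕ) :
    2 ^ k ∣ ∑ i ∈ Finset.range (2 ^ k), a ^ i := by
  induction k with
  | zero => simp
  | succ k ih =>
    rw [show 2 ^ (k + 1) = 2 ^ k + 2 ^ k by ring, Finset.sum_range_add]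
    simp_rw [pow_add, ← Finset.mul_sum]
    have h2 := two_dvd_add_of_isUnit isUnit_one (ha.pow (2 ^ k))
    have := mul_dvd_mul ih h2
    convert this using 1 <;> ring

theorem tr_pow_two_pow_self (g : G) : A.tr (g ^ 2 ^ e) = 0 := by
  have := geom_sum_two_pow_dvd (A.isUnit_lin g) e
  rw [two_pow_self, zero_dvd_iff] at this
  rw [tr_pow, this, zero_mul]

/-- An element with translation part a unit and linear part `≡ 3` modulo `4` has no
transitive powers. -/
theorem tr_pow_two_pow_pred_self {g : G} (he : 2 ≤ e) (h : 4 ∣ A.lin g + 1) :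
    A.tr (g ^ 2 ^ (e - 1)) = 0 := by
  -- Here 1 + a is already divisible by 4, one factor of two more than for a general unit, and each
  -- doubling of the length keeps this advantage.
  have key : ∀ k, 2 ^ (k + 2) ∣ ∑ i ∈ Finset.range (2 ^ (k + 1)), A.lin g ^ i := by
    intro k
    induction k with
    | zero => simpa [Finset.sum_range_succ, show (2 : ZMod (2 ^ e)) ^ 2 = 4 by norm_num,
        add_comm] using h
    | succ k ih =>
      rw [pow_succ 2 (k + 1), mul_two, Finset.sum_range_add]
      simp_rw [pow_add (A.lin g), ← Finset.mul_sum]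
      have h2 := two_dvd_add_of_isUnit isUnit_one ((A.isUnit_lin g).pow (2 ^ (k + 1)))
      have := mul_dvd_mul ih h2
      rw [show k + 1 + 2 = k + 2 + 1 by ring, pow_succ]
      convert this using 1
      ring
  have := key (e - 2)
  rw [show e - 2 + 2 = e by omega, show e - 2 + 1 = e - 1 by omega, two_pow_self,
    zero_dvd_iff] at this
  rw [tr_pow, this, zero_mul]

end AffineAction

/-- `H` is the stabilizer of a point in some transitive affine action on `ZMod (2 ^ e)`. -/
def IsAffineStabilizer (e : ℕ) {G : Type*} [Group G] (H : Subgroup G) : Prop :=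
  ∃ A : AffineAction e G, A.stab = H

/-! ### The holomorph as the affine group of ℤ/2^e. -/

namespace Hol

variable {N : Type*} [CommGroup N] {e : ℕ} (hN : Nat.card N = 2 ^ e) {σ : N}
  (hσ : Subgroup.zpowers σ = ⊤)

/-- The identification of the cyclic group `⟨σ⟩` with `ZMod (2 ^ e)`. -/
noncomputable def log : N ≃ ZMod (2 ^ e) :=
  (zmodMulEquivOfGenerator (fun x => hσ ▸ Subgroup.mem_top x) hN).symm.toEquiv.trans
    Multiplicative.toAdd

theorem log_mul (x y : N) : log hN hσ (x * y) = log hN hσ x + log hN hσ y := by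
  simp [log]

theorem log_one : log hN hσ 1 = 0 := by simp [log]

theorem log_zpow (i : ℤ) : log hN hσ (σ ^ i) = i := by
  change Multiplicative.toAdd ((zmodMulEquivOfGenerator _ hN).symm (σ ^ i)) = _
  rw [zmodMulEquivOfGenerator_symm_apply_zpow]
  rfl

theorem log_gen : log hN hσ σ = 1 := by
  simpa using log_zpow hN hσ 1

theorem log_symm_add (x y : ZMod (2 ^ e)) :
    (log hN hσ).symm (x + y) = (log hN hσ).symm x * (log hN hσ).symm y := by
  apply (log hN hσ).injective
  rw [log_mul]; simp

theorem log_aut (f : MulAut N) (x : N) : log hN hσ (f x) = log hN hσ (f σ) * log hN hσ x := by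
  obtain ⟨i, rfl⟩ := Subgroup.mem_zpowers_iff.1 (hσ ▸ Subgroup.mem_top x : x ∈ Subgroup.zpowers σ)
  obtain ⟨j, hj⟩ := Subgroup.mem_zpowers_iff.1
    (hσ ▸ Subgroup.mem_top (f σ) : f σ ∈ Subgroup.zpowers σ)
  rw [map_zpow, ← hj, ← zpow_mul, log_zpow, log_zpow, log_zpow]
  push_cast
  rfl

/-- The action of the holomorph as an affine action on `ZMod (2 ^ e)`. -/
noncomputable def affine : AffineAction e (Hol N) where
  lin :=
    { toFun := fun g => log hN hσ (g.right σ)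
      map_one' := log_gen hN hσ
      map_mul' := fun g h => by
        rw [SemidirectProduct.mul_right, MulAut.mul_apply, log_aut] }
  tr g := log hN hσ g.left
  tr_mul g h := by
    rw [SemidirectProduct.mul_left, log_mul, MonoidHom.id_apply, log_aut]
    rfl

theorem affine_tr (g : Hol N) : (affine hN hσ).tr g = log hN hσ g.left := rfl

theorem affine_lin (g : Hol N) : (affine hN hσ).lin g = log hN hσ (g.right σ) := rfl

theorem affine_faithful : (affine hN hσ).Faithful := by
  intro g h1 h2
  have h3 : g.left = 1 := (log hN hσ).injective (h1.trans (log_one hN hσ).symm)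
  refine SemidirectProduct.ext h3 (MulEquiv.ext fun x => (log hN hσ).injective ?_)
  rw [log_aut, show log hN hσ (g.right σ) = 1 from h2, one_mul]
  rfl

theorem smul_one_left (g : Hol N) : g • (1 : N) = g.left := by
  rw [Hol.smul_def, map_one, mul_one]

theorem mem_stab_iff (T : Subgroup (Hol N)) (t : T) :
    t ∈ Hol.stab T ↔ (affine hN hσ).tr t = 0 := by
  have : (t • (1 : N)) = (t : Hol N).left := smul_one_left _
  rw [Hol.stab, MulAction.mem_stabilizer_iff, this, affine_tr, ← log_one hN hσ,
    (log hN hσ).injective.eq_iff]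

theorem mem_base_iff (g : Hol N) : g ∈ Hol.base N ↔ (affine hN hσ).lin g = 1 := by
  rw [affine_lin, ← log_gen hN hσ, (log hN hσ).injective.eq_iff]
  constructor
  · rintro ⟨x, rfl⟩
    rfl
  · intro h
    refine ⟨g.left, SemidirectProduct.ext rfl (MulEquiv.ext fun x => (log hN hσ).injective ?_)⟩
    rw [log_aut hN hσ g.right, h, log_gen, one_mul]
    rfl

theorem isPretransitive_iff (T : Subgroup (Hol N)) : MulAction.IsPretransitive T N ↔
    Function.Surjective fun t : T => (affine hN hσ).tr t := by
  have key : ∀ t : T, t • (1 : N) = (t : Hol N).left := fun t => smul_one_left _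
  constructor
  · intro h y
    obtain ⟨t, ht⟩ := MulAction.exists_smul_eq T (1 : N) ((log hN hσ).symm y)
    refine ⟨t, ?_⟩
    change (affine hN hσ).tr (t : Hol N) = y
    rw [affine_tr, ← key, ht, Equiv.apply_symm_apply]
  · intro h
    have h1 : ∀ x : N, ∃ t : T, t • (1 : N) = x := fun x => by
      obtain ⟨t, ht⟩ := h (log hN hσ x)
      exact ⟨t, (key t).trans ((log hN hσ).injective ht)⟩
    refine ⟨fun x y => ?_⟩
    obtain ⟨s, rfl⟩ := h1 x
    obtain ⟨t, rfl⟩ := h1 y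
    exact ⟨t * s⁻¹, by rw [mul_smul, inv_smul_smul]⟩

section

variable {G : Type*} [Group G]

/-- The automorphism of `N` given by the linear part of `g`. -/
noncomputable def linAut (A : AffineAction e G) (g : G) : MulAut N where
  toFun x := (log hN hσ).symm (A.lin g * log hN hσ x)
  invFun x := (log hN hσ).symm (A.lin g⁻¹ * log hN hσ x)
  left_inv x := by
    simp only [Equiv.apply_symm_apply]
    rw [← mul_assoc, A.lin_inv_mul, one_mul, Equiv.symm_apply_apply]
  right_inv x := by
    simp only [Equiv.apply_symm_apply]
    rw [← mul_assoc, mul_comm (A.lin g), A.lin_inv_mul, one_mul, Equiv.symm_apply_apply]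
  map_mul' x y := by
    rw [log_mul, mul_add, log_symm_add]

/-- The homomorphism to the holomorph given by an affine action. -/
noncomputable def ofAffine (A : AffineAction e G) : G →* Hol N where
  toFun g := ⟨(log hN hσ).symm (A.tr g), linAut hN hσ A g⟩
  map_one' := by
    refine SemidirectProduct.ext ?_ (MulEquiv.ext fun x => (log hN hσ).injective ?_)
    · rw [A.tr_one]
      exact (log hN hσ).injective (by simp [log_one])
    · simp [linAut]
  map_mul' g h := by
    refine SemidirectProduct.ext ?_ (MulEquiv.ext fun x => (log hN hσ).injective ?_)
    · apply (log hN hσ).injective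
      simp [linAut, log_mul, A.tr_mul]
    · simp [linAut, mul_assoc]

theorem affine_ofAffine_tr (A : AffineAction e G) (g : G) :
    (affine hN hσ).tr (ofAffine hN hσ A g) = A.tr g := by
  simp [affine_tr, ofAffine]

theorem affine_ofAffine_lin (A : AffineAction e G) (g : G) :
    (affine hN hσ).lin (ofAffine hN hσ A g) = A.lin g := by
  simp [affine_lin, ofAffine, linAut, log_gen]

end

include hN hσ in
-- One direction pulls the action of `T` back along G → G/C ≅ T. For the other, an affine action
-- gives a homomorphism to the holomorph with image `T`, and its kernel is exactly the core because
-- the action is transitive.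
theorem isRealizable_iff {G : Subgroup (Hol N)} {H : Subgroup G} (hH : H.index = 2 ^ e) :
    IsRealizable H ↔ IsAffineStabilizer e H := by
  constructor
  · rintro ⟨T, -, f, hf⟩
    let ρ : G →* Hol N := T.subtype.comp (f.toMonoidHom.comp (QuotientGroup.mk' H.normalCore))
    refine ⟨(affine hN hσ).comap ρ, ?_⟩
    ext g
    have h1 : g ∈ ((affine hN hσ).comap ρ).stab ↔ f (g : G ⧸ H.normalCore) ∈ Hol.stab T :=
      (mem_stab_iff hN hσ T _).symm
    rw [h1, ← hf, Subgroup.mem_map_equiv, MulEquiv.symm_apply_apply, Subgroup.mem_map]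
    constructor
    · rintro ⟨h, hh, hgh⟩
      have h2 := QuotientGroup.eq.1 hgh
      have h3 := H.mul_mem hh (H.normalCore_le h2)
      simpa using h3
    · intro h
      exact ⟨g, h, rfl⟩
  · rintro ⟨A, rfl⟩
    have hs := A.surjective_of_index hH
    have hker : A.stab.normalCore = (ofAffine hN hσ A).ker := by
      refine le_antisymm (fun g hg => ?_) (Subgroup.normal_le_normalCore.2 fun g hg => ?_)
      · apply affine_faithful hN hσ
        · rw [affine_ofAffine_tr]
          exact A.stab.normalCore_le hg
        · rw [affine_ofAffine_lin]
          -- An element of the core fixes 0 and also the point 1, which is the image of 0 under `x`;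
          -- so its linear part is 1.
          obtain ⟨x, hx⟩ := hs 1
          have h1 : A.tr (x⁻¹ * g * x) = 0 := by
            have := hg x⁻¹
            rwa [inv_inv] at this
          have h2 : A.tr (g * x) = A.tr (x * (x⁻¹ * g * x)) := by congr 1; group
          rw [A.tr_mul, A.tr_mul x, h1, hx, show A.tr g = 0 from A.stab.normalCore_le hg] at h2
          linear_combination h2
      · rw [A.mem_stab, ← affine_ofAffine_tr hN hσ, MonoidHom.mem_ker.1 hg, AffineAction.tr_one]
    refine ⟨(ofAffine hN hσ A).range, ?_,
      (QuotientGroup.quotientMulEquivOfEq hker).trans (QuotientGroup.quotientKerEquivRange _), ?_⟩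
    · rw [isPretransitive_iff hN hσ]
      intro y
      obtain ⟨g, hg⟩ := hs y
      exact ⟨⟨_, g, rfl⟩, by rw [← hg]; exact affine_ofAffine_tr hN hσ A g⟩
    · ext ⟨t, g, rfl⟩
      rw [mem_stab_iff hN hσ]
      change _ ↔ (affine hN hσ).tr (ofAffine hN hσ A g) = 0
      rw [affine_ofAffine_tr, Subgroup.map_map]
      constructor
      · rintro ⟨h, hh, hgh⟩
        have h2 : ofAffine hN hσ A h = ofAffine hN hσ A g := congrArg Subtype.val hgh
        rw [← affine_ofAffine_tr hN hσ, ← h2, affine_ofAffine_tr]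
        exact hh
      · intro h
        exact ⟨g, h, rfl⟩

end Hol

/-! ### Obstructions when `H` contains nontrivial translations. -/

namespace ZModTwoPow

variable {e : ℕ}

/-- A nontrivial group of units `≡ 1` modulo `4` contains `1 + 2 ^ (e - 1)`. -/
theorem exists_pow_eq_one_add {a : ZMod (2 ^ e)} (h : 4 ∣ a - 1) (ha : a ≠ 1) :
    ∃ m : ℕ, a ^ m = 1 + 2 ^ (e - 1) := by
  obtain ⟨r, hr, u, hu, hru⟩ := exists_two_pow_mul (a - 1)
  have hre : r < e := by
    refine lt_of_le_of_ne hr fun hre => ha ?_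
    rw [hre, two_pow_self, zero_mul] at hru
    exact sub_eq_zero.1 hru
  obtain ⟨w, hw, hs⟩ := geom_sum_eq h (2 ^ (e - 1 - r))
  refine ⟨2 ^ (e - 1 - r), ?_⟩
  have h1 := geom_sum_mul a (2 ^ (e - 1 - r))
  rw [hs, hru] at h1
  push_cast at h1
  have h2 := two_pow_mul_self_eq (by omega) (hw.mul hu)
  have h3 : (2 : ZMod (2 ^ e)) ^ (e - 1) = 2 ^ (e - 1 - r) * 2 ^ r := by
    rw [← pow_add]; congr 1; omega
  rw [h3] at h2 ⊢
  linear_combination h2 - h1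

theorem pow_two_pow_self {a : ZMod (2 ^ e)} (ha : IsUnit a) : a ^ 2 ^ e = 1 := by
  obtain ⟨u, rfl⟩ := ha
  rcases Nat.eq_zero_or_pos e with rfl | he
  · have : Subsingleton (ZMod (2 ^ 0)) := by rw [pow_zero]; infer_instance
    exact Subsingleton.elim _ _
  · have h := ZMod.pow_totient u
    rw [Nat.totient_prime_pow Nat.prime_two he, Nat.add_one_sub_one, mul_one] at h
    have h2 : u ^ 2 ^ e = 1 := orderOf_dvd_iff_pow_eq_one.1
      ((orderOf_dvd_of_pow_eq_one h).trans (pow_dvd_pow 2 (Nat.sub_le e 1)))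
    rw [← Units.val_pow_eq_pow_val, h2, Units.val_one]

theorem sq_eq_zero_of_two_mul (he : 2 ≤ e) {x : ZMod (2 ^ e)} (hx : 2 * x = 0) : x * x = 0 := by
  rcases eq_zero_or_of_two_mul (by omega) hx with h | h
  · rw [h, mul_zero]
  · nth_rw 1 [h]
    exact two_pow_pred_mul_even (by omega) (h ▸ dvd_pow_self 2 (by omega))

theorem two_pow_dvd_of_four_mul (he : 2 ≤ e) {x : ZMod (2 ^ e)} (hx : 4 * x = 0) :
    2 ^ (e - 2) ∣ x :=
  (two_pow_mul_eq_zero (i := e - 2) (j := 2) (by omega) x).1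
    (by rw [← hx]; norm_num)

end ZModTwoPow

namespace AffineAction

variable {e : ℕ} {G : Type*} [Group G] (A : AffineAction e G)

open scoped commutatorElement

theorem tr_mul_of_lin_eq_one {n : G} (hn : A.lin n = 1) (g : G) :
    A.tr (n * g) = A.tr n + A.tr g := by rw [tr_mul, hn, one_mul]

theorem tr_pow_of_lin_eq_one {n : G} (hn : A.lin n = 1) (m : ℕ) : A.tr (n ^ m) = m * A.tr n := by
  rw [tr_pow, hn]; simp

theorem lin_conj (g n : G) : A.lin (g * n * g⁻¹) = A.lin n := by
  rw [map_mul, map_mul, mul_comm (A.lin g), mul_assoc, mul_comm (A.lin g), lin_inv_mul, mul_one]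

theorem tr_conj {n : G} (hn : A.lin n = 1) (g : G) :
    A.tr (g * n * g⁻¹) = A.lin g * A.tr n := by
  have h : A.tr (g * n * g⁻¹ * g) = A.tr (g * n) := by
    rw [inv_mul_cancel_right]
  rw [A.tr_mul_of_lin_eq_one ((A.lin_conj g n).trans hn) g, A.tr_mul g n] at h
  linear_combination h

/-- The translations by elements killed by `m`. -/
def torsion (m : ZMod (2 ^ e)) : Subgroup G where
  carrier := {g | A.lin g = 1 ∧ m * A.tr g = 0}
  one_mem' := ⟨map_one _, by rw [tr_one, mul_zero]⟩
  mul_mem' {g h} hg hh :=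
    ⟨by rw [map_mul, hg.1, hh.1, one_mul], by
      rw [A.tr_mul_of_lin_eq_one hg.1, mul_add, hg.2, hh.2, add_zero]⟩
  inv_mem' {g} hg := by
    have h := A.lin_inv_mul g
    rw [hg.1, mul_one] at h
    exact ⟨h, by rw [tr_inv, h, one_mul, mul_neg, hg.2, neg_zero]⟩

instance (m : ZMod (2 ^ e)) : (A.torsion m).Normal where
  conj_mem n hn g := by
    refine ⟨(A.lin_conj g n).trans hn.1, ?_⟩
    rw [A.tr_conj hn.1]
    linear_combination A.lin g * hn.2

/-- The power is a translation since 2^(e-2) annihilates the unit group. Raising it further to the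
power 2^k gives g^(2^e), whose translation part vanishes. -/
theorem pow_mem_torsion {k : ℕ} (he : 3 ≤ e) (hk : k ≤ 2) (g : G) :
    g ^ 2 ^ (e - k) ∈ A.torsion (2 ^ k) := by
  have hl : A.lin (g ^ 2 ^ (e - k)) = 1 := by
    rw [map_pow, show e - k = e - 2 + (2 - k) by omega, pow_add 2, pow_mul,
      pow_two_pow_eq_one he (A.isUnit_lin g), one_pow]
  refine ⟨hl, ?_⟩
  have h := A.tr_pow_of_lin_eq_one hl (2 ^ k)
  rw [← pow_mul, ← pow_add, Nat.sub_add_cancel (by omega), tr_pow_two_pow_self] at h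
  push_cast at h
  exact h.symm

variable {A}

theorem Faithful.card_le {L : Subgroup G} (hA : A.Faithful) (hL : L ≤ A.lin.ker)
    (s : Finset (ZMod (2 ^ e))) (h : ∀ g ∈ L, A.tr g ∈ s) : Nat.card L ≤ s.card := by
  have hinj : Function.Injective (fun g : L => (⟨A.tr g, h g g.2⟩ : s)) := by
    intro g k hgk
    exact Subtype.ext (hA.ext (congrArg Subtype.val hgk)
      ((MonoidHom.mem_ker.1 (hL g.2)).trans (MonoidHom.mem_ker.1 (hL k.2)).symm))
  simpa using Nat.card_le_card_of_injective _ hinj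

theorem Faithful.card_le_two (hA : A.Faithful) (he : 1 ≤ e) {L : Subgroup G}
    (hL : L ≤ A.torsion 2) : Nat.card L ≤ 2 := by
  refine (hA.card_le (fun g hg => (hL hg).1) {0, 2 ^ (e - 1)} fun g hg => ?_).trans
    Finset.card_le_two
  rcases eq_zero_or_of_two_mul he (hL hg).2 with h | h <;> simp [h]

theorem Faithful.card_le_four (hA : A.Faithful) (he : 2 ≤ e) {L : Subgroup G}
    (hL : L ≤ A.torsion 4) : Nat.card L ≤ 4 := by
  refine (hA.card_le (fun g hg => (hL hg).1)
    ((Finset.range 4).image fun i : ℕ => 2 ^ (e - 2) * (i : ZMod (2 ^ e))) fun g hg => ?_).trans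
    (Finset.card_image_le.trans (by simp))
  obtain ⟨y, hy⟩ := two_pow_dvd_of_four_mul he (hL hg).2
  obtain ⟨z, rfl⟩ := ZMod.natCast_zmod_surjective y
  rw [Finset.mem_image]
  refine ⟨z % 4, by simpa using Nat.mod_lt _ (by norm_num), ?_⟩
  have h1 : (z : ZMod (2 ^ e)) = 4 * ((z / 4 : ℕ) : ZMod (2 ^ e)) + ((z % 4 : ℕ) : ZMod (2 ^ e)) := by
    exact_mod_cast congrArg (Nat.cast : ℕ → ZMod (2 ^ e)) (Nat.div_add_mod z 4).symm
  have h2 : (2 : ZMod (2 ^ e)) ^ (e - 2) * 4 = 0 := by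
    rw [show (4 : ZMod (2 ^ e)) = 2 ^ 2 by norm_num, ← pow_add, Nat.sub_add_cancel he,
      two_pow_self]
  rw [hy, h1]
  linear_combination -((z / 4 : ℕ) : ZMod (2 ^ e)) * h2

variable {H : Subgroup G}

/-- There are at most two translations killed by 2, so `H` contains one by 2^j times a unit with j ≤
e - 2. Its powers include every translation killed by 4. -/
theorem Faithful.torsion_four_le (hA : A.Faithful) (he : 2 ≤ e)
    (hc : 4 ≤ Nat.card (H ⊓ A.lin.ker : Subgroup G)) : A.torsion 4 ≤ H := by
  have h1 : ¬ H ⊓ A.lin.ker ≤ A.torsion 2 := fun h => by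
    have := hA.card_le_two (by omega) h
    omega
  obtain ⟨k, hk, hk2⟩ := Set.not_subset.1 h1
  have hl : A.lin k = 1 := hk.2
  have hk3 : 2 * A.tr k ≠ 0 := fun h => hk2 ⟨hl, h⟩
  obtain ⟨j, hj, u, ⟨u, rfl⟩, hju⟩ := exists_two_pow_mul (A.tr k)
  have hje : j ≤ e - 2 := by
    by_contra hj
    apply hk3
    rw [hju, ← mul_assoc, ← pow_succ', two_pow_eq_zero (by omega), zero_mul]
  intro n hn
  obtain ⟨y, hy⟩ := two_pow_dvd_of_four_mul he hn.2
  obtain ⟨m, hm⟩ := ZMod.natCast_zmod_surjective (2 ^ (e - 2 - j) * y * (↑u⁻¹ : ZMod (2 ^ e)))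
  have : n = k ^ m := by
    apply hA.ext
    · rw [A.tr_pow_of_lin_eq_one hl, hm, hju, hy]
      have h3 : (2 : ZMod (2 ^ e)) ^ (e - 2) = 2 ^ (e - 2 - j) * 2 ^ j := by
        rw [← pow_add]; congr 1; omega
      rw [h3]
      linear_combination -(2 ^ (e - 2 - j) * 2 ^ j) * y * Units.inv_mul u
    · rw [map_pow, hl, one_pow, hn.1]
  rw [this]
  exact H.pow_mem hk.1 m

theorem Faithful.inf_ker_eq (hA : A.Faithful) (he : 1 ≤ e)
    (hc : Nat.card (H ⊓ A.lin.ker : Subgroup G) = 2) : H ⊓ A.lin.ker = A.torsion 2 := by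
  have := hA.finite
  have hle : H ⊓ A.lin.ker ≤ A.torsion 2 := by
    intro g hg
    have h1 : (⟨g, hg⟩ : (H ⊓ A.lin.ker : Subgroup G)) ^ 2 = 1 := by
      have h0 := pow_card_eq_one' (x := (⟨g, hg⟩ : (H ⊓ A.lin.ker : Subgroup G)))
      rwa [hc] at h0
    have h2 : g ^ 2 = 1 := congrArg Subtype.val h1
    have h3 := A.tr_pow_of_lin_eq_one hg.2 2
    rw [h2, tr_one] at h3
    exact ⟨hg.2, by exact_mod_cast h3.symm⟩
  refine Subgroup.eq_of_le_of_card_ge hle ?_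
  rw [hc]
  exact hA.card_le_two he le_rfl

theorem Faithful.card_group_le (hA : A.Faithful) (he : e ≤ 1) : Nat.card G ≤ 2 ^ e := by
  have hl : ∀ g, A.lin g = 1 := by
    intro g
    obtain ⟨k, hk⟩ := unit_eq_add (A.isUnit_lin g)
    have : (2 : ZMod (2 ^ e)) = 0 := by
      rw [← pow_one (2 : ZMod (2 ^ e))]; exact two_pow_eq_zero he
    rw [hk, this, zero_mul, add_zero]
  have := Nat.card_le_card_of_injective A.tr fun g h hgh => hA.ext hgh ((hl g).trans (hl h).symm)
  rwa [Nat.card_zmod] at this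

/-- The full affine group of ℤ/4 has order 8, so `G` is all of it. -/
theorem Faithful.bijective_of_card (hA : A.Faithful) (he : e = 2) (hc : 8 ≤ Nat.card G) :
    Nat.card G = 8 ∧ ∃ g, A.tr g = 1 ∧ A.lin g = 1 := by
  subst he
  have hinj : Function.Injective fun g : G => (A.tr g, (A.isUnit_lin g).unit) := by
    intro g h hgh
    refine hA.ext (congrArg Prod.fst hgh) ?_
    exact congrArg (fun p : ZMod (2 ^ 2) × (ZMod (2 ^ 2))ˣ => (p.2 : ZMod (2 ^ 2))) hgh
  have hcard : Nat.card (ZMod (2 ^ 2) × (ZMod (2 ^ 2))ˣ) = 8 := by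
    rw [Nat.card_prod, Nat.card_zmod, Nat.card_eq_fintype_card, ZMod.card_units_eq_totient]
    rfl
  have h8 : Nat.card G = 8 := le_antisymm (hcard ▸ Nat.card_le_card_of_injective _ hinj) hc
  have hb := (Nat.bijective_iff_injective_and_card _).2 ⟨hinj, h8.trans hcard.symm⟩
  obtain ⟨g, hg⟩ := hb.2 (1, 1)
  exact ⟨h8, g, congrArg Prod.fst hg,
    congrArg (fun p : ZMod (2 ^ 2) × (ZMod (2 ^ 2))ˣ => (p.2 : ZMod (2 ^ 2))) hg⟩

theorem Faithful.pow_two_pow_self (hA : A.Faithful) (g : G) : g ^ 2 ^ e = 1 :=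
  hA _ (A.tr_pow_two_pow_self g) (by rw [map_pow, ZModTwoPow.pow_two_pow_self (A.isUnit_lin g)])

theorem Faithful.orderOf_eq (hA : A.Faithful) (he : 2 ≤ e) {g : G} (h : 4 ∣ A.lin g - 1)
    (hg : IsUnit (A.tr g)) : orderOf g = 2 ^ e := by
  obtain ⟨k, hk⟩ : ∃ k, e = k + 1 := ⟨e - 1, by omega⟩
  have h1 := A.tr_pow_eq_zero h hg (2 ^ k)
  rw [Nat.pow_dvd_pow_iff_le_right (by norm_num)] at h1
  conv_rhs => rw [hk]
  refine orderOf_eq_prime_pow (fun h0 => ?_) ?_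
  · rw [h0, tr_one] at h1
    have := h1.1 rfl
    omega
  · rw [← hk]
    exact hA.pow_two_pow_self g

variable (hA : A.Faithful) (hidx : H.index = 2 ^ e)
include hA hidx

/-- The cases `e ≤ 2` of a subgroup `H` meeting the translations. -/
theorem Faithful.small_exponent (he : e ≤ 2) (hc : 2 ≤ Nat.card (H ⊓ A.lin.ker : Subgroup G)) :
    Nat.card (H ⊓ A.lin.ker : Subgroup G) = 2 ∧ e = 2 ∧ (∃ g : G, orderOf g = 2 ^ e) ∧
      H.Normal := by
  have := hA.finite
  have h1 : Nat.card (H ⊓ A.lin.ker : Subgroup G) ≤ Nat.card H :=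
    Subgroup.card_le_of_le inf_le_left
  have h2 := H.card_mul_index
  rw [hidx] at h2
  have he2 : e = 2 := by
    by_contra hne
    have h3 := hA.card_group_le (by omega)
    nlinarith [Nat.pow_pos (n := e) (show 0 < 2 by norm_num)]
  have hp : 2 ^ e = 4 := by rw [he2]; norm_num
  rw [hp] at h2
  obtain ⟨h8, g, hg1, hg2⟩ := hA.bijective_of_card he2 (by omega)
  have hc2 : Nat.card (H ⊓ A.lin.ker : Subgroup G) = 2 := by omega
  have hH : H ⊓ A.lin.ker = H := Subgroup.eq_of_le_of_card_ge inf_le_left (by omega)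
  refine ⟨hc2, he2, ⟨g, hA.orderOf_eq (by omega) ?_ ?_⟩, ?_⟩
  · rw [hg2]; simp
  · rw [hg1]; exact isUnit_one
  · rw [← hH, hA.inf_ker_eq (by omega) hc2]
    infer_instance

variable {B : AffineAction e G} (hB : B.stab = H)
include hB

/-- For e ≥ 3 some t ∈ G has t^(2^(e-2)) moving 0 in `B`. In `A` this power is a translation killed
by 4, and a large H ∩ N would contain it. -/
theorem Faithful.card_inf_ker_lt : Nat.card (H ⊓ A.lin.ker : Subgroup G) < 4 := by
  by_contra! hc
  rcases le_or_gt e 2 with he | he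
  · have := (hA.small_exponent hidx he (by omega)).1
    omega
  · have hs := B.surjective_of_index (hB ▸ hidx)
    obtain ⟨t, ht1, ht2⟩ := B.exists_four_dvd_lin_sub_one hs
    refine B.tr_pow_two_pow_ne_zero (k := e - 2) ht1 ht2 (by omega) ?_
    have := A.pow_mem_torsion (k := 2) he le_rfl t
    rw [show (2 : ZMod (2 ^ e)) ^ 2 = 4 by norm_num] at this
    have h2 := hA.torsion_four_le (by omega) hc this
    rwa [← hB] at h2

/-- The translation t^(2^(e-2)) lies outside `H`, hence is not killed by 2; so t^(2^(e-1)) ≠ 1. -/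
theorem Faithful.exists_orderOf_eq (hc : Nat.card (H ⊓ A.lin.ker : Subgroup G) = 2) :
    ∃ g : G, orderOf g = 2 ^ e := by
  rcases le_or_gt e 2 with he | he
  · exact (hA.small_exponent hidx he (by omega)).2.2.1
  · have hs := B.surjective_of_index (hB ▸ hidx)
    obtain ⟨t, ht1, ht2⟩ := B.exists_four_dvd_lin_sub_one hs
    have h1 := B.tr_pow_two_pow_ne_zero (k := e - 2) ht1 ht2 (by omega)
    have h2 := A.pow_mem_torsion (k := 2) he le_rfl t
    have h3 : t ^ 2 ^ (e - 2) ∉ A.torsion 2 := by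
      rw [← hA.inf_ker_eq (by omega) hc, ← hB]
      exact fun h => h1 h.1
    have h4 : t ^ 2 ^ (e - 1) ≠ 1 := by
      intro h4
      refine h3 ⟨h2.1, ?_⟩
      have h5 := A.tr_pow_of_lin_eq_one h2.1 2
      rw [← pow_mul, ← pow_succ, show e - 2 + 1 = e - 1 by omega, h4, tr_one] at h5
      exact_mod_cast h5.symm
    refine ⟨t, ?_⟩
    have h6 := orderOf_eq_prime_pow (p := 2) (n := e - 1) h4
    rw [show e - 1 + 1 = e by omega] at h6
    exact h6 (hA.pow_two_pow_self t)

/-- A translation of `A` lies in `H` exactly when it is killed by 2 (`hM`), which allows commutators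
to be compared in `A` and `B`. If `H` were not normal, some z ∈ H would have linear part 1 + 2^(e-1)
in `B`. Then [z, p], for p taking 0 to 1 in `B`, moves 0 in `B`; in `A` it turns out to be a
translation killed by 2. -/
theorem Faithful.normal_of_card (hc : Nat.card (H ⊓ A.lin.ker : Subgroup G) = 2) : H.Normal := by
  rcases le_or_gt e 2 with he | he
  · exact (hA.small_exponent hidx he (by omega)).2.2.2
  have hs := B.surjective_of_index (hB ▸ hidx)
  have hM : ∀ n, A.lin n = 1 → (B.tr n = 0 ↔ 2 * A.tr n = 0) := by
    intro n hn
    have h1 : n ∈ H ⊓ A.lin.ker ↔ n ∈ A.torsion 2 := by rw [hA.inf_ker_eq (by omega) hc]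
    rw [← hB] at h1
    exact ⟨fun h => (h1.1 ⟨h, hn⟩).2, fun h => (h1.2 ⟨hn, h⟩).1⟩
  have hpow : ∀ g, B.tr (g ^ 2 ^ (e - 1)) = 0 := by
    intro g
    obtain ⟨h1, h2⟩ := A.pow_mem_torsion (k := 1) he (by norm_num) g
    exact (hM _ h1).2 (by simpa using h2)
  -- Otherwise `g` would be a 2^e-cycle in `B`, but g^(2^(e-1)) fixes 0 there.
  have hodd : ∀ g, IsUnit (B.tr g) → 4 ∣ B.lin g + 1 := by
    intro g hg
    refine (four_dvd_or (B.isUnit_lin g)).resolve_left fun h => ?_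
    have := (B.tr_pow_eq_zero h hg _).1 (hpow g)
    rw [Nat.pow_dvd_pow_iff_le_right (by norm_num)] at this
    omega
  obtain ⟨p, hp⟩ := hs 1
  have hpu : IsUnit (B.tr p) := hp ▸ isUnit_one
  have heven : ∀ g, 2 ∣ B.tr g → 4 ∣ B.lin g - 1 := by
    intro g hg
    refine (four_dvd_or (B.isUnit_lin g)).resolve_right fun h => ?_
    exact not_four_dvd_both (by omega) (B.four_dvd_lin_mul' (hodd p hpu) h)
      (hodd _ (B.isUnit_tr_mul hpu hg))
  obtain ⟨t, ht⟩ := hs 2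
  have ht4 := heven t (ht ▸ dvd_rfl)
  have htA := A.pow_mem_torsion (k := 2) he le_rfl t
  have ht2 : A.tr (t ^ 2 ^ (e - 1)) ≠ 0 := by
    intro h0
    have h5 := A.tr_pow_of_lin_eq_one htA.1 2
    rw [← pow_mul, ← pow_succ, show e - 2 + 1 = e - 1 by omega, h0] at h5
    exact B.tr_pow_two_pow_ne_zero ht4 (Or.inr ht) (by omega)
      ((hM _ htA.1).2 (by exact_mod_cast h5.symm))
  have hta : 4 ∣ A.lin t - 1 := (four_dvd_or (A.isUnit_lin t)).resolve_right fun h =>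
    ht2 (A.tr_pow_two_pow_pred_self (by omega) h)
  have htu : IsUnit (A.tr t) := (two_dvd_or_isUnit _).resolve_left fun h => by
    obtain ⟨w, hw, hsum⟩ := geom_sum_eq hta (2 ^ (e - 1))
    apply ht2
    rw [tr_pow, hsum]
    push_cast
    rw [mul_assoc]
    exact two_pow_pred_mul_even (by omega) (h.mul_left _)
  by_contra hnn
  -- If all of `H` acted in `B` with linear part 1, it would act trivially, and so would its
  -- conjugates.
  have hz0 : ∃ z, B.tr z = 0 ∧ B.lin z ≠ 1 := by
    by_contra! hall
    refine hnn (hB ▸ ⟨fun z hz g => ?_⟩)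
    change B.tr _ = 0
    rw [B.tr_conj (hall z hz), show B.tr z = 0 from hz, mul_zero]
  obtain ⟨z, hz, hzl⟩ : ∃ z, B.tr z = 0 ∧ B.lin z = 1 + 2 ^ (e - 1) := by
    obtain ⟨z, hz, hzl⟩ := hz0
    obtain ⟨m, hm⟩ := exists_pow_eq_one_add (heven z (hz ▸ dvd_zero _)) hzl
    exact ⟨z ^ m, B.stab.pow_mem hz m, by rw [map_pow, hm]⟩
  have htwo : 2 * (2 : ZMod (2 ^ e)) ^ (e - 1) = 0 := two_mul_two_pow_pred (by omega)
  have hq : 2 * A.tr ⁅z, t⁆ = 0 := by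
    rw [← hM _ (A.lin_commutator z t), tr_commutator, hz, hzl, ht]
    linear_combination htwo
  rw [tr_commutator] at hq
  obtain ⟨m, hm⟩ := A.exists_pow_tr_eq hta htu (A.tr z)
  have hgeom := geom_sum_mul (A.lin t) m
  have hsum : (∑ i ∈ Finset.range m, A.lin t ^ i) * A.tr t = A.tr z := by rw [← tr_pow, hm]
  -- In `A`, `z` and t^m send 0 to the same point, and ε measures how their linear parts differ. As
  -- [z, t] fixes 0 in `B`, it is killed by 2 in `A`, which forces 2ε = 0.
  obtain ⟨ε, hε⟩ : ∃ ε, ε = A.lin z - A.lin t ^ m := ⟨_, rfl⟩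
  have hε2 : 2 * ε = 0 := by
    rw [← htu.mul_right_eq_zero, hε]
    linear_combination hq + 2 * (1 - A.lin t) * hsum + 2 * A.tr t * hgeom
  have hεε : ε * ε = 0 := sq_eq_zero_of_two_mul (by omega) hε2
  -- The squares of `z` and t^m have equal linear parts in `A` and differ by a translation killed by
  -- 2. That translation is in `H`, so t^(2m) ∈ H.
  have hw : B.tr ((z * z)⁻¹ * (t ^ m * t ^ m)) = 0 := by
    have hl2 : A.lin (z * z) = A.lin (t ^ m * t ^ m) := by
      rw [map_mul, map_mul, map_pow, show A.lin z = A.lin t ^ m + ε by rw [hε]; ring]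
      linear_combination A.lin t ^ m * hε2 + hεε
    rw [hM]
    · rw [tr_mul, tr_inv, A.tr_mul z, A.tr_mul (t ^ m), hm, map_pow,
        show A.lin z = A.lin t ^ m + ε by rw [hε]; ring]
      linear_combination (-A.lin (z * z)⁻¹ * A.tr z) * hε2
    · rw [map_mul, ← hl2, lin_inv_mul]
  have hzz : B.tr (z * z) = 0 := by rw [tr_mul, hz]; ring
  have htm : B.tr (t ^ (m + m)) = 0 := by
    rw [pow_add]
    have h3 : B.tr (z * z * ((z * z)⁻¹ * (t ^ m * t ^ m))) = 0 := by
      rw [tr_mul, hzz, hw]; ring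
    rwa [mul_inv_cancel_left] at h3
  obtain ⟨w, hwu, hws⟩ := geom_sum_eq ht4 (m + m)
  -- In `B` the translation part of t^(2m) is 4m times a unit. Hence t^m has linear part 1 in `A`,
  -- and `A.tr z` is killed by 4.
  have hm4 : 2 ^ (e - 2) ∣ m := by
    rw [tr_pow, hws, ht, mul_assoc, mul_comm w, ← mul_assoc, hwu.mul_left_eq_zero] at htm
    have h4 : ((4 * m : ℕ) : ZMod (2 ^ e)) = 0 := by
      push_cast at htm ⊢
      linear_combination htm
    rw [ZMod.natCast_eq_zero_iff, show 2 ^ e = 4 * 2 ^ (e - 2) by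
      rw [show 4 = 2 ^ 2 by norm_num, ← pow_add]; congr 1; omega] at h4
    exact Nat.dvd_of_mul_dvd_mul_left (by norm_num) h4
  obtain ⟨j, rfl⟩ := hm4
  obtain ⟨v, -, hv⟩ := geom_sum_eq hta (2 ^ (e - 2) * j)
  have h1a : A.lin t ^ (2 ^ (e - 2) * j) = 1 := by
    rw [pow_mul, pow_two_pow_eq_one he (A.isUnit_lin t), one_pow]
  rw [h1a] at hε
  have hfin : B.tr ⁅z, p⁆ = 0 := by
    rw [hM _ (A.lin_commutator z p), tr_commutator, ← hsum, hv]
    obtain ⟨k, hk⟩ := unit_eq_add (A.isUnit_lin p)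
    have h4 : (2 : ZMod (2 ^ e)) ^ (e - 2) * 4 = 0 := by
      rw [show (4 : ZMod (2 ^ e)) = 2 ^ 2 by norm_num, ← pow_add, Nat.sub_add_cancel (by omega),
        two_pow_self]
    rw [hk]
    push_cast
    linear_combination (-k * j * v * A.tr t) * h4 + A.tr p * hε2 - 2 * A.tr p * hε
  rw [tr_commutator, hz, hzl, hp] at hfin
  exact two_pow_ne_zero (e := e) (k := e - 1) (by omega) (by linear_combination hfin)

end AffineAction

/-! ### The obstruction from fixed point free reflections. -/

namespace AffineAction

open scoped commutatorElement

variable {e : ℕ} {G : Type*} [Group G] (A : AffineAction e G)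

/-- The elements whose linear part is `≡ 1` modulo `4`. -/
def positive : Subgroup G where
  carrier := {g | 4 ∣ A.lin g - 1}
  one_mem' := by rw [Set.mem_ofPred_eq, map_one, sub_self]; exact dvd_zero 4
  mul_mem' hg hh := A.four_dvd_lin_mul hg hh
  inv_mem' {g} hg := by
    have h := (dvd_neg.2 hg).mul_left (A.lin g⁻¹)
    have h2 := A.lin_inv_mul g
    have h3 : A.lin g⁻¹ - 1 = A.lin g⁻¹ * -(A.lin g - 1) := by linear_combination h2
    rw [Set.mem_ofPred_eq, h3]
    exact h

theorem mem_positive {g : G} : g ∈ A.positive ↔ 4 ∣ A.lin g - 1 := Iff.rfl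

theorem commutator_le {x : ZMod (2 ^ e)} (h : ∀ g k : G, x * A.tr ⁅g, k⁆ = 0) :
    commutator G ≤ A.torsion x := by
  rw [commutator_def, Subgroup.commutator_le]
  exact fun g _ k _ => ⟨A.lin_commutator g k, h g k⟩

section

variable {A} {h s : G} (hh : A.lin h = -1) (hu : IsUnit (A.tr h))
  (hs : A.lin s = 1 + 2 ^ (e - 1)) (hst : A.stab = Subgroup.zpowers s)
include hh hu hs hst

/-- The linear part modulo 4 is determined by the parity of the translation part. An element with
odd translation part and linear part ≡ 1 would have transitive powers, so `h` would be such a power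
times an element of the stabiliser ⟨s⟩, making its linear part ≡ 1 instead of -1. -/
theorem lin_eq_one_add (he : 3 ≤ e) (g : G) : 4 ∣ A.lin g - 1 - 2 * A.tr g := by
  have h4 : (4 : ZMod (2 ^ e)) ∣ 2 ^ (e - 1) := by
    rw [show (4 : ZMod (2 ^ e)) = 2 ^ 2 by norm_num]
    exact pow_dvd_pow 2 (by omega)
  have hsp : s ∈ A.positive := by
    rw [mem_positive, hs, add_sub_cancel_left]; exact h4
  have hodd : ∀ g, IsUnit (A.tr g) → 4 ∣ A.lin g + 1 := by
    intro g hg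
    refine (four_dvd_or (A.isUnit_lin g)).resolve_left fun hg4 => ?_
    obtain ⟨m, hm⟩ := A.exists_pow_tr_eq hg4 hg (A.tr h)
    have h1 : (g ^ m)⁻¹ * h ∈ A.stab := A.inv_mul_mem_stab.2 hm
    rw [hst] at h1
    have h2 : h ∈ A.positive := by
      have := A.positive.mul_mem (A.positive.pow_mem hg4 m)
        ((Subgroup.zpowers_le.2 hsp) h1)
      rwa [mul_inv_cancel_left] at this
    rw [mem_positive, hh] at h2
    apply not_four_dvd_two (e := e) (by omega)
    rw [← dvd_neg]
    convert h2 using 1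
    ring
  rcases two_dvd_or_isUnit (A.tr g) with hg | hg
  · have h1 : 4 ∣ A.lin g - 1 := by
      refine (four_dvd_or (A.isUnit_lin g)).resolve_right fun hg4 => ?_
      exact not_four_dvd_both (by omega)
        (A.four_dvd_lin_mul' (hodd h hu) hg4) (hodd _ (A.isUnit_tr_mul hu hg))
    obtain ⟨k, hk⟩ := hg
    refine dvd_sub h1 ⟨k, ?_⟩
    rw [hk]; ring
  · obtain ⟨k, hk⟩ := hodd g hg
    obtain ⟨j, hj⟩ := unit_eq_add hg
    exact ⟨k - 1 - j, by rw [hj]; linear_combination hk⟩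

theorem four_dvd_tr_commutator (he : 3 ≤ e) (g k : G) : 4 ∣ A.tr ⁅g, k⁆ := by
  obtain ⟨a, ha⟩ := lin_eq_one_add hh hu hs hst he g
  obtain ⟨b, hb⟩ := lin_eq_one_add hh hu hs hst he k
  refine ⟨a * A.tr k - b * A.tr g, ?_⟩
  rw [tr_commutator]
  linear_combination A.tr k * ha - A.tr g * hb

end

variable {A} (hA : A.Faithful)
include hA

theorem Faithful.card_ker_le : Nat.card A.lin.ker ≤ 2 ^ e := by
  have h := hA.card_le le_rfl Finset.univ fun _ _ => Finset.mem_univ _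
  rwa [Finset.card_univ, ZMod.card] at h

/-- There are at most 2^e translations, so |G ∩ N| ≥ 8 already gives e ≥ 3. For e = 2 all
commutators are killed by 2, which excludes a commutator subgroup of order 4. -/
theorem Faithful.three_le {h : 8 ≤ Nat.card A.lin.ker ∨
    (Nat.card A.lin.ker = 4 ∧ Nat.card (commutator G) = 4)} : 3 ≤ e := by
  have h1 := hA.card_ker_le
  rcases h with h | ⟨h, hc⟩
  · by_contra he
    have : 2 ^ e ≤ 2 ^ 2 := Nat.pow_le_pow_right (by norm_num) (by omega)
    omega
  · by_contra he
    have he2 : 2 ≤ e := by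
      by_contra he
      have : 2 ^ e ≤ 2 ^ 1 := Nat.pow_le_pow_right (by norm_num) (by omega)
      omega
    have h2 := hA.card_le_two (by omega) (A.commutator_le (x := 2) fun g k => by
      obtain ⟨a, ha⟩ := unit_eq_add (A.isUnit_lin g)
      obtain ⟨b, hb⟩ := unit_eq_add (A.isUnit_lin k)
      have h4 : (4 : ZMod (2 ^ e)) = 0 := by
        rw [show (4 : ZMod (2 ^ e)) = 2 ^ 2 by norm_num]
        exact two_pow_eq_zero (by omega)
      rw [tr_commutator, ha, hb]
      linear_combination (a * A.tr k - b * A.tr g) * h4)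
    omega

variable {h s : G} (hh : A.lin h = -1)
include hh

theorem Faithful.mul_self_eq_one : h * h = 1 :=
  hA _ (by rw [tr_mul, hh]; ring) (by rw [map_mul, hh]; ring)

theorem Faithful.mem_zpowers_iff (x : G) : x ∈ Subgroup.zpowers h ↔ x = 1 ∨ x = h := by
  have h2 := hA.mul_self_eq_one hh
  constructor
  · intro hx
    obtain ⟨k, rfl⟩ := Subgroup.mem_zpowers_iff.1 hx
    have h3 : ∀ m : ℤ, h ^ (2 * m) = 1 := fun m => by
      rw [zpow_mul, zpow_two, h2, one_zpow]
    rcases Int.even_or_odd' k with ⟨m, rfl | rfl⟩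
    · exact Or.inl (h3 m)
    · right
      rw [zpow_add, h3, one_mul, zpow_one]
  · rintro (rfl | rfl)
    · exact one_mem _
    · exact Subgroup.mem_zpowers _

variable (hu : IsUnit (A.tr h)) (hs : A.lin s = 1 + 2 ^ (e - 1))
  (hst : A.stab = Subgroup.zpowers s)
include hu hs hst

theorem Faithful.not_isAffineStabilizer (hidx : (Subgroup.zpowers h).index = 2 ^ e)
    (hc : 8 ≤ Nat.card A.lin.ker ∨
      (Nat.card A.lin.ker = 4 ∧ Nat.card (commutator G) = 4)) :
    ¬ IsAffineStabilizer e (Subgroup.zpowers h) := by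
  rintro ⟨B, hB⟩
  have he : 3 ≤ e := hA.three_le (h := hc)
  have hsurj := B.surjective_of_index (hB ▸ hidx)
  have hs0 : A.tr s = 0 := by
    rw [← mem_stab, hst]; exact Subgroup.mem_zpowers s
  have hBh : B.tr h = 0 := by
    rw [← mem_stab, hB]; exact Subgroup.mem_zpowers h
  have hh2 := hA.mul_self_eq_one hh
  have htwo : 2 * (2 : ZMod (2 ^ e)) ^ (e - 1) = 0 := two_mul_two_pow_pred (by omega)
  -- Otherwise `h` would act trivially in `B`, so [h, s] would lie in ⟨h⟩; but in `A` it is the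
  -- translation by 2^(e-1).
  have hlin : B.lin h ≠ 1 := by
    intro h1
    have h2 : B.tr ⁅h, s⁆ = 0 := by rw [tr_commutator, hBh, h1]; ring
    rw [← mem_stab, hB, hA.mem_zpowers_iff hh] at h2
    have h3 : A.tr ⁅h, s⁆ = 2 ^ (e - 1) := by
      rw [tr_commutator, hs0, hs]
      linear_combination -two_pow_mul_self_eq (by omega) hu - htwo
    have h4 := A.lin_commutator h s
    rcases h2 with h2 | h2
    · rw [h2, tr_one] at h3
      exact two_pow_ne_zero (by omega) h3.symm
    · rw [h2, hh] at h4
      apply two_pow_ne_zero (e := e) (k := 1) (by omega)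
      linear_combination -h4
  have hBfaith : B.Faithful := by
    intro g h1 h2
    rw [← mem_stab, hB, hA.mem_zpowers_iff hh] at h1
    rcases h1 with rfl | rfl
    · rfl
    · exact absurd h2 hlin
  have hsq : B.lin h * B.lin h = 1 := by rw [← map_mul, hh2, map_one]
  rcases four_dvd_or (B.isUnit_lin h) with h4 | h4
  · have hd := (sq_eq_one_of_four_dvd_sub (by omega) h4 hsq).resolve_left hlin
    -- With linear part 1 + 2^(e-1), `h` has only involutive commutators in `B`. Read in `A`, this
    -- says that translations are killed by 4 and commutators by 2.
    have key : ∀ g, 2 * (A.tr h * (1 - A.lin g)) = 4 * A.tr g := by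
      intro g
      have h1 : ⁅h, g⁆ * ⁅h, g⁆ = 1 := by
        refine hBfaith _ ?_ (by rw [map_mul, lin_commutator, one_mul])
        rw [tr_mul, lin_commutator, tr_commutator, hBh, hd]
        linear_combination B.tr g * htwo
      have h2 := congrArg A.tr h1
      rw [tr_mul, lin_commutator, tr_one, tr_commutator, hh] at h2
      linear_combination h2
    have hker : A.lin.ker ≤ A.torsion 4 := fun n hn => ⟨hn, by
      rw [← key, MonoidHom.mem_ker.1 hn]; ring⟩
    have hcard := hA.card_le_four (by omega) hker
    rcases hc with hc | ⟨-, hc⟩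
    · omega
    · have := hA.card_le_two (by omega) (A.commutator_le (x := 2) fun g k => by
        rw [← hu.mul_right_eq_zero, tr_commutator]
        linear_combination A.tr g * key k - A.tr k * key g)
      omega
  · obtain ⟨p, hp⟩ := hsurj 1
    obtain ⟨k, hk⟩ := four_dvd_tr_commutator hh hu hs hst he p h
    -- In `A` the commutator translates by a multiple of 4. In `B` it translates by 1 - `B.lin h`,
    -- twice a unit, so this power cannot be trivial.
    have h1 : ⁅p, h⁆ ^ 2 ^ (e - 2) = 1 := by
      refine hA _ ?_ (by rw [map_pow, lin_commutator, one_pow])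
      rw [A.tr_pow_of_lin_eq_one (A.lin_commutator _ _), hk]
      push_cast
      rw [← mul_assoc, show (4 : ZMod (2 ^ e)) = 2 ^ 2 by norm_num, ← pow_add,
        Nat.sub_add_cancel (by omega), two_pow_self, zero_mul]
    have h2 := B.tr_pow_of_lin_eq_one (B.lin_commutator p h) (2 ^ (e - 2))
    obtain ⟨j, hj⟩ := h4
    rw [h1, tr_one, tr_commutator, hBh, hp, show B.lin h = 4 * j - 1 by linear_combination hj] at h2
    have h3 : (2 : ZMod (2 ^ e)) ^ (e - 1) * (1 + 2 * -j) = 0 := by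
      rw [show e - 1 = e - 2 + 1 by omega, pow_succ]
      push_cast at h2
      linear_combination -h2
    rw [two_pow_mul_unit_eq_zero (isUnit_add_of_two_dvd isUnit_one ⟨-j, rfl⟩)] at h3
    omega

end AffineAction

/-! ### Regular affine actions of groups with a cyclic subgroup of index two. -/

/-- An invertible affine map `x ↦ lin * x + tr` of a commutative ring. -/
@[ext]
structure AffineMapUnit (R : Type*) [CommRing R] where
  tr : R
  lin : Rˣ

namespace AffineMapUnit

variable {R : Type*} [CommRing R]

instance : Mul (AffineMapUnit R) := ⟨fun f g => ⟨f.tr + f.lin * g.tr, f.lin * g.lin⟩⟩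

instance : One (AffineMapUnit R) := ⟨⟨0, 1⟩⟩

instance : Inv (AffineMapUnit R) := ⟨fun f => ⟨-(↑f.lin⁻¹ * f.tr), f.lin⁻¹⟩⟩

theorem mul_tr (f g : AffineMapUnit R) : (f * g).tr = f.tr + f.lin * g.tr := rfl

theorem mul_lin (f g : AffineMapUnit R) : (f * g).lin = f.lin * g.lin := rfl

theorem one_tr : (1 : AffineMapUnit R).tr = 0 := rfl

theorem one_lin : (1 : AffineMapUnit R).lin = 1 := rfl

theorem inv_tr (f : AffineMapUnit R) : f⁻¹.tr = -(↑f.lin⁻¹ * f.tr) := rfl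

theorem inv_lin (f : AffineMapUnit R) : f⁻¹.lin = f.lin⁻¹ := rfl

instance : Group (AffineMapUnit R) :=
  Group.ofLeftAxioms
    (fun f g h => by
      ext
      · simp only [mul_tr, mul_lin, Units.val_mul]; ring
      · simp only [mul_lin, Units.val_mul]; ring)
    (fun f => by ext <;> simp [mul_tr, mul_lin, one_tr, one_lin])
    (fun f => by ext <;> simp [mul_tr, mul_lin, one_tr, one_lin, inv_tr, inv_lin])

theorem ext_val {f g : AffineMapUnit R} (h1 : f.tr = g.tr) (h2 : (f.lin : R) = g.lin) : f = g :=
  AffineMapUnit.ext h1 (Units.ext h2)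

/-- The tautological action of the affine group of `ZMod (2 ^ e)`. -/
def action (e : ℕ) : AffineAction e (AffineMapUnit (ZMod (2 ^ e))) where
  lin :=
    { toFun := fun f => f.lin
      map_one' := rfl
      map_mul' := fun _ _ => rfl }
  tr f := f.tr
  tr_mul _ _ := rfl

theorem action_tr {e : ℕ} (f : AffineMapUnit (ZMod (2 ^ e))) : (action e).tr f = f.tr := rfl

theorem action_lin {e : ℕ} (f : AffineMapUnit (ZMod (2 ^ e))) : (action e).lin f = f.lin := rfl

theorem action_faithful (e : ℕ) : (action e).Faithful := fun _ h1 h2 => ext_val h1 h2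

end AffineMapUnit

theorem mul_zpow_of_conj_eq {L : Type*} [Group L] {x y : L} {u : ℤ} (h : y * x * y⁻¹ = x ^ u)
    (i : ℤ) : y * x ^ i = x ^ (u * i) * y := by
  rw [zpow_mul, ← h, conj_zpow, inv_mul_cancel_right]

/-- A homomorphism out of a group with a cyclic subgroup `⟨x⟩` of index two may be defined by
giving the images of `x` and of an element `y` outside `⟨x⟩`. -/
theorem exists_hom_of_index_two_zpowers {Q K : Type*} [Group Q] [Group K] {x y : Q}
    (hcov : ∀ q, ∃ i : ℤ, q = x ^ i ∨ q = x ^ i * y) (hy : y ∉ Subgroup.zpowers x) {u j : ℤ}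
    (h1 : y * x * y⁻¹ = x ^ u) (h2 : y * y = x ^ j) {X Y : K} (hX : X ^ orderOf x = 1)
    (h1X : Y * X * Y⁻¹ = X ^ u) (h2X : Y * Y = X ^ j) : ∃ f : Q →* K, f x = X ∧ f y = Y := by
  -- The graph of the homomorphism on the normal forms x^i and x^i y. It is single valued because
  -- the order of `X` divides that of `x` and because `y` is outside ⟨x⟩.
  let r : Q → K → Prop := fun q k =>
    ∃ i : ℤ, (q = x ^ i ∧ k = X ^ i) ∨ (q = x ^ i * y ∧ k = X ^ i * Y)
  have htot : ∀ q, ∃ k, r q k := by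
    intro q
    obtain ⟨i, rfl | rfl⟩ := hcov q
    · exact ⟨X ^ i, i, Or.inl ⟨rfl, rfl⟩⟩
    · exact ⟨X ^ i * Y, i, Or.inr ⟨rfl, rfl⟩⟩
  have hpow : ∀ i k : ℤ, x ^ i = x ^ k → X ^ i = X ^ k := by
    intro i k h
    have h3 : x ^ (i - k) = 1 := by rw [zpow_sub, h, mul_inv_cancel]
    obtain ⟨m, hm⟩ := orderOf_dvd_iff_zpow_eq_one.2 h3
    have h4 : X ^ (i - k) = 1 := by rw [hm, zpow_mul, zpow_natCast, hX, one_zpow]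
    rw [zpow_sub, mul_inv_eq_one] at h4
    exact h4
  have hne : ∀ i k : ℤ, x ^ i ≠ x ^ k * y := by
    intro i k h
    apply hy
    rw [← inv_mul_eq_iff_eq_mul] at h
    rw [← h]
    exact mul_mem (inv_mem (Subgroup.zpow_mem_zpowers x k)) (Subgroup.zpow_mem_zpowers x i)
  have hfun : ∀ q k l, r q k → r q l → k = l := by
    rintro q k l ⟨i, ⟨rfl, rfl⟩ | ⟨rfl, rfl⟩⟩ ⟨i', ⟨h, rfl⟩ | ⟨h, rfl⟩⟩
    · exact hpow _ _ h
    · exact absurd h (hne _ _)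
    · exact absurd h.symm (hne _ _)
    · rw [hpow _ _ (mul_right_cancel h)]
  have hmul : ∀ q k q' k', r q k → r q' k' → r (q * q') (k * k') := by
    rintro q k q' k' ⟨i, ⟨rfl, rfl⟩ | ⟨rfl, rfl⟩⟩ ⟨i', ⟨rfl, rfl⟩ | ⟨rfl, rfl⟩⟩
    · exact ⟨i + i', Or.inl ⟨(zpow_add _ _ _).symm, (zpow_add _ _ _).symm⟩⟩
    · exact ⟨i + i', Or.inr ⟨by rw [zpow_add, mul_assoc], by rw [zpow_add, mul_assoc]⟩⟩
    · exact ⟨i + u * i', Or.inr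
        ⟨by rw [mul_assoc, mul_zpow_of_conj_eq h1, zpow_add, mul_assoc],
          by rw [mul_assoc, mul_zpow_of_conj_eq h1X, zpow_add, mul_assoc]⟩⟩
    · refine ⟨i + u * i' + j, Or.inl ⟨?_, ?_⟩⟩
      · rw [mul_assoc, ← mul_assoc y, mul_zpow_of_conj_eq h1, mul_assoc (x ^ (u * i')), h2, zpow_add, zpow_add,
          mul_assoc]
      · rw [mul_assoc, ← mul_assoc Y, mul_zpow_of_conj_eq h1X, mul_assoc (X ^ (u * i')), h2X, zpow_add, zpow_add,
          mul_assoc]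
  choose F hF using htot
  refine ⟨MonoidHom.mk' F fun q q' => hfun _ _ _ (hF _) (hmul _ _ _ _ (hF q) (hF q')), ?_, ?_⟩
  · exact hfun x _ _ (hF x) ⟨1, Or.inl ⟨(zpow_one _).symm, (zpow_one _).symm⟩⟩
  · exact hfun y _ _ (hF y) ⟨0, Or.inr ⟨by simp, by simp⟩⟩

namespace AffineAction

variable {e : ℕ}

/-- The powers of `X` carry 0 to each even point, and composing with `Y` gives odd points. Since the
powers of `x` number only 2^(e-1), no nontrivial element of `Q` fixes 0. -/
theorem isAffineStabilizer_bot_of_relations {Q : Type*} [Group Q] (he : 2 ≤ e) {x y : Q}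
    (hx : orderOf x = 2 ^ (e - 1)) (hcov : ∀ q, ∃ i : ℤ, q = x ^ i ∨ q = x ^ i * y)
    (hy : y ∉ Subgroup.zpowers x) {u j : ℤ} (h1 : y * x * y⁻¹ = x ^ u) (h2 : y * y = x ^ j)
    {X Y : AffineMapUnit (ZMod (2 ^ e))} (hX : X.tr = 2) (hXl : 4 ∣ (X.lin : ZMod (2 ^ e)) - 1)
    (hY : Y.tr = 1) (h1X : Y * X = X ^ u * Y) (h2X : Y * Y = X ^ j) :
    IsAffineStabilizer e (⊥ : Subgroup Q) := by
  have hpow : X ^ orderOf x = 1 := by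
    rw [hx]
    refine AffineMapUnit.action_faithful e _ ?_ ?_
    · obtain ⟨w, hw, hs⟩ := geom_sum_eq hXl (2 ^ (e - 1))
      rw [tr_pow, AffineMapUnit.action_lin, AffineMapUnit.action_tr, hs, hX]
      push_cast
      rw [mul_assoc]
      exact two_pow_pred_mul_even (by omega) (Dvd.intro_left w rfl)
    · have h3 := pow_two_pow_sub_one (r := 2) (by norm_num) (by norm_num; exact hXl) (e - 1)
      rw [two_pow_eq_zero (show e ≤ 2 + (e - 1) by omega), zero_dvd_iff, sub_eq_zero] at h3
      rw [map_pow]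
      exact h3
  obtain ⟨f, hfx, hfy⟩ := exists_hom_of_index_two_zpowers hcov hy h1 h2 hpow
    (by rw [h1X, mul_inv_cancel_right]) h2X
  let B : AffineAction e Q := (AffineMapUnit.action e).comap f
  have hBx : B.tr x = 2 := by rw [← hX, ← hfx]; rfl
  have hBy : B.tr y = 1 := by rw [← hY, ← hfy]; rfl
  have hBl : 4 ∣ B.lin x - 1 := by rw [← hfx] at hXl; exact hXl
  have hord : IsOfFinOrder x := orderOf_pos_iff.1 (by rw [hx]; positivity)
  refine ⟨B, (Subgroup.eq_bot_iff_forall _).2 fun q hq => ?_⟩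
  obtain ⟨i, hi⟩ := hcov q
  obtain ⟨m, hm⟩ := hord.mem_powers_iff_mem_zpowers.2 (Subgroup.zpow_mem_zpowers x i)
  simp only at hm
  rw [← hm] at hi
  obtain ⟨w, hw, hs⟩ := geom_sum_eq hBl m
  have hxm : B.tr (x ^ m) = 2 * (m * w) := by rw [tr_pow, hs, hBx]; ring
  rcases hi with rfl | rfl
  · rw [mem_stab, hxm, ← mul_assoc, hw.mul_left_eq_zero] at hq
    have h4 : ((2 * m : ℕ) : ZMod (2 ^ e)) = 0 := by push_cast; exact hq
    rw [ZMod.natCast_eq_zero_iff, show 2 ^ e = 2 * 2 ^ (e - 1) by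
      rw [← pow_succ']; congr 1; omega] at h4
    exact orderOf_dvd_iff_pow_eq_one.1 (hx ▸ Nat.dvd_of_mul_dvd_mul_left (by norm_num) h4)
  · exfalso
    have hun : IsUnit (B.tr (x ^ m * y)) :=
      B.isUnit_tr_mul' ⟨_, hxm⟩ (hBy ▸ isUnit_one)
    rw [show B.tr (x ^ m * y) = 0 from hq] at hun
    exact not_two_dvd_of_isUnit (by omega) hun (dvd_zero 2)

/-- A group of order `2 ^ e` with a cyclic subgroup of index two has a regular affine action on
`ZMod (2 ^ e)`. -/
theorem isAffineStabilizer_bot {Q : Type*} [Group Q] (he : 2 ≤ e) (hQ : Nat.card Q = 2 ^ e) {x : Q}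
    (hx : orderOf x = 2 ^ (e - 1)) : IsAffineStabilizer e (⊥ : Subgroup Q) := by
  have hfin : Finite Q := Nat.finite_of_card_ne_zero (by rw [hQ]; positivity)
  have hidx : (Subgroup.zpowers x).index = 2 := by
    have h := (Subgroup.zpowers x).card_mul_index
    rw [Nat.card_zpowers, hx, hQ, show 2 ^ e = 2 ^ (e - 1) * 2 by
      rw [← pow_succ]; congr 1; omega] at h
    exact Nat.eq_of_mul_eq_mul_left (by positivity) h
  have hnorm : (Subgroup.zpowers x).Normal := Subgroup.normal_of_index_eq_two hidx
  obtain ⟨y, hy⟩ : ∃ y, y ∉ Subgroup.zpowers x := by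
    by_contra! h
    rw [(Subgroup.eq_top_iff' _).2 h, Subgroup.index_top] at hidx
    omega
  have hcov : ∀ z, z ∉ Subgroup.zpowers x → ∀ q, ∃ i : ℤ, q = x ^ i ∨ q = x ^ i * z := by
    intro z hz q
    by_cases hq : q ∈ Subgroup.zpowers x
    · obtain ⟨i, rfl⟩ := Subgroup.mem_zpowers_iff.1 hq
      exact ⟨i, Or.inl rfl⟩
    · have h : q * z⁻¹ ∈ Subgroup.zpowers x := by
        rw [Subgroup.mul_mem_iff_of_index_two hidx, inv_mem_iff]
        exact iff_of_false hq hz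
      obtain ⟨i, hi⟩ := Subgroup.mem_zpowers_iff.1 h
      exact ⟨i, Or.inr (by rw [hi, inv_mul_cancel_right])⟩
  obtain ⟨u, hu⟩ := Subgroup.mem_zpowers_iff.1 (hnorm.conj_mem x (Subgroup.mem_zpowers x) y)
  obtain ⟨j, hj⟩ := Subgroup.mem_zpowers_iff.1
    ((Subgroup.mul_mem_iff_of_index_two hidx (a := y) (b := y)).2 Iff.rfl)
  have hz : ∀ a b : ℤ, x ^ a = x ^ b ↔ (a : ZMod (2 ^ (e - 1))) = b := by
    intro a b
    rw [zpow_eq_zpow_iff_modEq, hx, ZMod.intCast_eq_intCast_iff]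
  have hcomm : ∀ i : ℤ, y * x ^ i * y⁻¹ = x ^ (u * i) := by
    intro i
    rw [← conj_zpow, ← hu, ← zpow_mul]
  have huu : (u : ZMod (2 ^ (e - 1))) * u = 1 := by
    have h : x ^ (u * u) = x ^ (1 : ℤ) := by
      rw [← hcomm, hu, zpow_one, mul_assoc, mul_assoc, ← mul_inv_rev, ← hj, ← mul_assoc, ← mul_assoc,
        ← hj]
      rw [← zpow_neg, ← zpow_add_one, ← zpow_add, show j + 1 + -j = 1 by ring, zpow_one]
    rw [hz] at h
    exact_mod_cast h
  have hju : (j : ZMod (2 ^ (e - 1))) * (u - 1) = 0 := by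
    have h : x ^ (u * j) = x ^ j := by rw [← hcomm, hj]; group
    rw [hz] at h
    push_cast at h
    linear_combination h
  /- The element `x ^ k * y` can be used in place of `y`. -/
  have main : ∀ (k u' j' : ℤ), (u' : ZMod (2 ^ (e - 1))) = u →
      (j' : ZMod (2 ^ (e - 1))) = j + k * (1 + u) → ∀ a b : (ZMod (2 ^ e))ˣ,
      4 ∣ (a : ZMod (2 ^ e)) - 1 →
      (⟨1, b⟩ : AffineMapUnit (ZMod (2 ^ e))) * ⟨2, a⟩ = ⟨2, a⟩ ^ u' * ⟨1, b⟩ →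
      (⟨1, b⟩ : AffineMapUnit (ZMod (2 ^ e))) * ⟨1, b⟩ = ⟨2, a⟩ ^ j' →
      IsAffineStabilizer e (⊥ : Subgroup Q) := by
    intro k u' j' hu' hj' a b ha hab hbb
    have hy' : x ^ k * y ∉ Subgroup.zpowers x := by
      rwa [Subgroup.mul_mem_cancel_left _ (Subgroup.zpow_mem_zpowers x k)]
    refine isAffineStabilizer_bot_of_relations he hx (hcov _ hy') hy' (u := u') (j := j') ?_ ?_
      rfl ha rfl hab hbb
    · rw [(hz _ _).2 hu', hu, mul_inv_rev, mul_assoc, mul_assoc, ← mul_assoc x, ← mul_assoc y,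
        ← mul_assoc y, ← hu, ← zpow_neg, ← zpow_add, ← zpow_add]
      congr 1; ring
    · have h3 : x ^ j' = x ^ (k + u * k + j) := by
        rw [hz]; push_cast; linear_combination hj'
      rw [h3, zpow_add, zpow_add, ← hcomm, hj]
      group
  have hX : ∀ a : (ZMod (2 ^ e))ˣ, 4 ∣ (a : ZMod (2 ^ e)) - 1 →
      (⟨2, a⟩ : AffineMapUnit (ZMod (2 ^ e))) ^ ((2 : ℤ) ^ (e - 2)) = ⟨2 ^ (e - 1), 1⟩ := by
    intro a ha
    rw [show ((2 : ℤ) ^ (e - 2)) = ((2 ^ (e - 2) : ℕ) : ℤ) by push_cast; rfl, zpow_natCast]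
    apply AffineMapUnit.ext_val
    · rw [← AffineMapUnit.action_tr, tr_pow, AffineMapUnit.action_tr, AffineMapUnit.action_lin]
      obtain ⟨w, hw, hs⟩ := geom_sum_eq ha (2 ^ (e - 2))
      rw [hs, ← two_pow_mul_self_eq (by omega) hw, show e - 1 = e - 2 + 1 by omega]
      push_cast
      ring
    · rw [← AffineMapUnit.action_lin, map_pow, AffineMapUnit.action_lin]
      have h3 := pow_two_pow_sub_one (r := 2) (by norm_num) (by norm_num; exact ha) (e - 2)
      rw [two_pow_eq_zero (show e ≤ 2 + (e - 2) by omega), zero_dvd_iff, sub_eq_zero] at h3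
      exact h3
  have he1 : 1 ≤ e - 1 := by omega
  have htwo : 2 * (2 : ZMod (2 ^ e)) ^ (e - 1) = 0 := two_mul_two_pow_pred (by omega)
  have hsq : (2 : ZMod (2 ^ e)) ^ (e - 1) * 2 ^ (e - 1) = 0 := sq_eq_zero_of_two_mul he htwo
  have huunit : IsUnit (u : ZMod (2 ^ (e - 1))) := IsUnit.of_mul_eq_one _ huu
  -- Since u² = 1 modulo 2^(e-1), `u` is ±1 or ±1 + 2^(e-2). Changing `y` to x^k y normalises y²,
  -- and the linear parts a and b of `X` and `Y` are then solved from the relations.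
  by_cases c1 : (u : ZMod (2 ^ (e - 1))) = 1
  · rcases two_dvd_or_isUnit (j : ZMod (2 ^ (e - 1))) with ⟨i, hi⟩ | hodd
    · obtain ⟨i, rfl⟩ := exists_int i
      -- For Y : z ↦ 1 - z to commute with X : z ↦ az + 2 one needs 2 + a = -1.
      obtain ⟨a, ha⟩ := isUnit_of_four_dvd (e := e) (a := -3) ⟨-1, by ring⟩
      refine main (-i) 1 0 (by rw [c1]; simp) ?_ a (-1) (by rw [ha]; exact ⟨-1, by ring⟩) ?_ ?_
      · rw [c1, hi]; push_cast; ring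
      · refine AffineMapUnit.ext_val ?_ ?_ <;>
        simp only [zpow_one, AffineMapUnit.mul_tr, AffineMapUnit.mul_lin, Units.val_mul, ha,
          Units.val_neg, Units.val_one] <;> ring
      · refine AffineMapUnit.ext_val ?_ ?_ <;>
        simp [AffineMapUnit.mul_tr, AffineMapUnit.mul_lin, AffineMapUnit.one_tr,
          AffineMapUnit.one_lin]
    -- The cyclic case: `Y` is the translation by 1 and X = Y².
    · obtain ⟨i, hi⟩ := unit_eq_add hodd
      obtain ⟨i, rfl⟩ := exists_int i
      refine main (-i) 1 1 (by rw [c1]; simp) ?_ 1 1 (by simp) ?_ ?_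
      · rw [c1, hi]; push_cast; ring
      · refine AffineMapUnit.ext_val ?_ ?_ <;>
        simp only [zpow_one, AffineMapUnit.mul_tr, AffineMapUnit.mul_lin, Units.val_mul,
          Units.val_one] <;> ring
      · refine AffineMapUnit.ext_val ?_ ?_ <;>
        simp only [zpow_one, AffineMapUnit.mul_tr, AffineMapUnit.mul_lin, Units.val_mul,
          Units.val_one] <;> ring
  by_cases c2 : (u : ZMod (2 ^ (e - 1))) = -1
  · have hj2 : 2 * (j : ZMod (2 ^ (e - 1))) = 0 := by
      rw [c2] at hju; linear_combination -hju
    rcases eq_zero_or_of_two_mul he1 hj2 with h0 | h0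
    · refine main 0 (-1) 0 (by rw [c2]; simp) (by rw [h0]; simp) 1 (-1) (by simp) ?_ ?_
      · refine AffineMapUnit.ext_val ?_ ?_ <;>
        simp only [zpow_neg_one, AffineMapUnit.mul_tr, AffineMapUnit.mul_lin, Units.val_mul,
          Units.val_neg, Units.val_one, AffineMapUnit.inv_tr, AffineMapUnit.inv_lin,
          inv_one] <;> ring
      · refine AffineMapUnit.ext_val ?_ ?_ <;>
        simp [AffineMapUnit.mul_tr, AffineMapUnit.mul_lin, AffineMapUnit.one_tr,
          AffineMapUnit.one_lin]
    -- The generalised quaternion case: Y² is the translation by 1 + b = 2^(e-1), which is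
    -- X^(2^(e-2)).
    · have hb2 : ((-1 + 2 ^ (e - 1)) : ZMod (2 ^ e)) * (-1 + 2 ^ (e - 1)) = 1 := by
        linear_combination hsq - htwo
      obtain ⟨b, hb⟩ : IsUnit ((-1 + 2 ^ (e - 1)) : ZMod (2 ^ e)) := IsUnit.of_mul_eq_one _ hb2
      refine main 0 (-1) (2 ^ (e - 2)) (by rw [c2]; simp)
        (by rw [h0, show e - 1 - 1 = e - 2 by omega]; push_cast; ring) 1 b (by simp) ?_ ?_
      · refine AffineMapUnit.ext_val ?_ ?_ <;>
        simp only [zpow_neg_one, AffineMapUnit.mul_tr, AffineMapUnit.mul_lin, Units.val_mul,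
          Units.val_one, AffineMapUnit.inv_tr, AffineMapUnit.inv_lin, inv_one, hb]
        · linear_combination htwo
        · ring
      · rw [hX 1 (by simp)]
        refine AffineMapUnit.ext_val ?_ ?_ <;>
        simp only [AffineMapUnit.mul_tr, AffineMapUnit.mul_lin, Units.val_mul, Units.val_one, hb]
        · ring
        · exact hb2
  have he4 : 4 ≤ e := by
    by_contra he4
    have h4 : (4 : ZMod (2 ^ (e - 1))) = 0 := by
      rw [show (4 : ZMod (2 ^ (e - 1))) = 2 ^ 2 by norm_num]
      exact two_pow_eq_zero (by omega)
    rcases four_dvd_or huunit with h | h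
    · rw [h4, zero_dvd_iff, sub_eq_zero] at h
      exact c1 h
    · rw [h4, zero_dvd_iff] at h
      exact c2 (by linear_combination h)
  have h42 : (4 : ZMod (2 ^ e)) ∣ 2 ^ (e - 1) := by
    rw [show (4 : ZMod (2 ^ e)) = 2 ^ 2 by norm_num]
    exact pow_dvd_pow 2 (by omega)
  have htwo1 : 2 * (2 : ZMod (2 ^ (e - 1))) ^ (e - 2) = 0 := by
    rw [← pow_succ', show e - 2 + 1 = e - 1 by omega, two_pow_self]
  rcases four_dvd_or huunit with h4 | h4
  · have c3 := (sq_eq_one_of_four_dvd_sub he1 h4 huu).resolve_left c1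
    rw [show e - 1 - 1 = e - 2 by omega] at c3
    have hje : 2 ∣ (j : ZMod (2 ^ (e - 1))) := by
      rw [← pow_one (2 : ZMod (2 ^ (e - 1))), ← two_pow_mul_eq_zero (j := e - 2) (by omega)]
      rw [c3] at hju
      linear_combination hju
    obtain ⟨i, hi⟩ := hje
    -- Here 1 + u is twice this unit, so j + k(1 + u) can be made zero for even j.
    obtain ⟨v, hv⟩ : IsUnit (1 + 2 * 2 ^ (e - 4) : ZMod (2 ^ (e - 1))) :=
      isUnit_add_of_two_dvd isUnit_one ⟨_, rfl⟩
    obtain ⟨k, hk⟩ := exists_int (-i * (↑v⁻¹ : ZMod (2 ^ (e - 1))))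
    obtain ⟨a, ha⟩ := isUnit_of_four_dvd (e := e) (a := -3 + 2 ^ (e - 1)) (by
      have := dvd_add (show (4 : ZMod (2 ^ e)) ∣ -4 from ⟨-1, by ring⟩) h42
      convert this using 1; ring)
    have ha4 : 4 ∣ (a : ZMod (2 ^ e)) - 1 := by
      have := dvd_add (show (4 : ZMod (2 ^ e)) ∣ -4 from ⟨-1, by ring⟩) h42
      rw [ha]
      convert this using 1; ring
    refine main k (1 + 2 ^ (e - 2)) 0 (by rw [c3]; push_cast; ring) ?_ a (-1) ha4 ?_ ?_
    · have h5 : (2 : ZMod (2 ^ (e - 1))) ^ (e - 2) = 4 * 2 ^ (e - 4) := by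
        rw [show (4 : ZMod (2 ^ (e - 1))) = 2 ^ 2 by norm_num, ← pow_add]; congr 1; omega
      rw [c3, hi, hk, h5]
      push_cast
      linear_combination 2 * i * Units.inv_mul v - 2 * i * (↑v⁻¹ : ZMod (2 ^ (e - 1))) * hv
    · rw [zpow_add, zpow_one, hX a ha4]
      refine AffineMapUnit.ext_val ?_ ?_ <;>
      simp only [AffineMapUnit.mul_tr, AffineMapUnit.mul_lin, Units.val_mul,
          Units.val_one, Units.val_neg, ha]
      · linear_combination htwo - hsq
      · ring
    · refine AffineMapUnit.ext_val ?_ ?_ <;>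
      simp [AffineMapUnit.mul_tr, AffineMapUnit.mul_lin, AffineMapUnit.one_tr,
          AffineMapUnit.one_lin]
  · have c3 := (sq_eq_one_of_four_dvd_add he1 h4 huu).resolve_left c2
    rw [show e - 1 - 1 = e - 2 by omega] at c3
    have hj2 : 2 * (j : ZMod (2 ^ (e - 1))) = 0 := by
      have hun : IsUnit (-1 + 2 * 2 ^ (e - 4) : ZMod (2 ^ (e - 1))) :=
        isUnit_add_of_two_dvd isUnit_one.neg ⟨_, rfl⟩
      have h5 : (2 : ZMod (2 ^ (e - 1))) ^ (e - 2) = 4 * 2 ^ (e - 4) := by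
        rw [show (4 : ZMod (2 ^ (e - 1))) = 2 ^ 2 by norm_num, ← pow_add]; congr 1; omega
      rw [← hun.mul_left_eq_zero]
      rw [c3, h5] at hju
      linear_combination hju
    -- Now 1 + u = 2^(e-2), and j is 0 or 2^(e-2), so k = 0 or k = 1 makes the new generator an
    -- involution.
    obtain ⟨k, hk⟩ : ∃ k : ℤ, ((0 : ℤ) : ZMod (2 ^ (e - 1))) = j + k * (1 + u) := by
      rcases eq_zero_or_of_two_mul he1 hj2 with h0 | h0
      · exact ⟨0, by rw [h0]; simp⟩
      · rw [show e - 1 - 1 = e - 2 by omega] at h0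
        exact ⟨1, by rw [h0, c3]; push_cast; linear_combination -htwo1⟩
    have ha2 : (1 + 2 ^ (e - 1) : ZMod (2 ^ e)) * (1 + 2 ^ (e - 1)) = 1 := by
      linear_combination hsq + htwo
    obtain ⟨a, ha⟩ : IsUnit ((1 + 2 ^ (e - 1)) : ZMod (2 ^ e)) := IsUnit.of_mul_eq_one _ ha2
    have ha4 : 4 ∣ (a : ZMod (2 ^ e)) - 1 := by rw [ha, add_sub_cancel_left]; exact h42
    have hainv : a⁻¹ = a := inv_eq_of_mul_eq_one_left (Units.ext (by rw [Units.val_mul, ha]; exact ha2))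
    refine main k (2 ^ (e - 2) - 1) 0 (by rw [c3]; push_cast; ring) hk a (-1) ha4 ?_ ?_
    · rw [zpow_sub_one, hX a ha4]
      refine AffineMapUnit.ext_val ?_ ?_ <;>
      simp only [AffineMapUnit.mul_tr, AffineMapUnit.mul_lin, Units.val_mul,
          Units.val_one, Units.val_neg, AffineMapUnit.inv_tr, AffineMapUnit.inv_lin, hainv, ha]
      · ring
      · ring
    · refine AffineMapUnit.ext_val ?_ ?_ <;>
      simp [AffineMapUnit.mul_tr, AffineMapUnit.mul_lin, AffineMapUnit.one_tr,
          AffineMapUnit.one_lin]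

/-- A normal subgroup of index `2 ^ e` meeting the translations in a group of order two is an
affine stabilizer when the group contains an element of order `2 ^ e`. -/
theorem Faithful.isAffineStabilizer_of_normal {G : Type*} [Group G] {A : AffineAction e G}
    (hA : A.Faithful) (he : 2 ≤ e) {H : Subgroup G} (hidx : H.index = 2 ^ e) [H.Normal]
    (hc : Nat.card (H ⊓ A.lin.ker : Subgroup G) = 2) {g : G} (hg : orderOf g = 2 ^ e) :
    IsAffineStabilizer e H := by
  have hK := hA.inf_ker_eq (by omega) hc
  have hne : g ^ 2 ^ (e - 1) ≠ 1 := by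
    intro h
    have h1 := orderOf_dvd_of_pow_eq_one h
    rw [hg, Nat.pow_dvd_pow_iff_le_right (by norm_num)] at h1
    omega
  have hsq : g ^ 2 ^ (e - 2) * g ^ 2 ^ (e - 2) = g ^ 2 ^ (e - 1) := by
    rw [← pow_add, ← two_mul, ← pow_succ']; congr 2; omega
  have hl4 : 4 ∣ A.lin g - 1 := by
    refine (four_dvd_or (A.isUnit_lin g)).resolve_right fun h => hne ?_
    refine hA _ (A.tr_pow_two_pow_pred_self he h) ?_
    obtain ⟨k, hk⟩ := h
    have h2 : 4 ∣ A.lin g ^ 2 - 1 := ⟨k * (A.lin g - 1), by linear_combination (A.lin g - 1) * hk⟩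
    have h3 := pow_two_pow_sub_one (r := 2) (by norm_num) (by norm_num; exact h2) (e - 2)
    rw [two_pow_eq_zero (show e ≤ 2 + (e - 2) by omega), zero_dvd_iff, sub_eq_zero] at h3
    rw [← hsq, ← pow_add, ← two_mul, pow_mul, map_pow, map_pow]
    exact h3
  have hl : A.lin (g ^ 2 ^ (e - 2)) = 1 := by
    have h3 := pow_two_pow_sub_one (r := 2) (by norm_num) (by norm_num; exact hl4) (e - 2)
    rw [two_pow_eq_zero (show e ≤ 2 + (e - 2) by omega), zero_dvd_iff, sub_eq_zero] at h3
    rw [map_pow, h3]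
  -- The translation g^(2^(e-2)) has order 4, so it is not in H ∩ N, while its square is.
  have hx : orderOf (g : G ⧸ H) = 2 ^ (e - 1) := by
    rw [show e - 1 = e - 2 + 1 by omega]
    refine orderOf_eq_prime_pow ?_ ?_
    · rw [← QuotientGroup.mk_pow, QuotientGroup.eq_one_iff]
      intro h
      have h1 : g ^ 2 ^ (e - 2) ∈ A.torsion 2 := hK ▸ ⟨h, hl⟩
      refine hne (hsq ▸ hA _ ?_ ?_)
      · rw [tr_mul, hl]
        linear_combination h1.2
      · rw [map_mul, hl, one_mul]
    · rw [← QuotientGroup.mk_pow, QuotientGroup.eq_one_iff, show e - 2 + 1 = e - 1 by omega]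
      have h1 : g ^ 2 ^ (e - 1) ∈ A.torsion 2 := by
        have hl1 : A.lin (g ^ 2 ^ (e - 1)) = 1 := by rw [← hsq, map_mul, hl, one_mul]
        refine ⟨hl1, ?_⟩
        have h2 := A.tr_pow_of_lin_eq_one hl1 2
        rw [← pow_mul, ← pow_succ, show e - 1 + 1 = e by omega, tr_pow_two_pow_self] at h2
        exact_mod_cast h2.symm
      rw [← hK] at h1
      exact h1.1
  obtain ⟨B, hB⟩ := isAffineStabilizer_bot he (Q := G ⧸ H) hidx hx
  refine ⟨B.comap (QuotientGroup.mk' H), ?_⟩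
  ext z
  have h1 : z ∈ (B.comap (QuotientGroup.mk' H)).stab ↔ (z : G ⧸ H) ∈ B.stab := Iff.rfl
  rw [h1, hB, Subgroup.mem_bot, QuotientGroup.eq_one_iff]

end AffineAction

/-! ### Twisted subgroups. -/

namespace ZModTwoPow

variable {e : ℕ}

theorem exists_two_pow_mul_of_dvd {x : ZMod (2 ^ e)} {j : ℕ} (hj : j ≤ e) (hx : 2 ^ j ∣ x) :
    ∃ k, j ≤ k ∧ k ≤ e ∧ ∃ u : ZMod (2 ^ e), IsUnit u ∧ x = 2 ^ k * u := by
  obtain ⟨y, rfl⟩ := hx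
  obtain ⟨k, hk, u, hu, rfl⟩ := exists_two_pow_mul y
  rcases le_or_gt (j + k) e with h | h
  · exact ⟨j + k, by omega, h, u, hu, by ring⟩
  · refine ⟨e, hj, le_rfl, 1, isUnit_one, ?_⟩
    rw [← mul_assoc, ← pow_add, two_pow_eq_zero h.le, two_pow_self]; ring

theorem exists_one_sub_eq {a : ZMod (2 ^ e)} (h : 4 ∣ a + 1) : ∃ v : (ZMod (2 ^ e))ˣ, 1 - a = 2 * v := by
  obtain ⟨k, hk⟩ := h
  obtain ⟨v, hv⟩ : IsUnit (1 + 2 * -k) := isUnit_add_of_two_dvd isUnit_one ⟨-k, rfl⟩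
  exact ⟨v, by rw [hv]; linear_combination -hk⟩

end ZModTwoPow

namespace ZModTwoPow

variable {e : ℕ}

section

variable {P s z a b b' c q : ZMod (2 ^ e)} (hP4 : 4 * P = 0) (hPP : 2 * (P * P) = 0)
include hP4 hPP

/-- This and the next three lemmas are the sign cases of the cocycle identity in
`isAffineStabilizer_of_no_translation`. There b and b' are translation parts, `a` is a linear part,
P = 2^(e-2), 2z is the translation part of the reflection, and the constants 0 and 1 record the sign
of the linear part. -/
theorem twisted_pos_pos
    (ha : a = 1 + 4 * s * (b + 2 * c)) :
    (b + a * b') - 0 * (2 * z) + P * ((b + a * b') * ((b + a * b') - 1) + 0 * (2 * z)) + 2 * P * ((b + a * b') * 0) =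
      b - 0 * (2 * z) + P * (b * (b - 1) + 0 * (2 * z)) + 2 * P * (b * 0) +
      a * (1 + 2 * P * b) * (b' - 0 * (2 * z) + P * (b' * (b' - 1) + 0 * (2 * z)) + 2 * P * (b' * 0)) := by
  rw [ha]
  linear_combination (((1 + 4 * s * (b + 2 * c))) * b' ^ 2 * s * (b + 2 * c)) * hP4
    - ((1 + 4 * s * (b + 2 * c))) * b * b' * (b' - 1) * hPP

theorem twisted_pos_neg (hsz : 4 * s * (2 * z) = 2 * P)
    (ha : a = 1 + 4 * s * (b + 2 * c)) :
    (b + a * b') - 1 * (2 * z) + P * ((b + a * b') * ((b + a * b') - 1) + 1 * (2 * z)) + 2 * P * ((b + a * b') * 1) =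
      b - 0 * (2 * z) + P * (b * (b - 1) + 0 * (2 * z)) + 2 * P * (b * 0) +
      a * (1 + 2 * P * b) * (b' - 1 * (2 * z) + P * (b' * (b' - 1) + 1 * (2 * z)) + 2 * P * (b' * 1)) := by
  rw [ha]
  linear_combination (b + 2 * c) * hsz + (b + c + ((1 + 4 * s * (b + 2 * c))) * b' ^ 2 * s * (b + 2 * c)
    - 2 * z * s * (b + 2 * c) + ((1 + 4 * s * (b + 2 * c))) * b * z
    - ((1 + 4 * s * (b + 2 * c))) * b * b' * P) * hP4
    - ((1 + 4 * s * (b + 2 * c))) * b * (b' * (b' - 1) + 2 * z) * hPP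

theorem twisted_neg_pos (hq : b' * (b' - 1) = 2 * q)
    (ha : a = -(1 + 4 * s * (b + 2 * c))) :
    (b + a * b') - 1 * (2 * z) + P * ((b + a * b') * ((b + a * b') - 1) + 1 * (2 * z)) + 2 * P * ((b + a * b') * 1) =
      b - 1 * (2 * z) + P * (b * (b - 1) + 1 * (2 * z)) + 2 * P * (b * 1) +
      a * (1 + 2 * P * b) * (b' - 0 * (2 * z) + P * (b' * (b' - 1) + 0 * (2 * z)) + 2 * P * (b' * 0)) := by
  rw [ha]
  linear_combination -2 * P * (-(1 + 4 * s * (b + 2 * c))) * hq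
    + (-(-(1 + 4 * s * (b + 2 * c))) * q - (-(1 + 4 * s * (b + 2 * c))) * s * (b + 2 * c) * b' ^ 2) * hP4
    - (-(1 + 4 * s * (b + 2 * c))) * b * b' * (b' - 1) * hPP

theorem twisted_neg_neg (hsz : 4 * s * (2 * z) = 2 * P) (hq : b' * (b' - 1) = 2 * q)
    (ha : a = -(1 + 4 * s * (b + 2 * c))) :
    (b + a * b') - 0 * (2 * z) + P * ((b + a * b') * ((b + a * b') - 1) + 0 * (2 * z)) + 2 * P * ((b + a * b') * 0) =
      b - 1 * (2 * z) + P * (b * (b - 1) + 1 * (2 * z)) + 2 * P * (b * 1) +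
      a * (1 + 2 * P * b) * (b' - 1 * (2 * z) + P * (b' * (b' - 1) + 1 * (2 * z)) + 2 * P * (b' * 1)) := by
  rw [ha]
  linear_combination -(b + 2 * c) * hsz - 2 * P * (-(1 + 4 * s * (b + 2 * c))) * hq
    + (-(b + c) + 2 * z * s * (b + 2 * c)
    - (-(1 + 4 * s * (b + 2 * c))) * s * (b + 2 * c) * b' ^ 2 - (-(1 + 4 * s * (b + 2 * c))) * (q + b')
    + (-(1 + 4 * s * (b + 2 * c))) * b * z - (-(1 + 4 * s * (b + 2 * c))) * b * b' * P) * hP4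
    - (-(1 + 4 * s * (b + 2 * c))) * b * (b' * (b' - 1) + 2 * z) * hPP

end

end ZModTwoPow

namespace AffineAction

open scoped commutatorElement

variable {e : ℕ} {G : Type*} [Group G] {A : AffineAction e G} {H : Subgroup G}

theorem isAffineStabilizer_of_fixed (hs : Function.Surjective A.tr) (hidx : H.index = 2 ^ e)
    (x : ZMod (2 ^ e)) (hx : ∀ h ∈ H, A.tr h = (1 - A.lin h) * x) : IsAffineStabilizer e H :=
  ⟨A.shift x, (A.shift x).stab_eq_of_le hidx (A.shift_surjective hs x) fun h hh => by
    rw [mem_stab, shift_tr, hx h hh, sub_self]⟩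

/-- If the linear parts of coset representatives depend only on the parity of the translation
part, these representatives meet every coset of `H`. -/
theorem exists_inv_mul_mem (hidx : H.index = 2 ^ e) (hinf : ∀ h ∈ H, A.lin h = 1 → h = 1)
    (heven : ∀ h ∈ H, 2 ∣ A.tr h) (sec : ZMod (2 ^ e) → G) (hsec : ∀ r, A.tr (sec r) = r)
    (hlin : ∀ r r', 2 ∣ r' - r → A.lin (sec r) = A.lin (sec r')) (g : G) :
    ∃ r, (sec r)⁻¹ * g ∈ H := by
  -- Two representatives in the same coset have translation parts of equal parity, hence equal
  -- linear parts; the quotient is then an element of `H` with linear part 1.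
  have hinj : Function.Injective fun r => (sec r : G ⧸ H) := by
    intro r r' h
    have hm := QuotientGroup.eq.1 h
    have h1 := heven _ hm
    rw [tr_mul, tr_inv, hsec, hsec, show -(A.lin (sec r)⁻¹ * r) + A.lin (sec r)⁻¹ * r' =
      A.lin (sec r)⁻¹ * (r' - r) by ring, (A.isUnit_lin _).dvd_mul_left] at h1
    have h2 := hinf _ hm (by rw [map_mul, ← hlin r r' h1, lin_inv_mul])
    rw [inv_mul_eq_one] at h2
    rw [← hsec r, h2, hsec]
  have hc : Nat.card (G ⧸ H) = 2 ^ e := hidx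
  have : Finite (G ⧸ H) := Nat.finite_of_card_ne_zero (by rw [hc]; positivity)
  have hb := (Nat.bijective_iff_injective_and_card _).2 ⟨hinj, by rw [Nat.card_zmod, hc]⟩
  obtain ⟨r, hr⟩ := hb.2 (g : G ⧸ H)
  exact ⟨r, QuotientGroup.eq.1 hr⟩

/-- The subgroup generated by `x ↦ (1 + 2 ^ r * u) * x` and `x ↦ -x + 2 ^ (e - r) * y`, with `u`
and `y` units. -/
structure IsTwisted (A : AffineAction e G) (H : Subgroup G) (r : ℕ) (h k : G) : Prop where
  two_le : 2 ≤ r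
  lt : r < e
  mem_left : h ∈ H
  mem_right : k ∈ H
  tr_right : A.tr k = 0
  lin_right : ∃ u, IsUnit u ∧ A.lin k = 1 + 2 ^ r * u
  lin_left : A.lin h = -1
  tr_left : ∃ y, IsUnit y ∧ A.tr h = 2 ^ (e - r) * y
  gen : ∀ g ∈ H, ∃ m : ℕ, g = k ^ m ∨ g = h * k ^ m

variable {r : ℕ} {h k : G}

namespace IsTwisted

variable (T : A.IsTwisted H r h k)
include T

theorem two_dvd_tr_left : 2 ∣ A.tr h := by
  obtain ⟨y, -, hy⟩ := T.tr_left
  have := T.lt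
  rw [hy]
  exact (dvd_pow_self 2 (by omega)).mul_right y

theorem tr_pow_right (m : ℕ) : A.tr (k ^ m) = 0 := A.stab.pow_mem T.tr_right m

theorem dvd_lin_pow_right (m : ℕ) : 2 ^ r ∣ A.lin (k ^ m) - 1 := by
  obtain ⟨u, -, hu⟩ := T.lin_right
  rw [map_pow]
  refine Dvd.dvd.trans ⟨u, ?_⟩ (sub_one_dvd_pow_sub_one _ m)
  rw [hu]; ring

theorem dvd_lin {g : G} (hg : g ∈ H) : 2 ^ r ∣ A.lin g - 1 ∨ 2 ^ r ∣ -A.lin g - 1 := by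
  obtain ⟨m, rfl | rfl⟩ := T.gen g hg
  · exact Or.inl (T.dvd_lin_pow_right m)
  · right
    rw [map_mul, T.lin_left, neg_one_mul, neg_neg]
    exact T.dvd_lin_pow_right m

theorem two_dvd_tr {g : G} (hg : g ∈ H) : 2 ∣ A.tr g := by
  obtain ⟨m, rfl | rfl⟩ := T.gen g hg
  · rw [T.tr_pow_right]; exact dvd_zero 2
  · rw [tr_mul, T.tr_pow_right, mul_zero, add_zero]; exact T.two_dvd_tr_left

theorem inf_trivial (hA : A.Faithful) {g : G} (hg : g ∈ H) (hl : A.lin g = 1) : g = 1 := by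
  obtain ⟨m, rfl | rfl⟩ := T.gen g hg
  · exact hA _ (T.tr_pow_right m) hl
  · exfalso
    have hr := T.lt
    have h2 := T.two_le
    have h1 := T.dvd_lin_pow_right m
    rw [map_mul, T.lin_left] at hl
    rw [show A.lin (k ^ m) = -1 by linear_combination -hl] at h1
    apply not_four_dvd_two (e := e) (by omega)
    rw [← dvd_neg]
    have h4 := (pow_dvd_pow (2 : ZMod (2 ^ e)) h2).trans h1
    convert h4 using 1 <;> norm_num

theorem le_stab {B : AffineAction e G} (h1 : B.tr h = 0) (h2 : B.tr k = 0) : H ≤ B.stab := by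
  intro g hg
  have hk := fun m => B.stab.pow_mem (show k ∈ B.stab from h2) m
  obtain ⟨m, rfl | rfl⟩ := T.gen g hg
  · exact hk m
  · exact B.stab.mul_mem h1 (hk m)

theorem exists_pow_lin_eq {x : ZMod (2 ^ e)} (hx : 2 ^ r ∣ x - 1) : ∃ m : ℕ, A.lin (k ^ m) = x := by
  obtain ⟨u, hu, hk⟩ := T.lin_right
  obtain ⟨m, hm⟩ := exists_pow_eq T.two_le hu hk hx
  exact ⟨m, by rw [map_pow, hm]⟩

theorem four_dvd : (4 : ZMod (2 ^ e)) ∣ 2 ^ r := by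
  rw [show (4 : ZMod (2 ^ e)) = 2 ^ 2 by norm_num]
  exact pow_dvd_pow 2 T.two_le

/-- The commutator of `k` with an element taking 0 to 1 is the translation by 2^r times a unit; a
power of it does the job. -/
theorem exists_involution_translation (hs : Function.Surjective A.tr) :
    ∃ n, A.lin n = 1 ∧ A.tr n = 2 ^ (e - 1) := by
  obtain ⟨u, hu, hk⟩ := T.lin_right
  obtain ⟨p, hp⟩ := hs 1
  have hlt := T.lt
  refine ⟨⁅k, p⁆ ^ 2 ^ (e - 1 - r), by rw [map_pow, lin_commutator, one_pow], ?_⟩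
  rw [A.tr_pow_of_lin_eq_one (A.lin_commutator k p), tr_commutator, T.tr_right, hp, hk,
    ← two_pow_mul_self_eq (by omega) hu]
  rw [show e - 1 = e - 1 - r + r by omega, pow_add]
  simp only [Nat.add_sub_cancel]
  push_cast
  ring

/-- The case in which `G` contains all translations. -/
theorem isAffineStabilizer_of_translation (hA : A.Faithful) (hs : Function.Surjective A.tr)
    (hidx : H.index = 2 ^ e) {n : G} (hn : A.lin n = 1) (hnu : IsUnit (A.tr n)) :
    IsAffineStabilizer e H := by
  have hlt := T.lt
  have h2r := T.two_le
  have htwo : 2 * (2 : ZMod (2 ^ e)) ^ (e - 1) = 0 := two_mul_two_pow_pred (by omega)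
  have hsq : (2 : ZMod (2 ^ e)) ^ (e - 1) * 2 ^ (e - 1) = 0 := sq_eq_zero_of_two_mul (by omega) htwo
  have hsec : ∀ x, ∃ m : ℕ, A.tr (n ^ m) = x := A.exists_pow_tr_eq (by rw [hn]; simp) hnu
  choose sec hsec using hsec
  -- The translations represent all cosets of `H`, so linear parts of `G` are linear parts of `H`.
  have hlin : ∀ g, 2 ^ r ∣ A.lin g - 1 ∨ 2 ^ r ∣ -A.lin g - 1 := by
    intro g
    obtain ⟨x, hx⟩ := exists_inv_mul_mem hidx (fun g hg => T.inf_trivial hA hg)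
      (fun g hg => T.two_dvd_tr hg) (fun x => n ^ sec x) hsec
      (fun _ _ _ => by simp [hn]) g
    have h1 := T.dvd_lin hx
    have h2 : A.lin (n ^ sec x)⁻¹ = 1 := by
      have := A.lin_inv_mul (n ^ sec x)
      rwa [map_pow, hn, one_pow, mul_one] at this
    rwa [map_mul, h2, one_mul] at h1
  classical
  -- A crossed homomorphism on the units ±(1 + 2^r w), sending each to 2^(e-1) w.
  let l : ZMod (2 ^ e) → ZMod (2 ^ e) := fun a =>
    if 4 ∣ a - 1 then 2 ^ (e - 1 - r) * (a - 1) else 2 ^ (e - 1 - r) * (-a - 1)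
  have hP : (2 : ZMod (2 ^ e)) ^ (e - 1) = 2 ^ (e - 1 - r) * 2 ^ r := by
    rw [← pow_add]; congr 1; omega
  have hneg : ∀ w : ZMod (2 ^ e), ¬ 4 ∣ -(1 + 2 ^ r * w) - 1 := by
    intro w hw
    have h3 := dvd_add hw (T.four_dvd.mul_right w)
    apply not_four_dvd_two (e := e) (by omega)
    rw [← dvd_neg]
    convert h3 using 1; ring
  have hlpos : ∀ w, l (1 + 2 ^ r * w) = 2 ^ (e - 1) * w := by
    intro w
    have : 4 ∣ (1 + 2 ^ r * w) - 1 := by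
      rw [add_sub_cancel_left]; exact T.four_dvd.mul_right w
    simp only [l, if_pos this, hP]
    ring
  have hlneg : ∀ w, l (-(1 + 2 ^ r * w)) = 2 ^ (e - 1) * w := by
    intro w
    simp only [l, if_neg (hneg w), hP]
    ring
  have hform : ∀ g, ∃ w, A.lin g = 1 + 2 ^ r * w ∨ A.lin g = -(1 + 2 ^ r * w) := by
    intro g
    rcases hlin g with ⟨w, hw⟩ | ⟨w, hw⟩
    · exact ⟨w, Or.inl (by linear_combination hw)⟩
    · exact ⟨w, Or.inr (by linear_combination -hw)⟩
  have hPr : (2 : ZMod (2 ^ e)) ^ (e - 1) * 2 ^ r = 0 := by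
    obtain ⟨q, hq⟩ := T.four_dvd
    rw [hq]; linear_combination 2 * q * htwo
  obtain ⟨y, hy, hty⟩ := T.tr_left
  obtain ⟨u, hu, hku⟩ := T.lin_right
  -- A fixed point of `h`. Moving the origin there gives `k` the translation part 2^(e-1), which
  -- adding `l` cancels without disturbing `h`.
  let x : ZMod (2 ^ e) := 2 ^ (e - r - 1) * y
  have hx2 : 2 * x = A.tr h := by
    rw [hty, show e - r = e - r - 1 + 1 by omega, pow_succ]
    simp only [x]; ring
  have hxr : 2 ^ r * x = 2 ^ (e - 1) := by
    simp only [x]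
    rw [← mul_assoc, ← pow_add, show r + (e - r - 1) = e - 1 by omega,
      two_pow_mul_self_eq (by omega) hy]
  let B : AffineAction e G :=
    { lin := A.lin
      tr := fun g => A.tr g - (1 - A.lin g) * x + l (A.lin g)
      tr_mul := by
        intro g g'
        have key : l (A.lin g * A.lin g') = l (A.lin g) + A.lin g * l (A.lin g') := by
          obtain ⟨w, hw | hw⟩ := hform g <;> obtain ⟨w', hw' | hw'⟩ := hform g' <;> rw [hw, hw']
          · rw [show (1 + 2 ^ r * w) * (1 + 2 ^ r * w') = 1 + 2 ^ r * (w + w' + 2 ^ r * w * w')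
              by ring, hlpos, hlpos, hlpos]
            linear_combination (w * w' - w * w') * hPr
          · rw [show (1 + 2 ^ r * w) * -(1 + 2 ^ r * w') = -(1 + 2 ^ r * (w + w' + 2 ^ r * w * w'))
              by ring, hlneg, hlpos, hlneg]
            linear_combination (w * w' - w * w') * hPr
          · rw [show -(1 + 2 ^ r * w) * (1 + 2 ^ r * w') = -(1 + 2 ^ r * (w + w' + 2 ^ r * w * w'))
              by ring, hlneg, hlneg, hlpos]
            linear_combination 2 * w * w' * hPr + w' * htwo
          · rw [show -(1 + 2 ^ r * w) * -(1 + 2 ^ r * w') = 1 + 2 ^ r * (w + w' + 2 ^ r * w * w')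
              by ring, hlpos, hlneg, hlneg]
            linear_combination 2 * w * w' * hPr + w' * htwo
        rw [tr_mul, map_mul, key]
        ring }
  have hBtr : ∀ g, B.tr g = A.tr g - (1 - A.lin g) * x + l (A.lin g) := fun _ => rfl
  refine ⟨B, B.stab_eq_of_le hidx ?_ (T.le_stab ?_ ?_)⟩
  -- Adding `l` changes a translation part by 0 or 2^(e-1), and the translation by 2^(e-1) undoes
  -- this.
  · obtain ⟨n', hn1, hn2⟩ := T.exists_involution_translation hs
    intro z
    obtain ⟨g, hg⟩ := A.shift_surjective hs x z
    rw [shift_tr] at hg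
    have hval : l (A.lin g) = 0 ∨ l (A.lin g) = 2 ^ (e - 1) := by
      apply two_pow_pred_dvd (by omega)
      obtain ⟨w, hw | hw⟩ := hform g
      · exact ⟨w, by rw [hw, hlpos]⟩
      · exact ⟨w, by rw [hw, hlneg]⟩
    rcases hval with h0 | h0
    · exact ⟨g, by rw [hBtr, hg, h0, add_zero]⟩
    · refine ⟨n' * g, ?_⟩
      rw [hBtr, tr_mul, map_mul, hn1, hn2, one_mul, one_mul, h0]
      linear_combination hg + htwo
  · have h0 : l (-1) = 0 := by
      have := hlneg 0
      rwa [mul_zero, mul_zero, add_zero] at this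
    rw [hBtr, T.lin_left, h0]
    linear_combination -hx2
  · rw [hBtr, hku, hlpos, T.tr_right]
    linear_combination u * hxr + u * htwo

/-- The structure of `G` if it does not contain all translations. -/
theorem exists_form_of_no_translation (hA : A.Faithful) (hs : Function.Surjective A.tr)
    (hidx : H.index = 2 ^ e) (hno : ∀ n, A.lin n = 1 → ¬ IsUnit (A.tr n)) :
    ∃ p n, IsUnit (A.tr p) ∧ 4 ∣ A.lin p - 1 ∧ A.lin n = 1 ∧
      (∃ v : (ZMod (2 ^ e))ˣ, A.tr n = 2 * v) ∧ 3 ≤ r ∧ ∃ s, (2 : ZMod (2 ^ e)) ^ (r - 1) = 4 * s ∧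
      ∀ g, ∃ c, A.lin g = 1 + 4 * s * (A.tr g + 2 * c) ∨
        A.lin g = -(1 + 4 * s * (A.tr g + 2 * c)) := by
  have hlt := T.lt
  have h2r := T.two_le
  have hth := T.two_dvd_tr_left
  /- An element of odd translation part and linear part `≡ 1` modulo `4`. -/
  obtain ⟨p, hpu, hp4⟩ : ∃ p, IsUnit (A.tr p) ∧ 4 ∣ A.lin p - 1 := by
    obtain ⟨p, hp⟩ := hs 1
    rcases four_dvd_or (A.isUnit_lin p) with h4 | h4
    · exact ⟨p, hp ▸ isUnit_one, h4⟩
    · refine ⟨p * h, A.isUnit_tr_mul (hp ▸ isUnit_one) hth, A.four_dvd_lin_mul' h4 ?_⟩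
      rw [T.lin_left, neg_add_cancel]; exact dvd_zero 4
  /- The group contains all even translations. -/
  obtain ⟨n, hn, v, hv⟩ : ∃ n, A.lin n = 1 ∧ ∃ v : (ZMod (2 ^ e))ˣ, A.tr n = 2 * v := by
    obtain ⟨t, ht⟩ := hp4
    obtain ⟨v, hv⟩ := isUnit_add_of_two_dvd hpu (⟨t * A.tr h, rfl⟩ : 2 ∣ 2 * (t * A.tr h))
    refine ⟨⁅p, h⁆, A.lin_commutator p h, v, ?_⟩
    rw [tr_commutator, T.lin_left, hv]
    linear_combination A.tr h * ht
  have hpown : ∀ m : ℕ, A.lin (n ^ m) = 1 := fun m => by rw [map_pow, hn, one_pow]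
  have heven : ∀ z, 2 ∣ z → ∃ m : ℕ, A.tr (n ^ m) = z := by
    rintro z ⟨q, rfl⟩
    obtain ⟨m, hm⟩ := ZMod.natCast_zmod_surjective ((↑v⁻¹ : ZMod (2 ^ e)) * q)
    refine ⟨m, ?_⟩
    rw [A.tr_pow_of_lin_eq_one hn, hm, hv]
    linear_combination 2 * q * Units.mul_inv v
  -- Representatives are even translations, or even translations times `p`, so their linear part
  -- depends only on parity.
  have hsec : ∀ z, ∃ g, A.tr g = z ∧
      ((2 ∣ z ∧ A.lin g = 1) ∨ (IsUnit z ∧ A.lin g = A.lin p)) := by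
    intro z
    rcases two_dvd_or_isUnit z with hz | hz
    · obtain ⟨m, hm⟩ := heven z hz
      exact ⟨n ^ m, hm, Or.inl ⟨hz, hpown m⟩⟩
    · obtain ⟨m, hm⟩ := heven (z - A.tr p)
        (by rw [sub_eq_add_neg]; exact two_dvd_add_of_isUnit hz hpu.neg)
      refine ⟨n ^ m * p, ?_, Or.inr ⟨hz, by rw [map_mul, hpown, one_mul]⟩⟩
      rw [A.tr_mul_of_lin_eq_one (hpown m), hm, sub_add_cancel]
  choose sec hsec1 hsec2 using hsec
  have hcov : ∀ g, ∃ w ∈ H, A.lin g = A.lin (sec (A.tr g)) * A.lin w := by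
    intro g
    have hpar : ∀ z z', 2 ∣ z' - z → A.lin (sec z) = A.lin (sec z') := by
      intro z z' hzz
      rcases hsec2 z with ⟨h1, h2⟩ | ⟨h1, h2⟩ <;> rcases hsec2 z' with ⟨h3, h4⟩ | ⟨h3, h4⟩
      · rw [h2, h4]
      · exfalso
        exact not_two_dvd_of_isUnit (by omega) h3 ((dvd_sub_left h1).1 hzz)
      · exfalso
        exact not_two_dvd_of_isUnit (by omega) h1 ((dvd_sub_right h3).1 hzz)
      · rw [h2, h4]
    obtain ⟨z, hz⟩ := exists_inv_mul_mem hidx (fun g hg => T.inf_trivial hA hg)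
      (fun g hg => T.two_dvd_tr hg) sec hsec1 hpar g
    refine ⟨_, hz, ?_⟩
    have h1 : A.tr g = z + A.lin (sec z) * A.tr ((sec z)⁻¹ * g) := by
      have h2 := A.tr_mul (sec z) ((sec z)⁻¹ * g)
      rwa [mul_inv_cancel_left, hsec1] at h2
    rw [hpar (A.tr g) z, ← map_mul, mul_inv_cancel_left]
    rw [h1, sub_add_cancel_left]
    exact ((T.two_dvd_tr hz).mul_left _).neg_right
  -- The square of `p` has even translation part, so its linear part comes from `H` and is ≡ 1 mod
  -- 2^r. Cancelling `A.lin p` + 1, twice a unit, loses one factor of two.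
  have hp1 : 2 ^ (r - 1) ∣ A.lin p - 1 := by
    obtain ⟨w, hw, hpw⟩ := hcov (p * p)
    rcases hsec2 (A.tr (p * p)) with ⟨-, h2⟩ | ⟨h1, -⟩
    · rw [h2, one_mul] at hpw
      have h3 : 2 ^ r ∣ A.lin (p * p) - 1 := by
        rw [hpw]
        refine (T.dvd_lin hw).resolve_right fun h4 => ?_
        refine not_four_dvd_both (e := e) (by omega) (A.four_dvd_lin_mul hp4 hp4) ?_
        rw [hpw, ← dvd_neg, neg_add']
        exact T.four_dvd.trans h4
      obtain ⟨t, ht⟩ := hp4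
      have hun : IsUnit (1 + 2 * t) := isUnit_add_of_two_dvd isUnit_one ⟨t, rfl⟩
      refine dvd_of_two_pow_mul_dvd (j := 1) (by omega) ?_
      rw [show 1 + (r - 1) = r by omega, pow_one, ← hun.dvd_mul_left]
      rw [map_mul] at h3
      convert h3 using 1
      linear_combination -(A.lin p - 1) * ht
    · exact absurd (A.two_dvd_tr_mul hpu hpu) (not_two_dvd_of_isUnit (by omega) h1)
  obtain ⟨w₀, hw₀⟩ := hp1
  have hr2 : (2 : ZMod (2 ^ e)) ^ r = 2 ^ (r - 1) * 2 := by
    rw [← pow_succ]; congr 1; omega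
  -- Otherwise a power of `k` would correct `p` to an odd translation.
  have hpn : ¬ 2 ^ r ∣ A.lin p - 1 := by
    intro hd
    obtain ⟨m, hm⟩ := T.exists_pow_lin_eq hd
    have h1 : A.lin (p * (k ^ m)⁻¹) = 1 := by
      rw [map_mul, ← hm, mul_comm, lin_inv_mul]
    refine hno _ h1 ?_
    rw [tr_mul, tr_inv, T.tr_pow_right, mul_zero, neg_zero, mul_zero, add_zero]
    exact hpu
  have hw₀u : IsUnit w₀ := by
    refine (two_dvd_or_isUnit w₀).resolve_left ?_
    rintro ⟨q, rfl⟩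
    exact hpn ⟨q, by rw [hw₀, hr2]; ring⟩
  have hr3 : 3 ≤ r := by
    by_contra hr3
    refine hpn ?_
    rw [show r = 2 by omega, show (2 : ZMod (2 ^ e)) ^ 2 = 4 by norm_num]
    exact hp4
  obtain ⟨s, hs4⟩ : (4 : ZMod (2 ^ e)) ∣ 2 ^ (r - 1) := by
    rw [show (4 : ZMod (2 ^ e)) = 2 ^ 2 by norm_num]
    exact pow_dvd_pow 2 (by omega)
  refine ⟨p, n, hpu, hp4, hn, ⟨v, hv⟩, hr3, s, hs4, ?_⟩
  intro g
  obtain ⟨w, hw, hgw⟩ := hcov g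
  have hbase : ∃ c, A.lin (sec (A.tr g)) = 1 + 4 * s * (A.tr g + 2 * c) := by
    rcases hsec2 (A.tr g) with ⟨⟨q, hq⟩, h2⟩ | ⟨h1, h2⟩
    · exact ⟨-q, by rw [h2, hq]; ring⟩
    · obtain ⟨c, hc⟩ := two_dvd_add_of_isUnit hw₀u h1.neg
      exact ⟨c, by rw [h2]; linear_combination hw₀ + w₀ * hs4 + 4 * s * hc⟩
  obtain ⟨c, hc⟩ := hbase
  rcases T.dvd_lin hw with ⟨q, hq⟩ | ⟨q, hq⟩ <;> rw [hr2, hs4] at hq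
  · refine ⟨c + (1 + 4 * s * (A.tr g + 2 * c)) * q, Or.inl ?_⟩
    rw [hgw, hc]
    linear_combination (1 + 4 * s * (A.tr g + 2 * c)) * hq
  · refine ⟨c + (1 + 4 * s * (A.tr g + 2 * c)) * q, Or.inr ?_⟩
    rw [hgw, hc]
    linear_combination -(1 + 4 * s * (A.tr g + 2 * c)) * hq

/-- The case in which `G` does not contain all translations. -/
theorem isAffineStabilizer_of_no_translation (hA : A.Faithful) (hs : Function.Surjective A.tr)
    (hidx : H.index = 2 ^ e) (hno : ∀ n, A.lin n = 1 → ¬ IsUnit (A.tr n)) :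
    IsAffineStabilizer e H := by
  have hlt := T.lt
  have hth := T.two_dvd_tr_left
  obtain ⟨p, n, hpu, hp4, hn, ⟨v, hv⟩, hr3, s, hs4, hform⟩ :=
    T.exists_form_of_no_translation hA hs hidx hno
  have hr2 : (2 : ZMod (2 ^ e)) ^ r = 2 ^ (r - 1) * 2 := by
    rw [← pow_succ]; congr 1; omega
  obtain ⟨y, hy, hty⟩ := T.tr_left
  obtain ⟨z, hz⟩ := hth
  obtain ⟨P, hP⟩ : ∃ P : ZMod (2 ^ e), P = 2 ^ (e - 2) := ⟨_, rfl⟩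
  have hP4 : 4 * P = 0 := by
    rw [hP, show (4 : ZMod (2 ^ e)) = 2 ^ 2 by norm_num, ← pow_add,
      two_pow_eq_zero (by omega)]
  have hPP : 2 * (P * P) = 0 := by
    rw [hP, ← pow_add, ← pow_succ', two_pow_eq_zero (by omega)]
  -- That is, 2^(r-1) times the translation part of `h` is 2^(e-1).
  have hsz : 4 * s * (2 * z) = 2 * P := by
    rw [← hz, hty, ← hs4, ← mul_assoc, ← pow_add, show r - 1 + (e - r) = e - 1 by omega,
      two_pow_mul_self_eq (by omega) hy, hP, ← pow_succ']
    congr 1; omega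
  obtain ⟨P', hP'⟩ : ∃ P', P = 2 * P' := by
    refine ⟨2 ^ (e - 3), ?_⟩
    rw [hP, ← pow_succ']; congr 1; omega
  classical
  let d : G → ZMod (2 ^ e) := fun g => if 4 ∣ A.lin g - 1 then 0 else 1
  have hd : ∀ g, ∃ c, (d g = 0 ∧ A.lin g = 1 + 4 * s * (A.tr g + 2 * c)) ∨
      (d g = 1 ∧ A.lin g = -(1 + 4 * s * (A.tr g + 2 * c))) := by
    intro g
    obtain ⟨c, hc | hc⟩ := hform g
    · refine ⟨c, Or.inl ⟨if_pos ⟨s * (A.tr g + 2 * c), ?_⟩, hc⟩⟩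
      rw [hc]; ring
    · refine ⟨c, Or.inr ⟨if_neg fun h4 => ?_, hc⟩⟩
      exact not_four_dvd_both (by omega) h4
        ⟨-(s * (A.tr g + 2 * c)), by rw [hc]; ring⟩
  have hdpos : ∀ g, 4 ∣ A.lin g - 1 → d g = 0 := fun g hg => if_pos hg
  have hdneg : ∀ g, 4 ∣ A.lin g + 1 → d g = 1 := fun g hg =>
    if_neg fun h4 => not_four_dvd_both (by omega) h4 hg
  have h4pos : ∀ {a t : ZMod (2 ^ e)}, a = 1 + 4 * s * t → 4 ∣ a - 1 := fun {a t} ha =>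
    ⟨s * t, by rw [ha]; ring⟩
  have h4neg : ∀ {a t : ZMod (2 ^ e)}, a = -(1 + 4 * s * t) → 4 ∣ a + 1 := fun {a t} ha =>
    ⟨-(s * t), by rw [ha]; ring⟩
  have hprod : ∀ b : ZMod (2 ^ e), ∃ q, b * (b - 1) = 2 * q := by
    intro b
    rcases two_dvd_or_isUnit b with h2 | h2
    · exact h2.mul_right _
    · refine Dvd.dvd.mul_left ?_ b
      rw [sub_eq_add_neg]; exact two_dvd_add_of_isUnit h2 isUnit_one.neg
  -- Subtracting 2z from elements of negative sign makes `h` fix 0 but breaks the cocycle identity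
  -- by 2^(e-1) times a translation part, by `hsz`. Twisting the linear part by 1 + 2^(e-1) `A.tr g`
  -- and adding terms quadratic in `A.tr g` and `d g` absorbs this error.
  let B : AffineAction e G :=
    { lin :=
        { toFun := fun g => A.lin g * (1 + 2 * P * A.tr g)
          map_one' := by rw [map_one, tr_one]; ring
          map_mul' := fun g g' => by
            obtain ⟨q, hq⟩ := unit_eq_add (A.isUnit_lin g)
            rw [map_mul, tr_mul, hq]
            linear_combination (1 + 2 * q) * A.lin g' * (q * A.tr g' - P * A.tr g * A.tr g') * hP4 }
      tr := fun g => A.tr g - d g * (2 * z) + P * (A.tr g * (A.tr g - 1) + d g * (2 * z))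
        + 2 * P * (A.tr g * d g)
      tr_mul := by
        intro g g'
        obtain ⟨c, ⟨hd1, hc⟩ | ⟨hd1, hc⟩⟩ := hd g <;>
        obtain ⟨c', ⟨hd2, hc'⟩ | ⟨hd2, hc'⟩⟩ := hd g' <;>
        obtain ⟨q, hq⟩ := hprod (A.tr g')
        · have hd3 := hdpos _ (A.four_dvd_lin_mul (h4pos hc) (h4pos hc'))
          simp only [hd1, hd2, hd3, tr_mul, MonoidHom.coe_mk, OneHom.coe_mk]
          exact twisted_pos_pos hP4 hPP hc
        · have hd3 := hdneg (g * g') (by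
            rw [map_mul, mul_comm, ← map_mul]
            exact A.four_dvd_lin_mul'' (h4neg hc') (h4pos hc))
          simp only [hd1, hd2, hd3, tr_mul, MonoidHom.coe_mk, OneHom.coe_mk]
          exact twisted_pos_neg hP4 hPP hsz hc
        · have hd3 := hdneg _ (A.four_dvd_lin_mul'' (h4neg hc) (h4pos hc'))
          simp only [hd1, hd2, hd3, tr_mul, MonoidHom.coe_mk, OneHom.coe_mk]
          exact twisted_neg_pos hP4 hPP hq hc
        · have hd3 := hdpos _ (A.four_dvd_lin_mul' (h4neg hc) (h4neg hc'))
          simp only [hd1, hd2, hd3, tr_mul, MonoidHom.coe_mk, OneHom.coe_mk]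
          exact twisted_neg_neg hP4 hPP hsz hq hc }
  have hBlin : ∀ g, B.lin g = A.lin g * (1 + 2 * P * A.tr g) := fun _ => rfl
  have hBtr : ∀ g, B.tr g = A.tr g - d g * (2 * z)
    + P * (A.tr g * (A.tr g - 1) + d g * (2 * z)) + 2 * P * (A.tr g * d g) := fun _ => rfl
  refine ⟨B, B.stab_eq_of_le hidx ?_ (T.le_stab ?_ ?_)⟩
  · have hBn : B.lin n = 1 := by
      rw [hBlin, hn, hv]; linear_combination (v : ZMod (2 ^ e)) * hP4
    obtain ⟨v', hv'⟩ : IsUnit ((v : ZMod (2 ^ e)) + 2 * (P' * v * (2 * v - 1))) :=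
      isUnit_add_of_two_dvd v.isUnit ⟨_, rfl⟩
    have hBnt : B.tr n = 2 * v' := by
      rw [hBtr, hdpos n (by rw [hn]; simp), hv, hv', hP']; ring
    have hBp : IsUnit (B.tr p) := by
      rw [hBtr, hdpos p hp4, hP', show A.tr p - 0 * (2 * z) + 2 * P' * (A.tr p * (A.tr p - 1) +
        0 * (2 * z)) + 2 * (2 * P') * (A.tr p * 0) = A.tr p + 2 * (P' * (A.tr p * (A.tr p - 1)))
        by ring]
      exact isUnit_add_of_two_dvd hpu ⟨_, rfl⟩
    have hBeven : ∀ x, 2 ∣ x → ∃ m : ℕ, B.tr (n ^ m) = x := by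
      rintro x ⟨q, rfl⟩
      obtain ⟨m, hm⟩ := ZMod.natCast_zmod_surjective ((↑v'⁻¹ : ZMod (2 ^ e)) * q)
      refine ⟨m, ?_⟩
      rw [B.tr_pow_of_lin_eq_one hBn, hm, hBnt]
      linear_combination 2 * q * Units.mul_inv v'
    intro x
    rcases two_dvd_or_isUnit x with hx | hx
    · obtain ⟨m, hm⟩ := hBeven x hx
      exact ⟨n ^ m, hm⟩
    · obtain ⟨m, hm⟩ := hBeven (x - B.tr p)
        (by rw [sub_eq_add_neg]; exact two_dvd_add_of_isUnit hx hBp.neg)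
      refine ⟨n ^ m * p, ?_⟩
      rw [B.tr_mul_of_lin_eq_one (by rw [map_pow, hBn, one_pow]), hm, sub_add_cancel]
  · rw [hBtr, hdneg h (by rw [T.lin_left, neg_add_cancel]; exact dvd_zero 4), hz]
    linear_combination (z ^ 2 + z) * hP4
  · obtain ⟨m, hm⟩ : ∃ u, A.lin k = 1 + 4 * s * (2 * u) := by
      obtain ⟨u, -, hu⟩ := T.lin_right
      exact ⟨u, by rw [hu, hr2, hs4]; ring⟩
    rw [hBtr, hdpos k (h4pos hm), T.tr_right]
    ring

theorem isAffineStabilizer (hA : A.Faithful) (hs : Function.Surjective A.tr)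
    (hidx : H.index = 2 ^ e) : IsAffineStabilizer e H := by
  by_cases hno : ∀ n, A.lin n = 1 → ¬ IsUnit (A.tr n)
  · exact T.isAffineStabilizer_of_no_translation hA hs hidx hno
  · push Not at hno
    obtain ⟨n, hn, hnu⟩ := hno
    exact T.isAffineStabilizer_of_translation hA hs hidx hn hnu

end IsTwisted

/-! ### Subgroups containing no nontrivial translation. -/

/-- A subgroup of index `2 ^ e` without translations is an affine stabilizer, unless it is
generated by a fixed point free reflection. -/
theorem Faithful.isAffineStabilizer_or (hA : A.Faithful) (he : 2 ≤ e)
    (hs : Function.Surjective A.tr) (hidx : H.index = 2 ^ e)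
    (hinf : ∀ h ∈ H, A.lin h = 1 → h = 1) :
    IsAffineStabilizer e H ∨
      ∃ h, A.lin h = -1 ∧ IsUnit (A.tr h) ∧ H = Subgroup.zpowers h := by
  have hinj : ∀ h ∈ H, ∀ k ∈ H, A.lin h = A.lin k → h = k := by
    intro h hh k hk hl
    exact inv_mul_eq_one.1 (hinf _ (H.mul_mem (H.inv_mem hh) hk)
      (by rw [map_mul, ← hl, lin_inv_mul]))
  -- The identity witnesses r = e. For the least r, the element `k` generates the part of `H` with
  -- linear part ≡ 1 mod 4.
  have hex : ∃ r, 2 ≤ r ∧ r ≤ e ∧ ∃ k ∈ H, ∃ u, IsUnit u ∧ A.lin k = 1 + 2 ^ r * u :=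
    ⟨e, he, le_rfl, 1, H.one_mem, 1, isUnit_one, by rw [map_one, two_pow_self]; ring⟩
  classical
  obtain ⟨hr2, hre, k, hkH, u, hu, hk⟩ := Nat.find_spec hex
  have hmin := fun m hm => Nat.find_min (H := hex) (m := m) hm
  generalize Nat.find hex = r at *
  have hpos : ∀ h ∈ H, 4 ∣ A.lin h - 1 → ∃ m : ℕ, h = k ^ m := by
    intro h hh h4
    obtain ⟨j, hj2, hje, v, hv, hjv⟩ := exists_two_pow_mul_of_dvd he
      (show (2 : ZMod (2 ^ e)) ^ 2 ∣ A.lin h - 1 by norm_num; exact h4)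
    have hrj : r ≤ j := by
      by_contra hlt
      exact hmin j (by omega) ⟨hj2, hje, h, hh, v, hv, by linear_combination hjv⟩
    obtain ⟨m, hm⟩ := exists_pow_eq hr2 hu hk
      (show 2 ^ r ∣ A.lin h - 1 from hjv ▸ (pow_dvd_pow 2 hrj).mul_right v)
    exact ⟨m, hinj h hh _ (H.pow_mem hkH m) (by rw [map_pow, hm])⟩
  have hk4 : 4 ∣ A.lin k - 1 := by
    rw [hk, add_sub_cancel_left, show (4 : ZMod (2 ^ e)) = 2 ^ 2 by norm_num]
    exact (pow_dvd_pow 2 hr2).mul_right u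
  -- As k^(2^(e-r)) = 1, the translation part of `k` is a multiple of 2^r, and 1 - `A.lin k` is 2^r
  -- times a unit; so `k` has a fixed point, which is moved to 0.
  obtain ⟨x, hx⟩ : ∃ x, (A.shift x).tr k = 0 := by
    have h1 : k ^ 2 ^ (e - r) = 1 := by
      refine hinf _ (H.pow_mem hkH _) ?_
      have h3 := pow_two_pow_sub_one (r := r) (a := A.lin k) (by omega) ⟨u, by rw [hk]; ring⟩ (e - r)
      rw [two_pow_eq_zero (show e ≤ r + (e - r) by omega), zero_dvd_iff, sub_eq_zero] at h3
      rw [map_pow, h3]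
    have h2 := A.tr_pow k (2 ^ (e - r))
    obtain ⟨w, hw, hsum⟩ := geom_sum_eq hk4 (2 ^ (e - r))
    rw [h1, tr_one, hsum] at h2
    push_cast at h2
    have h3 : w * (2 ^ (e - r) * A.tr k) = 0 := by linear_combination -h2
    rw [hw.mul_right_eq_zero, two_pow_mul_eq_zero (i := r) (by omega)] at h3
    obtain ⟨y, hy⟩ := h3
    obtain ⟨u, rfl⟩ := hu
    refine ⟨-(↑u⁻¹ * y), ?_⟩
    rw [shift_tr, hy, hk]
    linear_combination -(2 ^ r * y) * Units.mul_inv u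
  have hA' := hA.shift x
  have hs' := A.shift_surjective hs x
  have hl' : (A.shift x).lin = A.lin := rfl
  rw [← hl'] at hinj hk hk4 hpos
  have hlmain : ∀ h, (A.shift x).lin h = A.lin h := fun _ => rfl
  have htmain : ∀ h, (A.shift x).tr h = A.tr h - (1 - A.lin h) * x := fun _ => rfl
  generalize A.shift x = A' at *
  have hpow : ∀ m : ℕ, A'.tr (k ^ m) = 0 := fun m => A'.stab.pow_mem hx m
  by_cases hall : ∀ h ∈ H, 4 ∣ A'.lin h - 1
  · left
    refine isAffineStabilizer_of_fixed hs' hidx 0 fun h hh => ?_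
    obtain ⟨m, rfl⟩ := hpos h hh (hall h hh)
    rw [hpow, mul_zero]
  push Not at hall
  obtain ⟨h, hhH, hh⟩ := hall
  have hh4 := (four_dvd_or (A'.isUnit_lin h)).resolve_left hh
  have hgen : ∀ g ∈ H, ∃ m : ℕ, g = k ^ m ∨ g = h * k ^ m := by
    intro g hg
    rcases four_dvd_or (A'.isUnit_lin g) with h4 | h4
    · obtain ⟨m, hm⟩ := hpos g hg h4
      exact ⟨m, Or.inl hm⟩
    · have h5 : 4 ∣ A'.lin (h⁻¹ * g) - 1 := by
        have h6 : A'.lin (h⁻¹ * g) - 1 = A'.lin h⁻¹ * (A'.lin g + 1 - (A'.lin h + 1)) := by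
          rw [map_mul]; linear_combination A'.lin_inv_mul h
        rw [h6]
        exact (dvd_sub h4 hh4).mul_left _
      obtain ⟨m, hm⟩ := hpos _ (H.mul_mem (H.inv_mem hhH) hg) h5
      exact ⟨m, Or.inr (by rw [← hm, mul_inv_cancel_left])⟩
  obtain ⟨v, hv⟩ := exists_one_sub_eq hh4
  have hhh : ∃ m : ℕ, h * h = k ^ m :=
    hpos _ (H.mul_mem hhH hhH) (A'.four_dvd_lin_mul' hh4 hh4)
  have htrhh : A'.tr h * (1 + A'.lin h) = 0 := by
    obtain ⟨m, hm⟩ := hhh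
    have := hpow m
    rw [← hm, tr_mul] at this
    linear_combination this
  rcases hre.lt_or_eq with hlt | hreq
  · left
    -- `H` is abelian because its linear parts determine its elements. Commuting with `k` puts the
    -- translation part of `h` in 2^(e-r)ℤ.
    have hcomm : h * k = k * h := hinj _ (H.mul_mem hhH hkH) _ (H.mul_mem hkH hhH)
      (by rw [map_mul, map_mul, mul_comm])
    have h1 := congrArg A'.tr hcomm
    rw [tr_mul, tr_mul, hx, hk] at h1
    have h2 : u * (2 ^ r * A'.tr h) = 0 := by linear_combination -h1
    rw [hu.mul_right_eq_zero, two_pow_mul_eq_zero (i := e - r) (by omega)] at h2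
    obtain ⟨y, hy⟩ := h2
    rcases two_dvd_or_isUnit y with hy2 | hyu
    -- The given point is fixed by `h`; since y is even, `k` fixes it too.
    · have hfix : ∀ g ∈ H, A'.tr g = (1 - A'.lin g) * (2 ^ (e - r - 1) * y * ↑v⁻¹) := by
        intro g hg
        have hke : ∀ m : ℕ, (1 - A'.lin (k ^ m)) * (2 ^ (e - r - 1) * y) = 0 := by
          intro m
          obtain ⟨q, hq⟩ : 2 ^ r ∣ A'.lin (k ^ m) - 1 := by
            rw [map_pow]
            refine Dvd.dvd.trans ⟨u, ?_⟩ (sub_one_dvd_pow_sub_one _ m)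
            rw [hk]; ring
          have h3 : (2 : ZMod (2 ^ e)) ^ (e - 1) = 2 ^ r * 2 ^ (e - r - 1) := by
            rw [← pow_add]; congr 1; omega
          have h4 := two_pow_pred_mul_even (e := e) (by omega) hy2
          rw [h3] at h4
          linear_combination -q * h4 - 2 ^ (e - r - 1) * y * hq
        obtain ⟨m, rfl | rfl⟩ := hgen g hg
        · rw [hpow]; linear_combination -(↑v⁻¹ : ZMod (2 ^ e)) * hke m
        · have h5 : (2 : ZMod (2 ^ e)) ^ (e - r) = 2 * 2 ^ (e - r - 1) := by
            rw [← pow_succ']; congr 1; omega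
          rw [tr_mul, hpow, map_mul, hy, h5]
          linear_combination -(A'.lin h * ↑v⁻¹) * hke m - 2 ^ (e - r - 1) * y * ↑v⁻¹ * hv
            - 2 * 2 ^ (e - r - 1) * y * Units.mul_inv v
      exact isAffineStabilizer_of_fixed hs' hidx _ hfix
    · have hd : 2 ^ r ∣ 1 + A'.lin h := by
        rw [← two_pow_mul_eq_zero (i := r) (j := e - r) (by omega)]
        rw [hy] at htrhh
        rw [← hyu.mul_left_eq_zero]
        linear_combination htrhh
      -- A power of `k` corrects the linear part of `h` to -1.
      obtain ⟨m, hm⟩ := exists_pow_eq hr2 hu hk (x := -A'.lin h⁻¹) (by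
        have h6 : -A'.lin h⁻¹ - 1 = -A'.lin h⁻¹ * (1 + A'.lin h) := by
          linear_combination A'.lin_inv_mul h
        rw [h6]; exact hd.mul_left _)
      have T : A'.IsTwisted H r (h * k ^ m) k :=
        { two_le := hr2
          lt := hlt
          mem_left := H.mul_mem hhH (H.pow_mem hkH m)
          mem_right := hkH
          tr_right := hx
          lin_right := ⟨u, hu, hk⟩
          lin_left := by
            rw [map_mul, map_pow, hm]
            linear_combination -A'.lin_inv_mul h
          tr_left := ⟨y, hyu, by rw [tr_mul, hpow, hy]; ring⟩
          gen := by
            intro g hg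
            obtain ⟨j, hj | hj⟩ := hgen g hg
            · exact ⟨j, Or.inl hj⟩
            · obtain ⟨i, hi⟩ := hpos ((k ^ m)⁻¹ * k ^ j)
                (H.mul_mem (H.inv_mem (H.pow_mem hkH m)) (H.pow_mem hkH j))
                (A'.positive.mul_mem (A'.positive.inv_mem (A'.positive.pow_mem hk4 m))
                  (A'.positive.pow_mem hk4 j))
              exact ⟨i, Or.inr (by rw [hj, ← hi, mul_assoc, mul_inv_cancel_left])⟩ }
      exact T.isAffineStabilizer hA' hs' hidx
  · have hk1 : k = 1 := hinf k hkH (by rw [← hlmain, hk, hreq, two_pow_self]; ring)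
    subst hk1
    simp only [one_pow, mul_one] at hgen hhh
    obtain ⟨-, hhh⟩ := hhh
    have hsq : A'.lin h * A'.lin h = 1 := by rw [← map_mul, hhh, map_one]
    have hfix : 2 ∣ A'.tr h → IsAffineStabilizer e H := by
      rintro ⟨β, hβ⟩
      refine isAffineStabilizer_of_fixed hs' hidx (β * ↑v⁻¹) fun g hg => ?_
      obtain ⟨-, rfl | rfl⟩ := hgen g hg
      · rw [tr_one, map_one]; ring
      · rw [hβ, hv]
        linear_combination -2 * β * Units.mul_inv v
    rcases two_dvd_or_isUnit (A'.tr h) with h2 | h2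
    · exact Or.inl (hfix h2)
    rcases sq_eq_one_of_four_dvd_add (by omega) hh4 hsq with h3 | h3
    · right
      refine ⟨h, by rw [← hlmain, h3], ?_, le_antisymm (fun g hg => ?_) (Subgroup.zpowers_le.2 hhH)⟩
      · have h4 : A.tr h = A'.tr h + 2 * (v * x) := by
          rw [htmain, ← hlmain]; linear_combination x * hv
        rw [h4]
        exact isUnit_add_of_two_dvd h2 ⟨_, rfl⟩
      · obtain ⟨-, rfl | rfl⟩ := hgen g hg
        · exact one_mem _
        · exact Subgroup.mem_zpowers g
    -- The linear part -1 + 2^(e-1) is impossible for an involution with odd translation part.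
    · exfalso
      rw [h3, h2.mul_right_eq_zero] at htrhh
      exact two_pow_ne_zero (e := e) (k := e - 1) (by omega) (by linear_combination htrhh)

end AffineAction

/-! ### Subgroups generated by a fixed point free reflection. -/

namespace AffineAction

open scoped commutatorElement

variable {e : ℕ} {G : Type*} [Group G] {A : AffineAction e G}

/-- The range of the linear part has order at most `2 ^ (e - 1)`. -/
theorem card_le_two_pow_mul_card_ker [Finite G] (he : 1 ≤ e) :
    Nat.card G ≤ Nat.card A.lin.ker * 2 ^ (e - 1) := by
  have hk : A.lin.ker = A.lin.toHomUnits.ker := by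
    ext g
    rw [MonoidHom.mem_ker, MonoidHom.mem_ker, Units.ext_iff]
    rfl
  rw [← A.lin.ker.card_mul_index, hk, Subgroup.index_ker]
  refine Nat.mul_le_mul_left _ ((Subgroup.card_le_card_group _).trans ?_)
  rw [Nat.card_eq_fintype_card, ZMod.card_units_eq_totient,
    Nat.totient_prime_pow Nat.prime_two (by omega)]
  simp

variable (hA : A.Faithful) {h : G} (hh : A.lin h = -1)
include hA hh

theorem Faithful.orderOf_eq_two (he : 2 ≤ e) : orderOf h = 2 := by
  refine orderOf_eq_prime (by rw [pow_two, hA.mul_self_eq_one hh]) ?_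
  rintro rfl
  rw [map_one] at hh
  refine two_pow_ne_zero (e := e) (k := 1) (by omega) ?_
  linear_combination hh

theorem Faithful.card_eq_of_index (he : 2 ≤ e) (hidx : (Subgroup.zpowers h).index = 2 ^ e) :
    Nat.card G = 2 ^ (e + 1) := by
  rw [← (Subgroup.zpowers h).card_mul_index, Nat.card_zpowers, hA.orderOf_eq_two hh he, hidx,
    pow_succ']

theorem Faithful.exists_stab_eq_zpowers (he : 2 ≤ e) (hs : Function.Surjective A.tr)
    (hidx : (Subgroup.zpowers h).index = 2 ^ e) :
    ∃ s, s ≠ 1 ∧ s * s = 1 ∧ A.stab = Subgroup.zpowers s := by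
  have := hA.finite
  have h1 := A.stab.card_mul_index
  rw [A.index_of_surjective hs, hA.card_eq_of_index hh he hidx, pow_succ'] at h1
  have h2 : Nat.card A.stab = 2 := Nat.eq_of_mul_eq_mul_right (by positivity) h1
  have hp : Fact (Nat.Prime 2) := ⟨Nat.prime_two⟩
  have hcyc : IsCyclic A.stab := isCyclic_of_prime_card h2
  obtain ⟨s, hs⟩ := (Subgroup.isCyclic_iff_exists_zpowers_eq_top _).1 hcyc
  have h3 : orderOf s = 2 := by rw [← Nat.card_zpowers, hs, h2]
  refine ⟨s, ?_, ?_, hs.symm⟩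
  · rintro rfl
    rw [orderOf_one] at h3
    omega
  · rw [← pow_two, ← h3, pow_orderOf_eq_one]

/-- The dihedral case. -/
theorem Faithful.isAffineStabilizer_of_dihedral (he : 2 ≤ e) (hu : IsUnit (A.tr h))
    (hidx : (Subgroup.zpowers h).index = 2 ^ e) {s : G} (hss : s * s = 1) (hs0 : A.tr s = 0)
    (hs4 : 4 ∣ A.lin s + 1) : IsAffineStabilizer e (Subgroup.zpowers h) := by
  have := hA.finite
  have hhh := hA.mul_self_eq_one hh
  have hl : A.lin (h * s) = -A.lin s := by rw [map_mul, hh, neg_one_mul]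
  have ht : A.tr (h * s) = A.tr h := by rw [tr_mul, hs0, mul_zero, add_zero]
  have h4 : h * s ∈ A.positive := by
    rw [mem_positive, hl, ← neg_add', dvd_neg]; exact hs4
  -- The element hs is a 2^e-cycle inverted by `h`, so `G` is dihedral, and mapping hs to z ↦ z + 1
  -- and `h` to z ↦ -z gives the new action.
  have hord := hA.orderOf_eq he h4 (ht ▸ hu)
  have hidx2 : (Subgroup.zpowers (h * s)).index = 2 := by
    have h5 := (Subgroup.zpowers (h * s)).card_mul_index
    rw [Nat.card_zpowers, hord, hA.card_eq_of_index hh he hidx, pow_succ] at h5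
    exact Nat.eq_of_mul_eq_mul_left (by positivity) h5
  have hnot : h ∉ Subgroup.zpowers (h * s) := by
    intro hm
    have h5 := Subgroup.zpowers_le.2 h4 hm
    rw [mem_positive, hh] at h5
    refine not_four_dvd_two he ?_
    rw [← dvd_neg]
    convert h5 using 1
    ring
  have hcov : ∀ q, ∃ i : ℤ, q = (h * s) ^ i ∨ q = (h * s) ^ i * h := by
    intro q
    by_cases hq : q ∈ Subgroup.zpowers (h * s)
    · obtain ⟨i, rfl⟩ := Subgroup.mem_zpowers_iff.1 hq
      exact ⟨i, Or.inl rfl⟩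
    · have h5 : q * h⁻¹ ∈ Subgroup.zpowers (h * s) := by
        rw [Subgroup.mul_mem_iff_of_index_two hidx2, inv_mem_iff]
        exact iff_of_false hq hnot
      obtain ⟨i, hi⟩ := Subgroup.mem_zpowers_iff.1 h5
      exact ⟨i, Or.inr (by rw [hi, inv_mul_cancel_right])⟩
  have hinv : h⁻¹ = h := inv_eq_of_mul_eq_one_left hhh
  have sinv : s⁻¹ = s := inv_eq_of_mul_eq_one_left hss
  obtain ⟨f, hf1, hf2⟩ := exists_hom_of_index_two_zpowers (u := -1) (j := 0) hcov hnot
    (by rw [hinv, zpow_neg_one, mul_inv_rev, hinv, sinv, ← mul_assoc, hhh, one_mul])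
    (by rw [hhh, zpow_zero])
    (X := (⟨1, 1⟩ : AffineMapUnit (ZMod (2 ^ e)))) (Y := ⟨0, -1⟩)
    (by
      rw [hord]
      refine AffineMapUnit.action_faithful e _ ((AffineMapUnit.action e).tr_pow_two_pow_self _) ?_
      rw [map_pow]
      exact one_pow _)
    (by
      rw [zpow_neg_one]
      refine AffineMapUnit.ext_val ?_ ?_ <;>
      simp [AffineMapUnit.mul_tr, AffineMapUnit.mul_lin, AffineMapUnit.inv_tr,
        AffineMapUnit.inv_lin])
    (by
      rw [zpow_zero]
      refine AffineMapUnit.ext_val ?_ ?_ <;>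
      simp [AffineMapUnit.mul_tr, AffineMapUnit.mul_lin, AffineMapUnit.one_tr,
        AffineMapUnit.one_lin])
  let B := (AffineMapUnit.action e).comap f
  refine ⟨B, B.stab_eq_of_le hidx (fun x => ?_) (Subgroup.zpowers_le.2 ?_)⟩
  · have h5 : B.tr (h * s) = 1 := congrArg AffineMapUnit.tr hf1
    have h6 : B.lin (h * s) = 1 := congrArg (fun y => ((AffineMapUnit.lin y : (ZMod (2 ^ e))ˣ) :
      ZMod (2 ^ e))) hf1
    obtain ⟨m, hm⟩ := B.exists_pow_tr_eq (by rw [h6]; simp) (h5 ▸ isUnit_one) x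
    exact ⟨_, hm⟩
  · exact congrArg AffineMapUnit.tr hf2

/-- The case in which all commutators with the reflection `x ↦ 1 - x` have order at most two. -/
theorem Faithful.isAffineStabilizer_of_commutators (he : 2 ≤ e) (h1 : A.tr h = 1)
    (hcomm : ∀ g, 2 * (1 - 2 * A.tr g - A.lin g) = 0) :
    IsAffineStabilizer e (Subgroup.zpowers h) := by
  obtain ⟨P, hP⟩ : ∃ P : ZMod (2 ^ e), P = 2 ^ (e - 1) := ⟨_, rfl⟩
  have hP2 : 2 * P = 0 := hP ▸ two_mul_two_pow_pred (by omega)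
  have hPP : P * P = 0 := sq_eq_zero_of_two_mul he hP2
  have hP0 : P ≠ 0 := hP ▸ two_pow_ne_zero (by omega)
  have hPt : ∀ t, P * t = 0 ∨ P * t = P := by
    intro t
    rcases two_dvd_or_isUnit t with h2 | h2
    · exact Or.inl (hP ▸ two_pow_pred_mul_even (by omega) h2)
    · exact Or.inr (hP ▸ two_pow_mul_self_eq (by omega) h2)
  -- By `hcomm`, `A.lin g` is 1 - 2 `A.tr g` up to 2^(e-1), and `q` selects one of the two possible
  -- values. The elements satisfying it form the kernel of a homomorphism to a group of order two,
  -- and `h` lies outside.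
  let q : G → Prop := fun g => A.lin g = 1 - 2 * A.tr g + P * A.tr g
  have hneg : ∀ g, ¬ q g ↔ A.lin g = 1 - 2 * A.tr g + P * A.tr g + P := by
    intro g
    constructor
    · intro hq
      simp only [q] at hq
      rcases eq_zero_or_of_two_mul (by omega) (hcomm g) with h2 | h2 <;> rw [← hP] at * <;>
        rcases hPt (A.tr g) with h3 | h3 <;> rw [h3] at hq ⊢
      · exact absurd (by linear_combination -h2) hq
      · linear_combination -h2 - hP2
      · linear_combination -h2 - hP2
      · exact absurd (by linear_combination -h2 - hP2) hq
    · intro h2 h3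
      exact hP0 (by linear_combination h3 - h2)
  classical
  have hmul : ∀ g g', (q (g * g') ↔ (q g ↔ q g')) := by
    intro g g'
    by_cases hg : q g <;> by_cases hg' : q g'
    · refine iff_of_true ?_ (iff_of_true hg hg')
      simp only [q] at hg hg' ⊢
      rw [map_mul, tr_mul, hg, hg']
      ring
    · refine iff_of_false ?_ (fun hi => hg' (hi.1 hg))
      rw [hneg] at hg' ⊢
      simp only [q] at hg
      rw [map_mul, tr_mul, hg, hg']
      linear_combination A.tr g * hPP - A.tr g * hP2
    · refine iff_of_false ?_ (fun hi => hg (hi.2 hg'))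
      rw [hneg] at hg ⊢
      simp only [q] at hg'
      rw [map_mul, tr_mul, hg, hg']
      ring
    · refine iff_of_true ?_ (iff_of_false hg hg')
      rw [hneg] at hg hg'
      simp only [q]
      rw [map_mul, tr_mul, hg, hg']
      linear_combination (1 - A.tr g) * hP2 + (A.tr g + 1) * hPP
  -- Outside `q`, the element g acts as hg does in `A`, with 2^(e-1) added to the linear part; this
  -- makes `h` fix 0. On `q` only the translation part is rescaled, by 1 + 2^(e-1).
  let B : AffineAction e G :=
    { lin :=
        { toFun := fun g => if q g then A.lin g else P - A.lin g
          map_one' := by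
            rw [if_pos (by simp only [q]; rw [map_one, tr_one]; ring), map_one]
          map_mul' := fun g g' => by
            by_cases hg : q g <;> by_cases hg' : q g'
            · rw [if_pos hg, if_pos hg', if_pos ((hmul g g').2 (iff_of_true hg hg')), map_mul]
            · rw [if_pos hg, if_neg hg', if_neg (fun hi => hg' (((hmul g g').1 hi).1 hg)), map_mul]
              have hg1 : A.lin g = 1 - 2 * A.tr g + P * A.tr g := hg
              linear_combination A.tr g * hP2 - A.tr g * hPP - P * hg1
            · rw [if_neg hg, if_pos hg', if_neg (fun hi => hg (((hmul g g').1 hi).2 hg')), map_mul]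
              have hg1 : A.lin g' = 1 - 2 * A.tr g' + P * A.tr g' := hg'
              linear_combination A.tr g' * hP2 - A.tr g' * hPP - P * hg1
            · rw [if_neg hg, if_neg hg', if_pos ((hmul g g').2 (iff_of_false hg hg')), map_mul]
              rw [hneg] at hg hg'
              linear_combination P * hg + P * hg' + (1 - A.tr g - A.tr g') * hP2 + (A.tr g + A.tr g' + 1) * hPP }
      tr := fun g => if q g then A.tr g + P * A.tr g else 1 - A.tr g
      tr_mul := fun g g' => by
        change _ = _ + (if q g then A.lin g else P - A.lin g) * _
        by_cases hg : q g <;> by_cases hg' : q g'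
        · rw [if_pos hg, if_pos hg', if_pos ((hmul g g').2 (iff_of_true hg hg')), tr_mul, if_pos hg]
          simp only [q] at hg hg'
          rw [hg]
          ring
        · rw [if_pos hg, if_neg hg', if_neg (fun hi => hg' (((hmul g g').1 hi).1 hg)), tr_mul,
            if_pos hg]
          rw [hneg] at hg'
          simp only [q] at hg
          rw [hg]
          linear_combination -A.tr g * hP2
        · rw [if_neg hg, if_pos hg', if_neg (fun hi => hg (((hmul g g').1 hi).2 hg')), tr_mul,
            if_neg hg]
          rw [hneg] at hg
          rw [hg]
          linear_combination A.tr g * A.tr g' * hPP - A.tr g * A.tr g' * hP2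
        · rw [if_neg hg, if_neg hg', if_pos ((hmul g g').2 (iff_of_false hg hg')), tr_mul,
            if_neg hg]
          rw [hneg] at hg
          rw [hg]
          linear_combination (A.tr g + A.tr g' - A.tr g * A.tr g') * hP2 + (A.tr g * A.tr g' + A.tr g') * hPP }
  have hBtr : ∀ g, B.tr g = if q g then A.tr g + P * A.tr g else 1 - A.tr g := fun _ => rfl
  refine ⟨B, le_antisymm (fun g hg => ?_) (Subgroup.zpowers_le.2 ?_)⟩
  · rw [mem_stab, hBtr] at hg
    rw [hA.mem_zpowers_iff hh]
    split_ifs at hg with hq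
    · left
      simp only [q] at hq
      have h3 : A.tr g = 0 := by linear_combination (1 - P) * hg + A.tr g * hPP
      exact hA g h3 (by rw [hq, h3]; ring)
    · right
      rw [hneg] at hq
      have h3 : A.tr g = 1 := by linear_combination -hg
      exact hA.ext (h3.trans h1.symm) (by rw [hq, h3, hh]; linear_combination hP2)
  · have hq : ¬ q h := by
      rw [hneg, hh, h1]; linear_combination -hP2
    rw [mem_stab, hBtr, if_neg hq, h1, sub_self]

/-- The stabiliser of 0 in `A` is generated by an involution s with linear part ≡ 3 mod 4, the
dihedral case, or equal to 1 + 2^(e-1). In the latter case, if the size conditions fail then |G ∩ N|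
= 4 and |[G, G]| divides 2, so commutators with `h` are killed by 2. -/
theorem Faithful.isAffineStabilizer_or_of_reflection (he : 2 ≤ e) (hs : Function.Surjective A.tr)
    (hu : IsUnit (A.tr h)) (hidx : (Subgroup.zpowers h).index = 2 ^ e) :
    IsAffineStabilizer e (Subgroup.zpowers h) ∨
      (∃ s, A.lin s = 1 + 2 ^ (e - 1) ∧ A.stab = Subgroup.zpowers s) ∧
      (8 ≤ Nat.card A.lin.ker ∨ (Nat.card A.lin.ker = 4 ∧ Nat.card (commutator G) = 4)) := by
  have hfin := hA.finite
  obtain ⟨s, hs1, hss, hst⟩ := hA.exists_stab_eq_zpowers hh he hs hidx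
  have hs0 : A.tr s = 0 := by rw [← mem_stab, hst]; exact Subgroup.mem_zpowers s
  have hsl : A.lin s * A.lin s = 1 := by rw [← map_mul, hss, map_one]
  have hsne : A.lin s ≠ 1 := fun h0 => hs1 (hA s hs0 h0)
  rcases four_dvd_or (A.isUnit_lin s) with h4 | h4
  · have hd := (sq_eq_one_of_four_dvd_sub (by omega) h4 hsl).resolve_left hsne
    by_cases hc : 8 ≤ Nat.card A.lin.ker ∨ (Nat.card A.lin.ker = 4 ∧ Nat.card (commutator G) = 4)
    · exact Or.inr ⟨⟨s, hd, hst⟩, hc⟩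
    left
    push Not at hc
    obtain ⟨hc1, hc2⟩ := hc
    have hcard := hA.card_eq_of_index hh he hidx
    -- At most 2^(e-1) linear parts occur while |G| = 2^(e+1), so there are at least four
    -- translations; by assumption there are fewer than eight.
    have hker : Nat.card A.lin.ker = 4 := by
      have h5 := card_le_two_pow_mul_card_ker (A := A) (by omega)
      rw [hcard, show e + 1 = 2 + (e - 1) by omega, pow_add] at h5
      have h6 := Nat.le_of_mul_le_mul_right h5 (by positivity)
      have h7 : Nat.card A.lin.ker ∣ 2 ^ (e + 1) := hcard ▸ Subgroup.card_subgroup_dvd_card _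
      obtain ⟨m, -, hm⟩ := (Nat.dvd_prime_pow Nat.prime_two).1 h7
      rw [hm] at h6 hc1 ⊢
      have h8 : 2 ≤ m := (Nat.pow_le_pow_iff_right (by norm_num : 1 < 2)).1 h6
      have h9 : m < 3 := (Nat.pow_lt_pow_iff_right (by norm_num : 1 < 2)).1 hc1
      rw [show m = 2 by omega]
      norm_num
    have hle : commutator G ≤ A.lin.ker := by
      rw [commutator_def, Subgroup.commutator_le]
      exact fun g _ k _ => A.lin_commutator g k
    have hcd : Nat.card (commutator G) ∣ 4 := hker ▸ Subgroup.card_dvd_of_le hle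
    have hc2' := hc2 hker
    have hc2d : Nat.card (commutator G) ∣ 2 := by
      obtain ⟨m, hm, hm2⟩ := (Nat.dvd_prime_pow (m := 2) Nat.prime_two).1 (by simpa using hcd)
      have : m ≠ 2 := by rintro rfl; exact hc2' (by rw [hm2]; norm_num)
      rw [hm2]
      exact (pow_dvd_pow 2 (show m ≤ 1 by omega)).trans (by norm_num)
    have hcomm : ∀ g, 2 * A.tr ⁅h, g⁆ = 0 := by
      intro g
      have hmem : ⁅h, g⁆ ∈ commutator G := Subgroup.commutator_mem_commutator
        (Subgroup.mem_top h) (Subgroup.mem_top g)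
      have h5 : (⟨_, hmem⟩ : commutator G) ^ 2 = 1 :=
        orderOf_dvd_iff_pow_eq_one.1 ((orderOf_dvd_natCard _).trans hc2d)
      have h6 : ⁅h, g⁆ ^ 2 = 1 := congrArg Subtype.val h5
      have h7 := A.tr_pow_of_lin_eq_one (A.lin_commutator h g) 2
      rw [h6, tr_one] at h7
      exact_mod_cast h7.symm
    obtain ⟨u, hu⟩ := hu
    -- Rescaling turns the reflection into x ↦ 1 - x.
    refine (hA.scale u⁻¹).isAffineStabilizer_of_commutators (A := A.scale ↑u⁻¹) hh he
      (by change ↑u⁻¹ * A.tr h = 1; rw [← hu, Units.inv_mul]) fun g => ?_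
    change 2 * (1 - 2 * (↑u⁻¹ * A.tr g) - A.lin g) = 0
    have h5 := hcomm g
    rw [tr_commutator, hh, ← hu] at h5
    linear_combination (↑u⁻¹ : ZMod (2 ^ e)) * h5 - 2 * (1 - A.lin g) * Units.inv_mul u
  · exact Or.inl (hA.isAffineStabilizer_of_dihedral hh he hu hidx hss hs0 h4)

end AffineAction

/-! ### The criterion for affine actions. -/

namespace AffineAction

variable {e : ℕ} {G : Type*} [Group G] {A : AffineAction e G} {H : Subgroup G}

theorem Faithful.exists_card_eq_two_pow (hA : A.Faithful) :
    ∃ m, Nat.card G = 2 ^ m := by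
  have := hA.finite
  have hp : Fact (Nat.Prime 2) := ⟨Nat.prime_two⟩
  refine (IsPGroup.iff_card (p := 2)).1 fun g => ⟨e, hA.pow_two_pow_self g⟩

/-- The subgroups of index `2 ^ e` in a transitive group of affine maps of `ZMod (2 ^ e)` that are
not point stabilizers of an affine action. -/
theorem Faithful.not_isAffineStabilizer_iff (hA : A.Faithful) (hs : Function.Surjective A.tr)
    (hidx : H.index = 2 ^ e) : ¬ IsAffineStabilizer e H ↔
      (4 ≤ Nat.card (H ⊓ A.lin.ker : Subgroup G)) ∨
      (Nat.card (H ⊓ A.lin.ker : Subgroup G) = 2 ∧ ¬ ∃ g : G, orderOf g = 2 ^ e) ∨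
      (Nat.card (H ⊓ A.lin.ker : Subgroup G) = 2 ∧ ¬ H.Normal) ∨
      (Nat.card (H ⊓ A.lin.ker : Subgroup G) = 1 ∧
        (∃ h, (A.lin h = -1 ∧ IsUnit (A.tr h)) ∧ H = Subgroup.zpowers h) ∧
        Nat.card G = 2 ^ (e + 1) ∧
        (∃ s, A.lin s = 1 + 2 ^ (e - 1) ∧ A.stab = Subgroup.zpowers s) ∧
        (8 ≤ Nat.card A.lin.ker ∨
          (Nat.card A.lin.ker = 4 ∧ Nat.card (commutator G) = 4))) := by
  have hfin := hA.finite
  constructor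
  · intro hn
    by_contra! hcon
    obtain ⟨h4, h2, h2', h1⟩ := hcon
    apply hn
    rcases le_or_gt e 1 with he | he
    -- For e ≤ 1 the only linear part is 1, so |G| ≤ 2^e and `H` is trivial.
    · have hH : H = ⊥ := by
        have h5 := H.card_mul_index
        rw [hidx] at h5
        have h6 := hA.card_group_le he
        rw [← h5] at h6
        have h7 : Nat.card H ≤ 1 := Nat.le_of_mul_le_mul_right (by omega) (Nat.two_pow_pos e)
        exact Subgroup.card_le_one_iff_eq_bot _ |>.1 h7
      exact ⟨A, A.stab_eq_of_le hidx hs (hH ▸ bot_le)⟩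
    obtain ⟨m, hm⟩ := hA.exists_card_eq_two_pow
    obtain ⟨k, -, hk⟩ := (Nat.dvd_prime_pow Nat.prime_two).1
      (hm ▸ (H ⊓ A.lin.ker).card_subgroup_dvd_card)
    have hk2 : k < 2 := (Nat.pow_lt_pow_iff_right (by norm_num : 1 < 2)).1 (by omega)
    interval_cases k
    · rw [pow_zero] at hk
      have hbot := Subgroup.card_eq_one.1 hk
      have hinf : ∀ h ∈ H, A.lin h = 1 → h = 1 := fun h hh hl =>
        (Subgroup.eq_bot_iff_forall _).1 hbot h ⟨hh, hl⟩
      rcases hA.isAffineStabilizer_or he hs hidx hinf with h5 | ⟨h, hl, hu, rfl⟩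
      · exact h5
      · refine (hA.isAffineStabilizer_or_of_reflection hl he hs hu hidx).resolve_right ?_
        rintro ⟨⟨s, hs1, hs2⟩, hc⟩
        obtain ⟨h6, h7⟩ := h1 hk ⟨h, ⟨hl, hu⟩, rfl⟩ (hA.card_eq_of_index hl he hidx) ⟨s, hs1, hs2⟩
        rcases hc with hc | ⟨hc, hc'⟩
        · omega
        · exact h7 hc hc'
    · obtain ⟨g, hg⟩ := h2 hk
      have := h2' hk
      exact hA.isAffineStabilizer_of_normal he hidx hk hg
  · rintro (h | ⟨h, h'⟩ | ⟨h, h'⟩ | ⟨-, ⟨h, ⟨hl, hu⟩, rfl⟩, -, ⟨s, hs1, hs2⟩, hc⟩)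
    · rintro ⟨B, hB⟩
      have := hA.card_inf_ker_lt hidx hB
      omega
    · rintro ⟨B, hB⟩
      exact h' (hA.exists_orderOf_eq hidx hB h)
    · rintro ⟨B, hB⟩
      exact h' (hA.normal_of_card hidx hB h)
    · exact hA.not_isAffineStabilizer hl hu hs1 hs2 hidx hc

end AffineAction

/-! ### Return to subgroups of the holomorph. -/

namespace Hol

variable {N : Type*} [CommGroup N] {e : ℕ} (hN : Nat.card N = 2 ^ e) {σ : N}
  (hσ : Subgroup.zpowers σ = ⊤) (G : Subgroup (Hol N))

/-- The affine action of a subgroup of the holomorph. -/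
noncomputable def subAffine : AffineAction e G := (affine hN hσ).comap G.subtype

theorem subAffine_faithful : (subAffine hN hσ G).Faithful := fun _ h1 h2 =>
  Subtype.ext (affine_faithful hN hσ _ h1 h2)

theorem stab_eq : Hol.stab G = (subAffine hN hσ G).stab :=
  Subgroup.ext fun t => mem_stab_iff hN hσ G t

theorem base_eq : Hol.base N = (affine hN hσ).lin.ker := Subgroup.ext (mem_base_iff hN hσ)

theorem ker_subAffine : (subAffine hN hσ G).lin.ker = (Hol.base N).subgroupOf G := by
  rw [base_eq hN hσ]; rfl

theorem card_inf_base : Nat.card (G ⊓ Hol.base N : Subgroup (Hol N)) =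
    Nat.card (subAffine hN hσ G).lin.ker := by
  rw [ker_subAffine, ← Subgroup.card_map_of_injective G.subtype_injective,
    Subgroup.subgroupOf_map_subtype, inf_comm]

variable {G}

theorem card_inf_base_of_le {H : Subgroup (Hol N)} (hHG : H ≤ G) :
    Nat.card (H ⊓ Hol.base N : Subgroup (Hol N)) =
      Nat.card (H.subgroupOf G ⊓ (subAffine hN hσ G).lin.ker : Subgroup G) := by
  rw [ker_subAffine, ← Subgroup.card_map_of_injective G.subtype_injective,
    Subgroup.map_inf _ _ _ G.subtype_injective, Subgroup.subgroupOf_map_subtype,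
    Subgroup.subgroupOf_map_subtype, inf_eq_left.2 hHG, inf_comm _ G, ← inf_assoc,
    inf_eq_left.2 hHG]

theorem card_commutator : Nat.card (⁅G, G⁆ : Subgroup (Hol N)) = Nat.card (commutator G) := by
  rw [← Subgroup.card_map_of_injective G.subtype_injective, commutator_def,
    Subgroup.map_commutator, ← MonoidHom.range_eq_map, Subgroup.range_subtype]

/-- A subgroup of `G` is generated by an element of given coordinates. -/
theorem map_eq_zpowers_iff {K : Subgroup G} {g : Hol N} {P : G → Prop}
    (hP : ∀ k : G, k ∈ K → (P k ↔ (k : Hol N) = g)) :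
    K.map G.subtype = Subgroup.zpowers g ↔ ∃ k, P k ∧ K = Subgroup.zpowers k := by
  constructor
  · intro h
    obtain ⟨k, hk, rfl⟩ : g ∈ K.map G.subtype := h ▸ Subgroup.mem_zpowers g
    refine ⟨k, (hP k hk).2 rfl, Subgroup.map_injective G.subtype_injective ?_⟩
    rw [h, MonoidHom.map_zpowers]
  · rintro ⟨k, hk, rfl⟩
    rw [MonoidHom.map_zpowers]
    exact congrArg _ ((hP k (Subgroup.mem_zpowers k)).1 hk)

theorem affine_lin_powAut {a : ℤ} (ha : Odd a) (x : N) :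
    (affine hN hσ).lin ⟨x, powAut N a⟩ = a := by
  rw [affine_lin]
  change log hN hσ (powAut N a σ) = _
  rw [powAut_apply hN ha, log_zpow]

include hN hσ in
theorem isPretransitive_iff_subAffine : MulAction.IsPretransitive G N ↔
    Function.Surjective (subAffine hN hσ G).tr := isPretransitive_iff hN hσ G

theorem isUnit_intCast_iff (he : 1 ≤ e) {u : ℤ} : IsUnit (u : ZMod (2 ^ e)) ↔ Odd u := by
  rw [ZMod.coe_int_isUnit_iff_isCoprime]
  push_cast
  rw [IsCoprime.pow_left_iff (by omega), Int.isCoprime_two_left]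

theorem exists_reflection_iff {H : Subgroup (Hol N)} (hHG : H ≤ G) (he : 1 ≤ e) :
    (∃ u : ℤ, Odd u ∧ H = Subgroup.zpowers (⟨σ ^ u, powAut N (-1)⟩ : Hol N)) ↔
      ∃ h : G, ((subAffine hN hσ G).lin h = -1 ∧ IsUnit ((subAffine hN hσ G).tr h)) ∧
        H.subgroupOf G = Subgroup.zpowers h := by
  have hlin : ∀ x : N, (affine hN hσ).lin ⟨x, powAut N (-1)⟩ = -1 := fun x => by
    rw [affine_lin_powAut hN hσ (by decide)]; norm_num
  constructor
  · rintro ⟨u, hu, rfl⟩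
    refine ⟨⟨_, hHG (Subgroup.mem_zpowers _)⟩, ⟨hlin _, ?_⟩, ?_⟩
    · change IsUnit (log hN hσ (σ ^ u))
      rwa [log_zpow, isUnit_intCast_iff he]
    · apply Subgroup.map_injective G.subtype_injective
      rw [Subgroup.subgroupOf_map_subtype, inf_eq_left.2 hHG, MonoidHom.map_zpowers]
      rfl
  · rintro ⟨h, ⟨hl, hu⟩, hH⟩
    obtain ⟨u, hu'⟩ := ZMod.intCast_surjective ((subAffine hN hσ G).tr h)
    refine ⟨u, (isUnit_intCast_iff he).1 (hu' ▸ hu), ?_⟩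
    have hh : (h : Hol N) = ⟨σ ^ u, powAut N (-1)⟩ := by
      refine (affine_faithful hN hσ).ext ?_ (hl.trans (hlin _).symm)
      change _ = log hN hσ (σ ^ u)
      rw [log_zpow]
      exact hu'.symm
    rw [← hh, ← inf_eq_left.2 hHG, ← Subgroup.subgroupOf_map_subtype, hH, MonoidHom.map_zpowers]
    rfl

theorem stab_eq_zpowers_iff (he : 2 ≤ e) :
    (Hol.stab G).map G.subtype = Subgroup.zpowers (⟨1, powAut N (1 + 2 ^ (e - 1))⟩ : Hol N) ↔
      ∃ s : G, (subAffine hN hσ G).lin s = 1 + 2 ^ (e - 1) ∧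
        (subAffine hN hσ G).stab = Subgroup.zpowers s := by
  have hlin : (affine hN hσ).lin ⟨1, powAut N (1 + 2 ^ (e - 1))⟩ = 1 + 2 ^ (e - 1) := by
    rw [affine_lin_powAut hN hσ]
    · push_cast; rfl
    · exact odd_one.add_even ((even_two).pow_of_ne_zero (by omega))
  have htr : (affine hN hσ).tr ⟨1, powAut N (1 + 2 ^ (e - 1))⟩ = 0 := log_one hN hσ
  rw [stab_eq hN hσ]
  refine map_eq_zpowers_iff fun k hk => ⟨fun h => ?_, fun h => ?_⟩
  · exact (affine_faithful hN hσ).ext (Eq.trans hk htr.symm) (h.trans hlin.symm)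
  · rw [← hlin, ← h]; rfl

end Hol

theorem theorem1p3 {N : Type*} [CommGroup N] (e : ℕ) (hN : Nat.card N = 2 ^ e)
    (σ : N) (hσ : Subgroup.zpowers σ = ⊤)
    (G : Subgroup (Hol N)) (hG : MulAction.IsPretransitive G N)
    (H : Subgroup (Hol N)) (hHG : H ≤ G) (hindex : H.relIndex G = 2 ^ e) :
    ¬ IsRealizable (H.subgroupOf G) ↔
      (4 ≤ Nat.card (H ⊓ Hol.base N : Subgroup (Hol N))) ∨
      (Nat.card (H ⊓ Hol.base N : Subgroup (Hol N)) = 2 ∧ ¬ ∃ g ∈ G, orderOf g = 2 ^ e) ∨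
      (Nat.card (H ⊓ Hol.base N : Subgroup (Hol N)) = 2 ∧ ¬ (H.subgroupOf G).Normal) ∨
      (Nat.card (H ⊓ Hol.base N : Subgroup (Hol N)) = 1 ∧
        (∃ u : ℤ, Odd u ∧ H = Subgroup.zpowers (⟨σ ^ u, powAut N (-1)⟩ : Hol N)) ∧
        Nat.card G = 2 ^ (e + 1) ∧
        (Hol.stab G).map G.subtype =
          Subgroup.zpowers (⟨1, powAut N (1 + 2 ^ (e - 1))⟩ : Hol N) ∧
        (8 ≤ Nat.card (G ⊓ Hol.base N : Subgroup (Hol N)) ∨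
          (Nat.card (G ⊓ Hol.base N : Subgroup (Hol N)) = 4 ∧
            Nat.card (⁅G, G⁆ : Subgroup (Hol N)) = 4))) := by
  have hA := Hol.subAffine_faithful hN hσ G
  have hs := (Hol.isPretransitive_iff_subAffine hN hσ).1 hG
  have hord : (∃ g ∈ G, orderOf g = 2 ^ e) ↔ ∃ g : G, orderOf g = 2 ^ e := by
    simp only [Subtype.exists, Subgroup.orderOf_mk, exists_prop]
  rw [Hol.isRealizable_iff hN hσ (H := H.subgroupOf G) hindex,
    hA.not_isAffineStabilizer_iff hs hindex, Hol.card_inf_base_of_le hN hσ hHG,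
    Hol.card_inf_base hN hσ, Hol.card_commutator, hord]
  refine or_congr_right <| or_congr_right <| or_congr_right <| and_congr_right fun _ => ?_
  -- The size condition forces e ≥ 3, so 1 + 2^(e-1) is odd and `powAut` is the genuine power map.
  -- If it fails, both forms of (iv) are false.
  by_cases hc : 8 ≤ Nat.card (Hol.subAffine hN hσ G).lin.ker ∨
      (Nat.card (Hol.subAffine hN hσ G).lin.ker = 4 ∧ Nat.card (commutator G) = 4)
  · have he : 3 ≤ e := hA.three_le (h := hc)
    rw [Hol.exists_reflection_iff hN hσ hHG (by omega), Hol.stab_eq_zpowers_iff hN hσ (by omega)]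
  · simp only [hc, and_false]
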